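/- Let $d\ge 1$, let $\Omega\subset\mathbb R^d$ be (the interior of) a convex polytope with nonempty interior, and write $\delta(x)=\operatorname{dist}(x,\partial\Omega)$. Let $s\in(0,1)$, $2s<\beta\le 4$ with $\beta,\ \beta-2s\notin\mathbb N_0$, $\bar\beta=\min\{\beta,2\}$, $\mu\ge 1$ and $0<\lambda\le\Lambda<\infty$. **Continuous problem.** Let $\eta:\mathbb S^{d-1}\to\mathbb R$ be measurable with $\eta(\theta)=\eta(-\theta)$ for all $\theta$ and $\lambda\le\eta\le\Lambda$ a.e., and suppose that $\eta\in C^k(\mathbb S^{d-1})$ for every integer $k\ge1$ with $k<\beta$. Put $$\mathcal L_\eta[w](x)=\mathrm{p.v.}\!\int_{\mathbb R^d}\frac{w(x)-w(y)}{|x-y|^{d+2s}}\,\eta\Big(\frac{x-y}{|x-y|}\Big)\,dy .$$ Let $f\in C^{\beta-2s}(\Omega)\cap L^\infty(\Omega)$ have finite weighted Hölder norm $\|f\|^{(s)}_{\beta-2s,\Omega}$; that is, with $\beta-2s=k+\gamma$, $k\in\mathbb N_0$, $\gamma\in(0,1)$, the quantities $\sup_\Omega\delta^{\ell+s}|D^\ell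 f|$ $(0\le\ell\le k)$ and $\sup_{x\ne y\in\Omega}\min\{\delta(x),\delta(y)\}^{\beta-s}\,|D^kf(x)-D^kf(y)|\,|x-y|^{-\gamma}$ are finite. Let $\widetilde H^s(\Omega)$ be the space of functions in $L^2(\Omega)$ whose extension by zero lies in $H^s(\mathbb R^d)$, and let $u\in\widetilde H^s(\Omega)$, extended by zero, be the weak solution of $\mathcal L_\eta[u]=f$ in $\Omega$, i.e. $$\frac12\iint_{\mathbb R^d\times\mathbb R^d}\frac{(u(x)-u(y))(v(x)-v(y))}{|x-y|^{d+2s}}\,\eta\Big(\frac{x-y}{|x-y|}\Big)\,dx\,dy=\int_\Omega f v\,dx\qquad\text{for all } v\in\widetilde H^s(\Omega).$$ Assume that $u\in\mathcal S^\beta(\Omega)$ with constant $M$: $u\in C^\beta(\Omega)$, $\|u\|_{C^{0,s}(\bar\Omega)}\le M$, and $\|u\|_{C^\beta(\{x\in\Omega:\delta(x)\ge\rho\})}\le M\rho^{s-\beta}$ for all $\rho>0$. **Mesh.** Let $h>0$ and let $\mathcal T$ be a conforming simplicial triangulation of $\Omega$ into finitely many closed simplices, shape regular with constant $\kappa>0$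 (every $T\in\mathcal T$ contains a ball of radius $\kappa h_T$, where $h_T=\operatorname{diam}T$) and graded with constant $c>0$: $$c^{-1}h^\mu\le h_T\le c\,h^\mu\ \text{ if } T\cap\partial\Omega\ne\emptyset,\qquad c^{-1}h\operatorname{dist}(T,\partial\Omega)^{\frac{\mu-1}{\mu}}\le h_T\le c\,h\operatorname{dist}(T,\partial\Omega)^{\frac{\mu-1}{\mu}}\ \text{ if } T\cap\partial\Omega=\emptyset .$$ For a vertex $z\in\Omega$ of $\mathcal T$ let $h_z$ be the radius of the largest ball centered at $z$ contained in the union of the elements containing $z$, and let $\bar\varepsilon(z)=\tfrac12h_z^{1/2}\delta(z)^{1/2}$. **Scheme.** For $\varepsilon>0$ let $\mathcal K_\varepsilon(r)=r^{-d-2s}$ for $r\ge\varepsilon$ and $\mathcal K_\varepsilon(r)=\varepsilon^{-d-2s}+\gamma_\varepsilon(r^2-\varepsilon^2)+\nu_\varepsilon(r^3-\varepsilon^3)$ for $r<\varepsilon$, where $$\gamma_\varepsilon=-\frac{(4+d)(d+2s)(3+d+2s)}{4(1-s)}\,\varepsilon^{-d-2s-2},\qquad \nu_\varepsilon=\frac{(5+d)(d+2s)(2+d+2s)}{6(1-s)}\,\varepsilon^{-d-2s-3},$$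 and put $$\mathcal L_{\eta,\varepsilon}[w](x)=\frac12\int_{\mathbb R^d}\big(2w(x)-w(x-y)-w(x+y)\big)\,\eta\Big(\frac{y}{|y|}\Big)\,\mathcal K_\varepsilon(|y|)\,dy .$$ Let $u_h\in C(\bar\Omega)$ be affine on every $T\in\mathcal T$, vanish on $\partial\Omega$, be extended by zero outside $\Omega$, and satisfy $\mathcal L_{\eta,\bar\varepsilon(z)}[u_h](z)=f(z)$ for every vertex $z\in\Omega$ of $\mathcal T$. Then $$\|u-u_h\|_{L^\infty(\Omega)}\le C\,\max\big\{h^{\mu s},\,h^{\bar\beta-s},\,h^{\beta/2-s}\big\},$$ where the constant $C$ depends only on $d,\Omega,s,\beta,\mu,\lambda,\Lambda,\kappa,c$ and $M$ (in particular, not on $h$ or on the mesh). -/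

import Mathlib

open MeasureTheory Set

noncomputable section

namespace TwoScale

/-- `ℝ^d` with the Euclidean norm. -/
abbrev Rd (d : ℕ) : Type := EuclideanSpace ℝ (Fin d)

variable {d : ℕ}

/-! ### The domain -/

/-- `Ω` is (the interior of) a convex polytope with nonempty interior. -/
def IsConvexPolytope (Ω : Set (Rd d)) : Prop :=
  Ω.Nonempty ∧ ∃ V : Finset (Rd d), Ω = interior (convexHull ℝ (V : Set (Rd d)))

/-- `δ(x) = dist(x, ∂Ω)`. -/
def bdist (Ω : Set (Rd d)) (x : Rd d) : ℝ := Metric.infDist x (frontier Ω)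

/-! ### Hölder spaces

All orders `β` that occur are positive and not integers, so `β = k + α` with `k = ⌊β⌋` and
`α = β - k ∈ (0, 1)`. -/

/-- `‖w‖_{C^β(A)} ≤ N`, for a set `A` contained in an open set on which `w` is of class `C^k`:
all derivatives of order at most `k` are bounded by `N` on `A`, and the `k`-th one is
`α`-Hölder on `A` with constant `N`. -/
def HolderNormLE (β : ℝ) (w : Rd d → ℝ) (A : Set (Rd d)) (N : ℝ) : Prop :=
  (∀ j : ℕ, j ≤ ⌊β⌋₊ → ∀ x ∈ A, ‖iteratedFDeriv ℝ j w x‖ ≤ N) ∧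
  ∀ x ∈ A, ∀ y ∈ A,
    ‖iteratedFDeriv ℝ ⌊β⌋₊ w x - iteratedFDeriv ℝ ⌊β⌋₊ w y‖ ≤ N * ‖x - y‖ ^ (β - (⌊β⌋₊ : ℝ))

/-- `w ∈ C^β(Ω)` for an open set `Ω`: `w` is of class `C^k` in `Ω` and its `C^β` norm is finite on
every compact subset of `Ω`. -/
def MemHolder (β : ℝ) (w : Rd d → ℝ) (Ω : Set (Rd d)) : Prop :=
  ContDiffOn ℝ (⌊β⌋₊ : ℕ) w Ω ∧
  ∀ A : Set (Rd d), IsCompact A → A ⊆ Ω → ∃ N : ℝ, HolderNormLE β w A N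

/-- `‖w‖_{β,Ω}^{(σ)} < ∞`, the weighted Hölder norm with weight exponent `σ ≥ 0`, for
`w ∈ C^k(Ω)`. The term of order `ℓ = 0` is `sup δ^σ |w|`. -/
def WeightedHolderFinite (β σ : ℝ) (w : Rd d → ℝ) (Ω : Set (Rd d)) : Prop :=
  ∃ N : ℝ,
    (∀ l : ℕ, l ≤ ⌊β⌋₊ → ∀ x ∈ Ω,
      bdist Ω x ^ ((l : ℝ) + σ) * ‖iteratedFDeriv ℝ l w x‖ ≤ N) ∧
    ∀ x ∈ Ω, ∀ y ∈ Ω,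
      min (bdist Ω x) (bdist Ω y) ^ (β + σ) *
        ‖iteratedFDeriv ℝ ⌊β⌋₊ w x - iteratedFDeriv ℝ ⌊β⌋₊ w y‖
          ≤ N * ‖x - y‖ ^ (β - (⌊β⌋₊ : ℝ))

/-- `w ∈ S^β(Ω)` with constant `M`: `w ∈ C^β(Ω)`, the norm of `w` in `C^{0,s}(closure Ω)` is at
most `M`, and `‖w‖_{C^β({x ∈ Ω : δ(x) ≥ ρ})} ≤ M ρ^{s-β}` for all `ρ > 0`. Being bounded and
`s`-Hölder on `Ω` is the same as having an extension in `C^{0,s}(closure Ω)` (with the same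
norm); no boundary values are prescribed here. -/
def MemSClass (s β : ℝ) (Ω : Set (Rd d)) (M : ℝ) (w : Rd d → ℝ) : Prop :=
  MemHolder β w Ω ∧ HolderNormLE s w Ω M ∧
  ∀ ρ : ℝ, 0 < ρ → HolderNormLE β w {x ∈ Ω | ρ ≤ bdist Ω x} (M * ρ ^ (s - β))

/-! ### The kernel -/

/-- The class `C(λ, Λ)` of (measurable) symmetric and elliptic functions on the unit sphere. -/
def KernelClass (lam Lam : ℝ) (η : Metric.sphere (0 : Rd d) 1 → ℝ) : Prop :=
  AEMeasurable η (volume : Measure (Rd d)).toSphere ∧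
  (∀ θ, η (-θ) = η θ) ∧
  ∀ᵐ θ ∂((volume : Measure (Rd d)).toSphere), lam ≤ η θ ∧ η θ ≤ Lam

/-- `y ↦ η(y/|y|)`, with the irrelevant value `0` at `y = 0`. -/
def angular (η : Metric.sphere (0 : Rd d) 1 → ℝ) (y : Rd d) : ℝ :=
  if h : y = 0 then 0 else η ⟨‖y‖⁻¹ • y, by
    rw [mem_sphere_zero_iff_norm, norm_smul, norm_inv, norm_norm,
      inv_mul_cancel₀ (norm_ne_zero_iff.mpr h)]⟩

/-- `η ∈ C^k(S^{d-1})`, through the extension of `η` that is homogeneous of degree zero. -/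
def KernelContDiff (k : ℕ) (η : Metric.sphere (0 : Rd d) 1 → ℝ) : Prop :=
  ContDiffOn ℝ k (angular η) {0}ᶜ

/-! ### The linear problem: weak solutions -/

/-- `v`, defined on all of `ℝ^d`, is the extension by zero of an element of the space
`H̃^s(Ω) = {v ∈ L²(Ω) : the extension by zero of v is in H^s(ℝ^d)}`. -/
def MemTildeH (s : ℝ) (Ω : Set (Rd d)) (v : Rd d → ℝ) : Prop :=
  (∀ x, x ∉ Ω → v x = 0) ∧ MemLp v 2 volume ∧
  Integrable (fun p : Rd d × Rd d => (v p.1 - v p.2) ^ 2 / ‖p.1 - p.2‖ ^ ((d : ℝ) + 2 * s))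
    volume

/-- `u ∈ H̃^s(Ω)` is the weak solution of `L_η[u] = f` in `Ω`, `u = 0` outside `Ω`, where
`L_η[w](x) = p.v. ∫ (w(x) - w(y)) |x-y|^{-d-2s} η((x-y)/|x-y|) dy`. The left-hand side below is
the pairing `⟨L_η[u], v⟩`. -/
def IsWeakSolution (s : ℝ) (η : Metric.sphere (0 : Rd d) 1 → ℝ) (Ω : Set (Rd d))
    (f u : Rd d → ℝ) : Prop :=
  MemTildeH s Ω u ∧ ∀ v : Rd d → ℝ, MemTildeH s Ω v →
    1 / 2 * ∫ p : Rd d × Rd d, (u p.1 - u p.2) * (v p.1 - v p.2) * angular η (p.1 - p.2)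
        / ‖p.1 - p.2‖ ^ ((d : ℝ) + 2 * s)
      = ∫ x in Ω, f x * v x

/-! ### The regularized operator -/

/-- The coefficient of `r² - ε²` in the regularized kernel. -/
def regGamma (d : ℕ) (s ε : ℝ) : ℝ :=
  -((4 + d) * (d + 2 * s) * (3 + d + 2 * s) / (4 * (1 - s))) * ε ^ (-(d : ℝ) - 2 * s - 2)

/-- The coefficient of `r³ - ε³` in the regularized kernel. -/
def regNu (d : ℕ) (s ε : ℝ) : ℝ :=
  (5 + d) * (d + 2 * s) * (2 + d + 2 * s) / (6 * (1 - s)) * ε ^ (-(d : ℝ) - 2 * s - 3)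

/-- The regularization of the radial kernel `r^{-d-2s}` at scale `ε`. -/
def regKernel (d : ℕ) (s ε r : ℝ) : ℝ :=
  if ε ≤ r then r ^ (-((d : ℝ) + 2 * s))
  else ε ^ (-((d : ℝ) + 2 * s)) + regGamma d s ε * (r ^ 2 - ε ^ 2)
    + regNu d s ε * (r ^ 3 - ε ^ 3)

/-- `L_{η,ε}[w](x)`. -/
def regOp (s : ℝ) (η : Metric.sphere (0 : Rd d) 1 → ℝ) (ε : ℝ) (w : Rd d → ℝ) (x : Rd d) : ℝ :=
  1 / 2 * ∫ y : Rd d,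
    (2 * w x - w (x - y) - w (x + y)) * angular η y * regKernel d s ε ‖y‖

/-! ### Meshes -/

/-- The elements of a mesh, given by their vertex sets: the `d`-simplices of the complex. -/
def elements (K : Geometry.SimplicialComplex ℝ (Rd d)) : Set (Finset (Rd d)) :=
  {t ∈ K.faces | t.card = d + 1}

/-- The closed simplex with vertex set `t`. -/
abbrev cell (t : Finset (Rd d)) : Set (Rd d) := convexHull ℝ (t : Set (Rd d))

/-- `K` is a conforming simplicial triangulation of `Ω`: a finite simplicial complex that covers
`closure Ω` and whose faces are the faces of its `d`-simplices. -/
def IsTriangulation (Ω : Set (Rd d)) (K : Geometry.SimplicialComplex ℝ (Rd d)) : Prop :=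
  K.faces.Finite ∧ K.space = closure Ω ∧ ∀ t ∈ K.faces, ∃ t' ∈ elements K, t ⊆ t'

/-- Shape regularity with constant `κ`: every element `T` contains a ball of radius `κ h_T`, with
`h_T = diam T`. -/
def ShapeRegular (κ : ℝ) (K : Geometry.SimplicialComplex ℝ (Rd d)) : Prop :=
  ∀ t ∈ elements K, ∃ a : Rd d, Metric.closedBall a (κ * Metric.diam (cell t)) ⊆ cell t

/-- `dist(A, B) = inf {|x - y| : x ∈ A, y ∈ B}`. -/
def setDist (A B : Set (Rd d)) : ℝ := sInf (Set.image2 dist A B)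

/-- The grading condition with mesh size `h`, parameter `μ` and equivalence constant `c`:
`h_T ≈ h^μ` if `T` touches `∂Ω`, and `h_T ≈ h dist(T, ∂Ω)^{(μ-1)/μ}` otherwise. -/
def IsGraded (Ω : Set (Rd d)) (μ c h : ℝ) (K : Geometry.SimplicialComplex ℝ (Rd d)) : Prop :=
  ∀ t ∈ elements K,
    ((cell t ∩ frontier Ω).Nonempty →
      c⁻¹ * h ^ μ ≤ Metric.diam (cell t) ∧ Metric.diam (cell t) ≤ c * h ^ μ) ∧
    (cell t ∩ frontier Ω = ∅ →
      c⁻¹ * (h * setDist (cell t) (frontier Ω) ^ ((μ - 1) / μ)) ≤ Metric.diam (cell t) ∧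
      Metric.diam (cell t) ≤ c * (h * setDist (cell t) (frontier Ω) ^ ((μ - 1) / μ)))

/-- The patch `ω_z`: the union of the elements that contain `z`. -/
def patch (K : Geometry.SimplicialComplex ℝ (Rd d)) (z : Rd d) : Set (Rd d) :=
  ⋃ t ∈ {t ∈ elements K | z ∈ cell t}, cell t

/-- `h_z`: the radius of the largest ball centered at `z` that is contained in `ω_z`. -/
def patchSize (K : Geometry.SimplicialComplex ℝ (Rd d)) (z : Rd d) : ℝ :=
  sSup {r : ℝ | Metric.ball z r ⊆ patch K z}

/-- The regularization scale `½ h_z^{1/2} δ(z)^{1/2}`. -/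
def regScale (Ω : Set (Rd d)) (K : Geometry.SimplicialComplex ℝ (Rd d)) (z : Rd d) : ℝ :=
  1 / 2 * patchSize K z ^ (1 / 2 : ℝ) * bdist Ω z ^ (1 / 2 : ℝ)

/-- `w`, extended by zero outside `Ω`, is a continuous function on `closure Ω` that vanishes on
`∂Ω` and is affine on every element. -/
def MemFE0 (Ω : Set (Rd d)) (K : Geometry.SimplicialComplex ℝ (Rd d)) (w : Rd d → ℝ) : Prop :=
  ContinuousOn w (closure Ω) ∧ (∀ x, x ∉ Ω → w x = 0) ∧
  ∀ t ∈ elements K, ∃ g : Rd d →ᵃ[ℝ] ℝ, EqOn w g (cell t)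

/-- `u_h` is a solution of the scheme: `u_h ∈ V_h^0` and `L_{η,ε(z)}[u_h](z) = f(z)` at every
interior vertex `z`, with `ε(z) = ½ h_z^{1/2} δ(z)^{1/2}`. -/
def IsDiscreteSolution (s : ℝ) (η : Metric.sphere (0 : Rd d) 1 → ℝ) (Ω : Set (Rd d))
    (K : Geometry.SimplicialComplex ℝ (Rd d)) (f uh : Rd d → ℝ) : Prop :=
  MemFE0 Ω K uh ∧ ∀ z ∈ K.vertices ∩ Ω, regOp s η (regScale Ω K z) uh z = f z

end TwoScale

end

/-!
# The maximum norm error of a two-scale discretization of the fractional Laplacian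

The error is estimated at the vertices by a discrete maximum principle, and between the vertices by
interpolation. Everything is measured in powers of `δ(z)`, the distance of a vertex to the boundary.

*Consistency.* A weak solution of class `S^β` satisfies `L_η[u] = f` at every interior point
(`MemSClass.singOp_eq`): the quadratic term of the second difference is controlled away from the
boundary, so the symmetric form, tested with smooth functions of small support, becomes the operator
in the limit of truncations of the diagonal. The coefficients of `K_ε` are such that `K_ε` has the
same second radial moment as the singular kernel. For `ε ≤ δ(z)/2` the quadratic part of the second
difference therefore drops out of `L_{η,ε}[u](z) - L_η[u](z)`, and what is left is
`O(δ(z)^{s-β} ε^{β-2s})` (`MemSClass.abs_regOp_sub_singOp_le`).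

*Boundary values.* Neither the class `S^β` nor, for `s < 1/2`, the energy space makes `u` vanish on
the boundary. The equation does: a nonzero boundary value would make `L_η[u]` blow up like `δ^{-2s}`,
against the boundedness of `f`. This gives `|u| ≤ M δ^s` (`MemSClass.abs_le_bdist_rpow`), which is
what the interpolation estimate needs near the boundary.

*Stability.* Convexity of `Ω` puts a ball of radius `δ(z)` at distance `δ(z)` from `z` into the
complement, namely the reflection of a ball in `Ω` through the boundary point nearest to `z`. A
function vanishing off `Ω` with nearly maximal value `m ≥ 0` at `z` therefore has
`L_{η,ε}[w](z) ≥ C m δ(z)^{-2s}` up to the deviation from maximality (`regOp_lower_bound`). This takes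
the place of a barrier function.

*Conclusion.* Let `m` be the largest nodal value of `w = u - u_h`, attained at `z`. Between the
vertices `w` exceeds `m` at most by the interpolation error, which is `h^{min β 2} δ(z)^{s - min β 2/μ}`
near `z` and of the order of the final rate elsewhere (`exists_interpError_const`). Comparing with the
consistency error bounds `m` (`exists_nodal_const`): with `h_z ≈ h δ(z)^{(μ-1)/μ}` and `δ(z) ≳ h^μ`
(`exists_meshBounds`), both contributions take the form `h^p δ(z)^{s-p/μ}` with `p = β/2 - s` and
`p = min β 2 - s`, which is at most a multiple of `max (h^{μ s}) (h^p)`. This is the one-sided bound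
`exists_one_sided_const`; applied to `u - u_h` and to `u_h - u`, it gives the theorem.
-/

noncomputable section

namespace TwoScale

variable {d : ℕ}

/-! ### Convex domains and the distance to the boundary -/

/-- The properties of the interior of a convex polytope that matter for the error estimate: a
nonempty bounded open convex set with nonempty boundary. -/
structure ConvexDomain (Ω : Set (Rd d)) : Prop where
  isOpen : IsOpen Ω
  convex : Convex ℝ Ω
  isBounded : Bornology.IsBounded Ω
  nonempty : Ω.Nonempty
  frontier_nonempty : (frontier Ω).Nonempty

lemma IsConvexPolytope.convexDomain (hd : 1 ≤ d) {Ω : Set (Rd d)} (h : IsConvexPolytope Ω) :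
    ConvexDomain Ω := by
  obtain ⟨hne, V, rfl⟩ := h
  have hb : Bornology.IsBounded (interior (convexHull ℝ (V : Set (Rd d)))) :=
    ((isBounded_convexHull).2 V.finite_toSet.isBounded).subset interior_subset
  refine ⟨isOpen_interior, (convex_convexHull ℝ _).interior, hb, hne, ?_⟩
  rw [nonempty_frontier_iff]
  refine ⟨hne, fun hu => ?_⟩
  have : Nonempty (Fin d) := ⟨⟨0, hd⟩⟩
  have : Nontrivial (Rd d) := inferInstance
  rw [hu] at hb
  exact NormedSpace.unbounded_univ ℝ (Rd d) hb

variable {Ω : Set (Rd d)}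

namespace ConvexDomain

lemma interior_closure (hΩ : ConvexDomain Ω) : interior (closure Ω) = Ω := by
  rw [hΩ.convex.interior_closure_eq_interior_of_nonempty_interior, hΩ.isOpen.interior_eq]
  rw [hΩ.isOpen.interior_eq]; exact hΩ.nonempty

lemma notMem_of_mem_frontier (hΩ : ConvexDomain Ω) {x : Rd d} (hx : x ∈ frontier Ω) : x ∉ Ω := by
  rw [hΩ.isOpen.frontier_eq] at hx; exact hx.2

lemma mem_frontier_of_mem_closure (_hΩ : ConvexDomain Ω) {x : Rd d} (hx : x ∈ closure Ω)
    (hx' : x ∉ Ω) : x ∈ frontier Ω := ⟨hx, fun h => hx' (interior_subset h)⟩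

lemma bdist_pos (hΩ : ConvexDomain Ω) {x : Rd d} (hx : x ∈ Ω) : 0 < bdist Ω x :=
  (isClosed_frontier.notMem_iff_infDist_pos hΩ.frontier_nonempty).1
    fun h => hΩ.notMem_of_mem_frontier h hx

lemma ball_subset (hΩ : ConvexDomain Ω) {x : Rd d} (hx : x ∈ Ω) :
    Metric.ball x (bdist Ω x) ⊆ Ω := by
  have hpre : IsPreconnected (Metric.ball x (bdist Ω x)) := (convex_ball _ _).isPreconnected
  have hdis : Metric.ball x (bdist Ω x) ∩ frontier Ω = ∅ :=
    Set.disjoint_iff_inter_eq_empty.1 Metric.disjoint_ball_infDist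
  have hcl : ∀ w ∈ Metric.ball x (bdist Ω x), w ∉ Ω → w ∈ (closure Ω)ᶜ := fun w hw hwΩ hwc =>
    (hdis.subset ⟨hw, hΩ.mem_frontier_of_mem_closure hwc hwΩ⟩ : w ∈ (∅ : Set (Rd d)))
  intro w hw
  by_contra hwΩ
  obtain ⟨v, -, hv, hv'⟩ := hpre Ω (closure Ω)ᶜ hΩ.isOpen isClosed_closure.isOpen_compl
    (fun w hw => or_iff_not_imp_left.2 (hcl w hw)) ⟨x, Metric.mem_ball_self (hΩ.bdist_pos hx), hx⟩
    ⟨w, hw, hcl w hw hwΩ⟩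
  exact hv' (subset_closure hv)

lemma le_bdist_of_ball_subset (hΩ : ConvexDomain Ω) {x : Rd d} {r : ℝ}
    (h : Metric.ball x r ⊆ Ω) : r ≤ bdist Ω x := by
  refine (Metric.le_infDist hΩ.frontier_nonempty).2 fun y hy => ?_
  by_contra hlt
  refine hΩ.notMem_of_mem_frontier hy (h ?_)
  rw [Metric.mem_ball, dist_comm]; exact not_le.1 hlt

lemma exists_frontier_dist_eq (hΩ : ConvexDomain Ω) (x : Rd d) :
    ∃ q ∈ frontier Ω, bdist Ω x = dist x q :=
  isClosed_frontier.exists_infDist_eq_dist hΩ.frontier_nonempty x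

/-- The point reflection through a boundary point maps a convex open set into its complement. -/
lemma reflection_notMem (hΩ : ConvexDomain Ω) {q a : Rd d} (hq : q ∈ frontier Ω) (ha : a ∈ Ω) :
    (2 : ℝ) • q - a ∉ Ω := by
  intro h
  apply hΩ.notMem_of_mem_frontier hq
  have := hΩ.convex ha h (by norm_num : (0 : ℝ) ≤ 1 / 2) (by norm_num : (0 : ℝ) ≤ 1 / 2)
    (by norm_num)
  convert this using 1
  module

lemma exists_ball_compl (hΩ : ConvexDomain Ω) {z : Rd d} (hz : z ∈ Ω) :
    ∃ p : Rd d, ‖p‖ = 2 * bdist Ω z ∧ ∀ y ∈ Metric.ball p (bdist Ω z), z + y ∉ Ω := by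
  obtain ⟨q, hq, hqz⟩ := hΩ.exists_frontier_dist_eq z
  refine ⟨(2 : ℝ) • (q - z), ?_, fun y hy hmem => ?_⟩
  · rw [norm_smul, ← dist_eq_norm, dist_comm q z, ← hqz]; norm_num
  · have h1 : (2 : ℝ) • q - (z + y) ∈ Ω := by
      apply hΩ.ball_subset hz
      rw [mem_ball_iff_norm] at hy ⊢
      rwa [show (2 : ℝ) • q - (z + y) - z = -(y - (2 : ℝ) • (q - z)) by module, norm_neg]
    exact hΩ.reflection_notMem hq h1 (by convert hmem using 1; module)

lemma le_bdist_add (_hΩ : ConvexDomain Ω) (x y : Rd d) : bdist Ω x ≤ bdist Ω y + ‖x - y‖ := by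
  rw [← dist_eq_norm]; exact Metric.infDist_le_infDist_add_dist

lemma convex_superlevel (hΩ : ConvexDomain Ω) (ρ : ℝ) :
    Convex ℝ {x ∈ Ω | ρ ≤ bdist Ω x} := by
  intro x hx y hy a b ha hb hab
  refine ⟨hΩ.convex hx.1 hy.1 ha hb hab, hΩ.le_bdist_of_ball_subset fun w hw => ?_⟩
  have hx' : x + (w - (a • x + b • y)) ∈ Ω := by
    apply hΩ.ball_subset hx.1
    rw [mem_ball_iff_norm] at hw ⊢
    rw [add_sub_cancel_left]; exact hw.trans_le hx.2
  have hy' : y + (w - (a • x + b • y)) ∈ Ω := by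
    apply hΩ.ball_subset hy.1
    rw [mem_ball_iff_norm] at hw ⊢
    rw [add_sub_cancel_left]; exact hw.trans_le hy.2
  have := hΩ.convex hx' hy' ha hb hab
  convert this using 1
  obtain rfl : b = 1 - a := by linarith
  module

lemma ball_half_bdist (hΩ : ConvexDomain Ω) {z x : Rd d}
    (hx : ‖x - z‖ ≤ bdist Ω z / 2) : bdist Ω z / 2 ≤ bdist Ω x := by
  have := hΩ.le_bdist_add z x
  rw [norm_sub_rev] at this
  linarith

lemma add_mem (hΩ : ConvexDomain Ω) {z y : Rd d} (hz : z ∈ Ω)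
    (hy : ‖y‖ ≤ bdist Ω z / 2) : z + y ∈ Ω := by
  apply hΩ.ball_subset hz
  rw [mem_ball_iff_norm, add_sub_cancel_left]
  linarith [hΩ.bdist_pos hz]

end ConvexDomain

/-! ### Taylor expansion along segments -/

/-- Taylor's formula with a remainder controlled by the oscillation of the last derivative. -/
lemma abs_taylor_remainder_le (k : ℕ) : ∀ (g : ℕ → ℝ → ℝ) (N : ℝ),
    (∀ j < k, ∀ t ∈ Icc (0 : ℝ) 1, HasDerivAt (g j) (g (j + 1) t) t) →
    (∀ t ∈ Icc (0 : ℝ) 1, |g k t - g k 0| ≤ N) →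
    ∀ t ∈ Icc (0 : ℝ) 1,
      |g 0 t - ∑ j ∈ Finset.range (k + 1), g j 0 * t ^ j / (j.factorial : ℝ)| ≤ N := by
  induction k with
  | zero => intro g N _ h t ht; simpa using h t ht
  | succ k ih =>
    intro g N hg h t ht
    have hN : 0 ≤ N := (abs_nonneg _).trans (h t ht)
    have ih' := ih (fun j => g (j + 1)) N (fun j hj t ht => hg (j + 1) (by omega) t ht) h
    set R : ℝ → ℝ := fun t => g 0 t -
      ∑ j ∈ Finset.range (k + 1 + 1), g j 0 * t ^ j / (j.factorial : ℝ) with hR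
    have hder : ∀ t ∈ Icc (0 : ℝ) 1, HasDerivWithinAt R
        (g 1 t - ∑ j ∈ Finset.range (k + 1), g (j + 1) 0 * t ^ j / (j.factorial : ℝ))
        (Icc 0 1) t := by
      intro t ht
      refine HasDerivAt.hasDerivWithinAt ?_
      refine (hg 0 (by omega) t ht).sub ?_
      have : ∀ j ∈ Finset.range (k + 1 + 1), HasDerivAt
          (fun t : ℝ => g j 0 * t ^ j / (j.factorial : ℝ))
          (g j 0 * (j * t ^ (j - 1)) / (j.factorial : ℝ)) t := fun j _ =>
        ((hasDerivAt_pow j t).const_mul _).div_const _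
      have h2 := HasDerivAt.fun_sum this
      convert h2 using 1
      rw [Finset.sum_range_succ' _ (k + 1)]
      rw [show g 0 0 * (((0 : ℕ) : ℝ) * t ^ (0 - 1)) / ((Nat.factorial 0 : ℕ) : ℝ) = 0 by simp,
        add_zero]
      refine Finset.sum_congr rfl fun j _ => ?_
      rw [Nat.factorial_succ, Nat.add_sub_cancel]
      push_cast
      have : (j.factorial : ℝ) ≠ 0 := by positivity
      field_simp
    have := norm_image_sub_le_of_norm_deriv_le_segment' (f := R) (C := N) (a := 0) (b := 1) hder
      (fun x hx => ih' x ⟨hx.1, hx.2.le⟩) t ht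
    have h0 : R 0 = 0 := by
      simp only [hR]
      rw [Finset.sum_range_succ']
      simp
    rw [h0, sub_zero, sub_zero] at this
    exact this.trans (mul_le_of_le_one_right hN ht.2)

/-- `t ↦ D^j w(x + t y)(y, …, y)`. -/
def lineDer (w : Rd d → ℝ) (x y : Rd d) (j : ℕ) (t : ℝ) : ℝ :=
  iteratedFDeriv ℝ j w (x + t • y) fun _ => y

lemma hasDerivAt_lineDer {w : Rd d → ℝ} {k : ℕ} (hΩ : IsOpen Ω) (hw : ContDiffOn ℝ k w Ω)
    {x y : Rd d} {j : ℕ} (hj : j < k) {t : ℝ} (ht : x + t • y ∈ Ω) :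
    HasDerivAt (lineDer w x y j) (lineDer w x y (j + 1) t) t := by
  have hc : ContDiffAt ℝ k w (x + t • y) := hw.contDiffAt (hΩ.mem_nhds ht)
  have hdiff : DifferentiableAt ℝ (iteratedFDeriv ℝ j w) (x + t • y) :=
    hc.differentiableAt_iteratedFDeriv (by exact_mod_cast hj)
  have hline : HasDerivAt (fun t : ℝ => x + t • y) y t := by
    simpa using ((hasDerivAt_id t).smul_const y).const_add x
  have h1 := hdiff.hasFDerivAt.comp_hasDerivAt t hline
  have h2 := ((ContinuousMultilinearMap.apply ℝ (fun _ : Fin j => Rd d) ℝ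
    (fun _ => y)).hasFDerivAt.comp_hasDerivAt t h1)
  have h3 : lineDer w x y (j + 1) t =
      (fderiv ℝ (iteratedFDeriv ℝ j w) (x + t • y)) y fun _ => y := by
    rw [lineDer, iteratedFDeriv_succ_apply_left]; rfl
  rw [h3]
  exact h2

lemma abs_lineDer_sub_le (w : Rd d → ℝ) (x y : Rd d) (k : ℕ) (t t' : ℝ) :
    |lineDer w x y k t - lineDer w x y k t'| ≤
      ‖iteratedFDeriv ℝ k w (x + t • y) - iteratedFDeriv ℝ k w (x + t' • y)‖ * ‖y‖ ^ k := by
  have := (iteratedFDeriv ℝ k w (x + t • y) - iteratedFDeriv ℝ k w (x + t' • y)).le_opNorm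
    (fun _ => y)
  simpa [lineDer] using this

/-! ### Second differences of functions of class `S^β` -/

/-- The symmetric second difference `2w(x) - w(x-y) - w(x+y)`. -/
def secDiff (w : Rd d → ℝ) (x y : Rd d) : ℝ := 2 * w x - w (x - y) - w (x + y)

/-- The quadratic term of the second difference: `D²w(x)(y, y)` if `w` is at least twice
differentiable, i.e. if `β ≥ 2`, and `0` otherwise. -/
def quadTerm (β : ℝ) (w : Rd d → ℝ) (x y : Rd d) : ℝ :=
  if 2 ≤ ⌊β⌋₊ then lineDer w x y 2 0 else 0

lemma lineDer_smul (w : Rd d → ℝ) (x y : Rd d) (j : ℕ) (c : ℝ) :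
    lineDer w x (c • y) j 0 = c ^ j * lineDer w x y j 0 := by
  have := (iteratedFDeriv ℝ j w x).map_smul_univ (fun _ => c) (fun _ => y)
  simpa [lineDer] using this

lemma lineDer_neg (w : Rd d → ℝ) (x y : Rd d) (j : ℕ) :
    lineDer w x (-y) j 0 = (-1) ^ j * lineDer w x y j 0 := by
  rw [← lineDer_smul]; simp

lemma lineDer_zero (w : Rd d → ℝ) (x y : Rd d) (t : ℝ) : lineDer w x y 0 t = w (x + t • y) := by
  simp [lineDer]

lemma quadTerm_smul (β : ℝ) (w : Rd d → ℝ) (x y : Rd d) (c : ℝ) :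
    quadTerm β w x (c • y) = c ^ 2 * quadTerm β w x y := by
  unfold quadTerm
  split_ifs
  · exact lineDer_smul ..
  · simp

lemma quadTerm_continuous (β : ℝ) (w : Rd d → ℝ) (x : Rd d) : Continuous (quadTerm β w x) := by
  unfold quadTerm
  split_ifs
  · unfold lineDer
    simp only [zero_smul, add_zero]
    exact (iteratedFDeriv ℝ 2 w x).cont.comp (by fun_prop)
  · exact continuous_const

namespace MemSClass

variable {s β M : ℝ} {w : Rd d → ℝ}

lemma abs_le (h : MemSClass s β Ω M w) {x : Rd d} (hx : x ∈ Ω) : |w x| ≤ M := by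
  simpa using h.2.1.1 0 (Nat.zero_le _) x hx

lemma abs_sub_le (h : MemSClass s β Ω M w) (hs : s ∈ Ioo (0 : ℝ) 1) {x y : Rd d} (hx : x ∈ Ω)
    (hy : y ∈ Ω) : |w x - w y| ≤ M * ‖x - y‖ ^ s := by
  have := h.2.1.2 x hx y hy
  rw [Nat.floor_eq_zero.2 hs.2] at this
  rw [← iteratedFDeriv_zero_apply (𝕜 := ℝ) (f := w) (x := x) (0 : Fin 0 → Rd d),
    ← iteratedFDeriv_zero_apply (𝕜 := ℝ) (f := w) (x := y) (0 : Fin 0 → Rd d)]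
  refine (le_trans ?_ (this.trans_eq (by simp)))
  have h2 := (iteratedFDeriv ℝ 0 w x - iteratedFDeriv ℝ 0 w y).le_opNorm (0 : Fin 0 → Rd d)
  simpa using h2

lemma nonneg (h : MemSClass s β Ω M w) (hΩ : ConvexDomain Ω) : 0 ≤ M :=
  (abs_nonneg _).trans (h.abs_le hΩ.nonempty.some_mem)

/-- Taylor's formula of order `⌊β⌋` along a segment at distance at least `ρ` from the boundary. -/
lemma abs_taylor_le (h : MemSClass s β Ω M w) (hΩ : ConvexDomain Ω) (hβ : 0 < β) {ρ : ℝ}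
    (hρ : 0 < ρ) {x y : Rd d}
    (hxy : ∀ t ∈ Icc (0 : ℝ) 1, x + t • y ∈ Ω ∧ ρ ≤ bdist Ω (x + t • y)) :
    |w (x + y) - ∑ j ∈ Finset.range (⌊β⌋₊ + 1), lineDer w x y j 0 / (j.factorial : ℝ)| ≤
      M * ρ ^ (s - β) * ‖y‖ ^ β := by
  have hM := h.nonneg hΩ
  have hα : 0 ≤ β - (⌊β⌋₊ : ℝ) := sub_nonneg.2 (Nat.floor_le hβ.le)
  have key := abs_taylor_remainder_le ⌊β⌋₊ (lineDer w x y) (M * ρ ^ (s - β) * ‖y‖ ^ β)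
    (fun j hj t ht => hasDerivAt_lineDer hΩ.isOpen h.1.1 hj (hxy t ht).1) ?_ 1 (by simp)
  · simpa [lineDer_zero] using key
  · intro t ht
    refine (abs_lineDer_sub_le w x y _ t 0).trans ?_
    have h0 := (h.2.2 ρ hρ).2 (x + t • y) (hxy t ht) (x + (0 : ℝ) • y) (hxy 0 (by simp))
    have h1 : ‖x + t • y - (x + (0 : ℝ) • y)‖ ≤ ‖y‖ := by
      rw [zero_smul, add_zero, add_sub_cancel_left, norm_smul, Real.norm_of_nonneg ht.1]
      exact mul_le_of_le_one_left (norm_nonneg _) ht.2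
    have h2 : ‖y‖ ^ (β - (⌊β⌋₊ : ℝ)) * ‖y‖ ^ ⌊β⌋₊ = ‖y‖ ^ β := by
      rw [← Real.rpow_natCast, ← Real.rpow_add' (norm_nonneg _) (by simpa using hβ.ne')]
      simp
    calc _ ≤ M * ρ ^ (s - β) * ‖y‖ ^ (β - (⌊β⌋₊ : ℝ)) * ‖y‖ ^ ⌊β⌋₊ := by
            gcongr
            exact h0.trans (by gcongr)
      _ = _ := by rw [mul_assoc, h2]

lemma abs_secDiff_add_quadTerm_le (h : MemSClass s β Ω M w) (hΩ : ConvexDomain Ω) (hβ : 0 < β)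
    (hβ4 : β < 4) {z y : Rd d} (hz : z ∈ Ω) (hy : ‖y‖ ≤ bdist Ω z / 2) :
    |secDiff w z y + quadTerm β w z y| ≤ 2 * M * (bdist Ω z / 2) ^ (s - β) * ‖y‖ ^ β := by
  have hρ : 0 < bdist Ω z / 2 := half_pos (hΩ.bdist_pos hz)
  have hseg : ∀ y : Rd d, ‖y‖ ≤ bdist Ω z / 2 → ∀ t ∈ Icc (0 : ℝ) 1,
      z + t • y ∈ Ω ∧ bdist Ω z / 2 ≤ bdist Ω (z + t • y) := by
    intro y hy t ht
    have : ‖t • y‖ ≤ bdist Ω z / 2 := by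
      rw [norm_smul, Real.norm_of_nonneg ht.1]
      exact (mul_le_of_le_one_left (norm_nonneg _) ht.2).trans hy
    exact ⟨hΩ.add_mem hz this, hΩ.ball_half_bdist (by simpa using this)⟩
  have h1 := h.abs_taylor_le hΩ hβ hρ (hseg y hy)
  have h2 := h.abs_taylor_le hΩ hβ hρ (hseg (-y) (by simpa using hy))
  rw [norm_neg] at h2
  have hk : ⌊β⌋₊ < 4 := (Nat.floor_lt hβ.le).2 (by exact_mod_cast hβ4)
  have h0 : lineDer w z y 0 0 = w z := by simp [lineDer_zero]
  have hsum : ∑ j ∈ Finset.range (⌊β⌋₊ + 1), lineDer w z y j 0 / (j.factorial : ℝ) +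
      ∑ j ∈ Finset.range (⌊β⌋₊ + 1), lineDer w z (-y) j 0 / (j.factorial : ℝ) =
      2 * w z + quadTerm β w z y := by
    rw [← Finset.sum_add_distrib, ← h0]
    simp only [lineDer_neg, quadTerm]
    generalize ⌊β⌋₊ = k at hk
    interval_cases k <;> simp [Finset.sum_range_succ, Nat.factorial] <;> ring
  have : secDiff w z y + quadTerm β w z y =
      -((w (z + y) - ∑ j ∈ Finset.range (⌊β⌋₊ + 1), lineDer w z y j 0 / (j.factorial : ℝ)) +
      (w (z + -y) - ∑ j ∈ Finset.range (⌊β⌋₊ + 1), lineDer w z (-y) j 0 / (j.factorial : ℝ))) := by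
    rw [secDiff, sub_eq_add_neg z y]; linarith
  rw [this, abs_neg]
  refine (abs_add_le _ _).trans ?_
  linarith

lemma abs_secDiff_le_holder (h : MemSClass s β Ω M w) (hΩ : ConvexDomain Ω)
    (hs : s ∈ Ioo (0 : ℝ) 1) {z y : Rd d} (hz : z ∈ Ω) (hy : ‖y‖ ≤ bdist Ω z / 2) :
    |secDiff w z y| ≤ 2 * M * ‖y‖ ^ s := by
  have h1 := h.abs_sub_le hs hz (hΩ.add_mem hz hy)
  have h2 := h.abs_sub_le hs hz (hΩ.add_mem (y := -y) hz (by simpa using hy))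
  simp only [sub_add_cancel_left, norm_neg, neg_neg] at h1 h2
  rw [← sub_eq_add_neg] at h2
  rw [show secDiff w z y = (w z - w (z + y)) + (w z - w (z - y)) by rw [secDiff]; ring]
  refine (abs_add_le _ _).trans ?_
  linarith

/-- The norms of order two in the definition of `S^β` scale like `ρ^{s-β}`; that the second
derivative is in fact of order `ρ^{s-2}` follows by interpolation between the `C^{0,s}` and the
`C^β` bounds, i.e. by evaluating Taylor's formula at the distance `ρ`. -/
lemma abs_quadTerm_le (h : MemSClass s β Ω M w) (hΩ : ConvexDomain Ω) (hs : s ∈ Ioo (0 : ℝ) 1)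
    (hβ : 0 < β) (hβ4 : β < 4) {z : Rd d} (hz : z ∈ Ω) (y : Rd d) :
    |quadTerm β w z y| ≤ 4 * M * (bdist Ω z / 2) ^ (s - 2) * ‖y‖ ^ 2 := by
  have hM := h.nonneg hΩ
  set ρ := bdist Ω z / 2 with hρdef
  have hρ : 0 < ρ := half_pos (hΩ.bdist_pos hz)
  rcases eq_or_ne y 0 with rfl | hy0
  · have := quadTerm_smul β w z (0 : Rd d) 0
    simp only [zero_smul] at this
    rw [this]; simp
  have hyp : 0 < ‖y‖ := norm_pos_iff.2 hy0
  set y' : Rd d := (ρ / ‖y‖) • y with hy'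
  have hn : ‖y'‖ = ρ := by
    rw [hy', norm_smul, Real.norm_of_nonneg (by positivity)]; field_simp
  have h1 := h.abs_secDiff_add_quadTerm_le hΩ hβ hβ4 hz (hn.le)
  have h2 := h.abs_secDiff_le_holder hΩ hs hz (hn.le)
  rw [hn] at h1 h2
  rw [← hρdef, mul_assoc (2 * M), ← Real.rpow_add hρ, sub_add_cancel] at h1
  have h3 : |quadTerm β w z y'| ≤ 4 * M * ρ ^ s := by
    rw [show quadTerm β w z y' = (secDiff w z y' + quadTerm β w z y') - secDiff w z y' by ring]
    refine (abs_sub _ _).trans ?_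
    linarith
  rw [hy', quadTerm_smul, abs_mul, abs_of_nonneg (by positivity)] at h3
  have h4 : ρ ^ (s - 2) = ρ ^ s / ρ ^ 2 := by
    rw [Real.rpow_sub hρ]; norm_num
  rw [h4]
  rw [div_pow, div_mul_eq_mul_div, div_le_iff₀ (by positivity)] at h3
  rw [show 4 * M * (ρ ^ s / ρ ^ 2) * ‖y‖ ^ 2 = (4 * M * ρ ^ s * ‖y‖ ^ 2) / ρ ^ 2 by ring,
    le_div_iff₀ (by positivity)]
  linarith

lemma abs_secDiff_le (h : MemSClass s β Ω M w) (hΩ : ConvexDomain Ω) (hs : s ∈ Ioo (0 : ℝ) 1)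
    (hβ : 0 < β) (hβ4 : β < 4) {z y : Rd d} (hz : z ∈ Ω) (hy : ‖y‖ ≤ bdist Ω z / 2) :
    |secDiff w z y| ≤ 6 * M * (bdist Ω z / 2) ^ (s - min β 2) * ‖y‖ ^ min β 2 := by
  have hM := h.nonneg hΩ
  have h1 := h.abs_secDiff_add_quadTerm_le hΩ hβ hβ4 hz hy
  have h2 := h.abs_quadTerm_le hΩ hs hβ hβ4 hz y
  set ρ := bdist Ω z / 2 with hρdef
  have hρ : 0 < ρ := half_pos (hΩ.bdist_pos hz)
  rcases lt_or_ge β 2 with hlt | hge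
  · have hk : ¬ 2 ≤ ⌊β⌋₊ := not_le.2 ((Nat.floor_lt hβ.le).2 (by exact_mod_cast hlt))
    rw [quadTerm, if_neg hk, add_zero] at h1
    rw [min_eq_left hlt.le]
    refine h1.trans ?_
    gcongr
    norm_num
  · rw [min_eq_right hge]
    have h3 : ρ ^ (s - β) * ‖y‖ ^ β ≤ ρ ^ (s - 2) * ‖y‖ ^ (2 : ℝ) := by
      have e1 : ‖y‖ ^ β = ‖y‖ ^ (2 : ℝ) * ‖y‖ ^ (β - 2) := by
        rw [← Real.rpow_add' (norm_nonneg _) (by simpa using hβ.ne')]; ring_nf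
      have e2 : ρ ^ (s - 2) = ρ ^ (s - β) * ρ ^ (β - 2) := by
        rw [← Real.rpow_add hρ]; ring_nf
      rw [e1, e2]
      have := Real.rpow_le_rpow (norm_nonneg y) hy (sub_nonneg.2 hge)
      calc _ = ρ ^ (s - β) * ‖y‖ ^ (2 : ℝ) * ‖y‖ ^ (β - 2) := by ring
        _ ≤ ρ ^ (s - β) * ‖y‖ ^ (2 : ℝ) * ρ ^ (β - 2) := by gcongr
        _ = _ := by ring
    have h4 : |secDiff w z y| ≤ 2 * M * ρ ^ (s - β) * ‖y‖ ^ β + 4 * M * ρ ^ (s - 2) * ‖y‖ ^ 2 := by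
      rw [show secDiff w z y = (secDiff w z y + quadTerm β w z y) - quadTerm β w z y by ring]
      exact (abs_sub _ _).trans (add_le_add h1 h2)
    rw [Real.rpow_two] at *
    nlinarith [mul_le_mul_of_nonneg_left h3 (by positivity : 0 ≤ 2 * M)]

/-- A first order Taylor expansion with the largest remainder exponent `min β 2`. -/
lemma exists_linear_approx (h : MemSClass s β Ω M w) (hΩ : ConvexDomain Ω)
    (hs : s ∈ Ioo (0 : ℝ) 1) (hβs : s < β) (hβ4 : β < 4) {ρ : ℝ} (hρ : 0 < ρ) (x : Rd d) :
    ∃ L : Rd d →ₗ[ℝ] ℝ, ∀ y : Rd d,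
      (∀ t ∈ Icc (0 : ℝ) 1, x + t • y ∈ Ω ∧ ρ ≤ bdist Ω (x + t • y)) →
      |w (x + y) - w x - L y| ≤ 10 * M * (ρ / 2) ^ (s - min β 2) * ‖y‖ ^ min β 2 := by
  have hβ : 0 < β := hs.1.trans hβs
  have hM := h.nonneg hΩ
  have hmono : ρ ^ (s - β) ≤ (ρ / 2) ^ (s - β) :=
    Real.rpow_le_rpow_of_nonpos (by positivity) (by linarith) (by linarith)
  have hweak : ∀ y : Rd d, M * ρ ^ (s - β) * ‖y‖ ^ β ≤
      10 * M * (ρ / 2) ^ (s - β) * ‖y‖ ^ β := fun y => by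
    gcongr
    linarith
  have hL : ∀ y, fderiv ℝ w x y = lineDer w x y 1 0 := fun y => by simp [lineDer]
  rcases lt_or_ge β 1 with h1 | h1
  · refine ⟨0, fun y hy => ?_⟩
    have := h.abs_taylor_le hΩ hβ hρ hy
    rw [Nat.floor_eq_zero.2 h1] at this
    rw [min_eq_left (by linarith)]
    refine le_trans ?_ (hweak y)
    simpa [lineDer_zero] using this
  refine ⟨(fderiv ℝ w x).toLinearMap, fun y hy => ?_⟩
  rw [ContinuousLinearMap.coe_coe, hL]
  rcases lt_or_ge β 2 with h2 | h2
  · have := h.abs_taylor_le hΩ hβ hρ hy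
    have hk : ⌊β⌋₊ = 1 := (Nat.floor_eq_iff hβ.le).2 ⟨by simpa using h1, by norm_num; linarith⟩
    rw [hk] at this
    rw [min_eq_left h2.le]
    refine le_trans ?_ (hweak y)
    simpa [Finset.sum_range_succ, lineDer_zero, sub_sub] using this
  · rw [min_eq_right h2]
    have hk : 2 ≤ ⌊β⌋₊ := Nat.le_floor (by exact_mod_cast h2)
    have hq : ∀ t ∈ Icc (0 : ℝ) 1, |lineDer w x y 2 t| ≤ 4 * M * (ρ / 2) ^ (s - 2) * ‖y‖ ^ 2 := by
      intro t ht
      have := h.abs_quadTerm_le hΩ hs hβ hβ4 (hy t ht).1 y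
      rw [quadTerm, if_pos hk] at this
      rw [show lineDer w x y 2 t = lineDer w (x + t • y) y 2 0 by simp [lineDer]]
      refine this.trans ?_
      have : (bdist Ω (x + t • y) / 2) ^ (s - 2) ≤ (ρ / 2) ^ (s - 2) :=
        Real.rpow_le_rpow_of_nonpos (by positivity) (by linarith [(hy t ht).2])
          (by linarith [hs.2])
      gcongr
    have key := abs_taylor_remainder_le 2 (lineDer w x y)
      (2 * (4 * M * (ρ / 2) ^ (s - 2) * ‖y‖ ^ 2))
      (fun j hj t ht => hasDerivAt_lineDer hΩ.isOpen h.1.1 (hj.trans_le hk) (hy t ht).1)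
      (fun t ht => (abs_sub _ _).trans (by linarith [hq t ht, hq 0 (by simp)])) 1 (by simp)
    have h0 := hq 0 (by simp)
    simp only [Finset.sum_range_succ, Finset.range_zero, Finset.sum_empty, lineDer_zero,
      one_smul, zero_smul, add_zero, one_pow, mul_one, Nat.factorial, zero_add, Nat.cast_one,
      div_one] at key
    rw [Real.rpow_two]
    rw [_root_.abs_le] at key h0 ⊢
    push_cast at key
    constructor <;> linarith [key.1, key.2, h0.1, h0.2]

end MemSClass

/-! ### The angular factor of the kernel -/

lemma angular_smul (η : Metric.sphere (0 : Rd d) 1 → ℝ) {r : ℝ} (hr : 0 < r) (y : Rd d) :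
    angular η (r • y) = angular η y := by
  unfold angular
  by_cases h : y = 0
  · simp [h]
  · have h' : r • y ≠ 0 := smul_ne_zero hr.ne' h
    rw [dif_neg h', dif_neg h]
    congr 2
    rw [norm_smul, Real.norm_of_nonneg hr.le, smul_smul]
    congr 1
    field_simp

lemma map_coe_comap_coe_compl_zero [Nontrivial (Rd d)] :
    ((volume : Measure (Rd d)).comap ((↑) : ({0}ᶜ : Set (Rd d)) → Rd d)).map Subtype.val = volume := by
  rw [map_comap_subtype_coe (measurableSet_singleton _).compl, restrict_compl_singleton]

lemma quasiMeasurePreserving_direction :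
    Measure.QuasiMeasurePreserving (fun x => (homeomorphUnitSphereProd (Rd d) x).1)
      ((volume : Measure (Rd d)).comap ((↑) : ({0}ᶜ : Set (Rd d)) → Rd d))
      (volume : Measure (Rd d)).toSphere :=
  Measure.quasiMeasurePreserving_fst.comp
    (volume : Measure (Rd d)).measurePreserving_homeomorphUnitSphereProd.quasiMeasurePreserving

lemma angular_coe (η : Metric.sphere (0 : Rd d) 1 → ℝ) (x : ({0}ᶜ : Set (Rd d))) :
    angular η x = η (homeomorphUnitSphereProd (Rd d) x).1 := by
  rw [angular, dif_neg (show (x : Rd d) ≠ 0 from x.2)]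
  exact congrArg η (Subtype.ext (by simp))

namespace KernelClass

variable {lam Lam : ℝ} {η : Metric.sphere (0 : Rd d) 1 → ℝ}

lemma angular_neg (hη : KernelClass lam Lam η) (y : Rd d) : angular η (-y) = angular η y := by
  unfold angular
  by_cases h : y = 0
  · simp [h]
  · rw [dif_neg (neg_ne_zero.2 h), dif_neg h, ← hη.2.1]
    congr 2
    ext1
    simp

lemma aemeasurable [Nontrivial (Rd d)] (hη : KernelClass lam Lam η) :
    AEMeasurable (angular η) volume := by
  rw [← map_coe_comap_coe_compl_zero, (MeasurableEmbedding.subtype_coe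
    (measurableSet_singleton _).compl).aemeasurable_map_iff]
  refine (hη.1.comp_quasiMeasurePreserving quasiMeasurePreserving_direction).congr ?_
  exact Filter.Eventually.of_forall fun x => (angular_coe η x).symm

lemma ae_bounds [Nontrivial (Rd d)] (hη : KernelClass lam Lam η) :
    ∀ᵐ y : Rd d, lam ≤ angular η y ∧ angular η y ≤ Lam := by
  rw [← map_coe_comap_coe_compl_zero, (MeasurableEmbedding.subtype_coe
    (measurableSet_singleton _).compl).ae_map_iff]
  filter_upwards [quasiMeasurePreserving_direction.ae hη.2.2] with x hx
  rwa [angular_coe]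

lemma ae_abs_le [Nontrivial (Rd d)] (hη : KernelClass lam Lam η) (hlam : 0 < lam) :
    ∀ᵐ y : Rd d, ‖angular η y‖ ≤ Lam := by
  filter_upwards [hη.ae_bounds] with y hy
  rw [Real.norm_of_nonneg (hlam.le.trans hy.1)]; exact hy.2

lemma integrable_mul [Nontrivial (Rd d)] (hη : KernelClass lam Lam η) (hlam : 0 < lam)
    {g : Rd d → ℝ} (hg : Integrable g) : Integrable fun y => g y * angular η y :=
  hg.mul_bdd hη.aemeasurable.aestronglyMeasurable (hη.ae_abs_le hlam)

lemma abs_integral_mul_le [Nontrivial (Rd d)] (hη : KernelClass lam Lam η) (hlam : 0 < lam)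
    {g F : Rd d → ℝ} (hF : Integrable F) (hgF : ∀ y, |g y| ≤ F y) :
    |∫ y, g y * angular η y| ≤ Lam * ∫ y, F y := by
  rw [← integral_const_mul, ← Real.norm_eq_abs]
  refine norm_integral_le_of_norm_le (hF.const_mul _) ?_
  filter_upwards [hη.ae_abs_le hlam] with y hy
  rw [norm_mul, mul_comm]
  exact mul_le_mul hy (hgF y) (norm_nonneg _) ((norm_nonneg _).trans hy)

end KernelClass

/-! ### Radial integrals -/

/-- The surface measure of the unit sphere. -/
def sphereArea (d : ℕ) : ℝ := d * (volume : Measure (Rd d)).real (Metric.ball 0 1)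

lemma sphereArea_nonneg (d : ℕ) : 0 ≤ sphereArea d := by unfold sphereArea; positivity

lemma integral_radial [Nontrivial (Rd d)] (f : ℝ → ℝ) :
    ∫ y : Rd d, f ‖y‖ = sphereArea d * ∫ r in Ioi (0 : ℝ), r ^ ((d : ℝ) - 1) * f r := by
  have hd : 0 < d := by simpa using (Module.finrank_pos : 0 < Module.finrank ℝ (Rd d))
  rw [integral_fun_norm_addHaar]
  simp only [finrank_euclideanSpace, Fintype.card_fin, nsmul_eq_mul, smul_eq_mul, sphereArea]
  rw [mul_assoc]
  congr 2
  refine setIntegral_congr_fun measurableSet_Ioi fun r _ => ?_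
  rw [← Real.rpow_natCast, Nat.cast_sub hd]; simp

lemma integrable_radial [Nontrivial (Rd d)] (f : ℝ → ℝ) :
    Integrable (fun y : Rd d => f ‖y‖) ↔
      IntegrableOn (fun r => r ^ ((d : ℝ) - 1) * f r) (Ioi (0 : ℝ)) := by
  have hd : 0 < d := by simpa using (Module.finrank_pos : 0 < Module.finrank ℝ (Rd d))
  rw [integrable_fun_norm_addHaar]
  simp only [finrank_euclideanSpace, Fintype.card_fin, smul_eq_mul]
  refine integrableOn_congr_fun (fun r _ => ?_) measurableSet_Ioi
  rw [← Real.rpow_natCast, Nat.cast_sub hd]; simp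

/-- `|y|^{p-d}` on the ball of radius `ρ`. -/
def innerPow (d : ℕ) (p ρ : ℝ) (y : Rd d) : ℝ := if ‖y‖ < ρ then ‖y‖ ^ (p - d) else 0

/-- `|y|^{-p-d}` off the ball of radius `ρ`. -/
def outerPow (d : ℕ) (p ρ : ℝ) (y : Rd d) : ℝ := if ρ ≤ ‖y‖ then ‖y‖ ^ (-p - d) else 0

lemma innerPow_nonneg (p ρ : ℝ) (y : Rd d) : 0 ≤ innerPow d p ρ y := by
  unfold innerPow; split_ifs <;> positivity

lemma outerPow_nonneg (p ρ : ℝ) (y : Rd d) : 0 ≤ outerPow d p ρ y := by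
  unfold outerPow; split_ifs <;> positivity

lemma innerPow_radial_eq {p ρ : ℝ} :
    EqOn (fun r : ℝ => r ^ ((d : ℝ) - 1) * if r < ρ then r ^ (p - d) else 0)
      ((Iio ρ).indicator fun r => r ^ (p - 1)) (Ioi 0) := by
  intro r hr
  have hr : 0 < r := hr
  by_cases h : r < ρ
  · simp only [h, if_true, indicator_of_mem (show r ∈ Iio ρ from h)]
    rw [← Real.rpow_add hr]; ring_nf
  · simp [h]

lemma outerPow_radial_eq {p ρ : ℝ} :
    EqOn (fun r : ℝ => r ^ ((d : ℝ) - 1) * if ρ ≤ r then r ^ (-p - d) else 0)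
      ((Ici ρ).indicator fun r => r ^ (-p - 1)) (Ioi 0) := by
  intro r hr
  have hr : 0 < r := hr
  by_cases h : ρ ≤ r
  · simp only [h, if_true, indicator_of_mem (show r ∈ Ici ρ from h)]
    rw [← Real.rpow_add hr]; ring_nf
  · simp [h]

lemma integrable_innerPow [Nontrivial (Rd d)] {p ρ : ℝ} (hp : 0 < p) :
    Integrable (innerPow d p ρ) := by
  refine (integrable_radial (fun r => if r < ρ then r ^ (p - d) else 0)).2 ?_
  rw [integrableOn_congr_fun innerPow_radial_eq measurableSet_Ioi,
    integrableOn_indicator_iff measurableSet_Iio, inter_comm, Ioi_inter_Iio]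
  have := (intervalIntegral.intervalIntegrable_rpow' (a := 0) (b := ρ) (r := p - 1)
    (by linarith)).1
  exact this.mono_set Ioo_subset_Ioc_self

lemma integral_innerPow [Nontrivial (Rd d)] {p ρ : ℝ} (hp : 0 < p) (hρ : 0 < ρ) :
    ∫ y, innerPow d p ρ y = sphereArea d / p * ρ ^ p := by
  refine (integral_radial (fun r => if r < ρ then r ^ (p - d) else 0)).trans ?_
  rw [setIntegral_congr_fun measurableSet_Ioi innerPow_radial_eq,
    setIntegral_indicator measurableSet_Iio, Ioi_inter_Iio, ← integral_Ioc_eq_integral_Ioo,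
    ← intervalIntegral.integral_of_le hρ.le, integral_rpow (Or.inl (by linarith)),
    sub_add_cancel, Real.zero_rpow hp.ne']
  ring

lemma integrable_outerPow [Nontrivial (Rd d)] {p ρ : ℝ} (hp : 0 < p) (hρ : 0 < ρ) :
    Integrable (outerPow d p ρ) := by
  refine (integrable_radial (fun r => if ρ ≤ r then r ^ (-p - d) else 0)).2 ?_
  rw [integrableOn_congr_fun outerPow_radial_eq measurableSet_Ioi,
    integrableOn_indicator_iff measurableSet_Ici, integrableOn_congr_set_ae
    (show (Ici ρ ∩ Ioi 0 : Set ℝ) =ᵐ[volume] Ioi ρ from ?_)]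
  · exact integrableOn_Ioi_rpow_of_lt (by linarith) hρ
  · rw [inter_eq_left.2 (Ici_subset_Ioi.2 hρ)]
    exact Ioi_ae_eq_Ici.symm

lemma integral_outerPow [Nontrivial (Rd d)] {p ρ : ℝ} (hp : 0 < p) (hρ : 0 < ρ) :
    ∫ y, outerPow d p ρ y = sphereArea d / p * ρ ^ (-p) := by
  refine (integral_radial (fun r => if ρ ≤ r then r ^ (-p - d) else 0)).trans ?_
  rw [setIntegral_congr_fun measurableSet_Ioi outerPow_radial_eq,
    setIntegral_indicator measurableSet_Ici, inter_comm,
    inter_eq_left.2 (Ici_subset_Ioi.2 hρ), integral_Ici_eq_integral_Ioi,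
    integral_Ioi_rpow_of_lt (by linarith) hρ, sub_add_cancel]
  field_simp

/-- A separated integrand that is homogeneous of degree two in the angular part integrates to zero
as soon as its second radial moment vanishes. -/
lemma integral_homogeneous_mul_radial_eq_zero [Nontrivial (Rd d)] {φ : Rd d → ℝ} {ψ : ℝ → ℝ}
    (hφ : ∀ r : ℝ, 0 < r → ∀ y, φ (r • y) = r ^ 2 * φ y)
    (hψ : ∫ r in Ioi (0 : ℝ), r ^ (d - 1) * (r ^ 2 * ψ r) = 0) :
    ∫ y : Rd d, φ y * ψ ‖y‖ = 0 := by
  calc ∫ y : Rd d, φ y * ψ ‖y‖ = ∫ x : ({(0)}ᶜ : Set (Rd d)), φ x * ψ ‖x.1‖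
          ∂((volume : Measure (Rd d)).comap (↑)) := by
        rw [integral_subtype_comap (measurableSet_singleton _).compl fun x : Rd d => φ x * ψ ‖x‖,
          restrict_compl_singleton]
    _ = ∫ x : Metric.sphere (0 : Rd d) 1 × Ioi (0 : ℝ), φ x.1 * (x.2.1 ^ 2 * ψ x.2)
          ∂(volume : Measure (Rd d)).toSphere.prod
          (.volumeIoiPow (Module.finrank ℝ (Rd d) - 1)) := by
        rw [← (volume : Measure (Rd d)).measurePreserving_homeomorphUnitSphereProd.integral_comp
          (Homeomorph.measurableEmbedding _)]
        refine integral_congr_ae (Filter.Eventually.of_forall fun x => ?_)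
        have hx : 0 < ‖x.1‖ := norm_pos_iff.2 x.2
        simp only [homeomorphUnitSphereProd_apply_fst_coe, homeomorphUnitSphereProd_apply_snd_coe]
        rw [hφ _ (inv_pos.2 hx)]
        field_simp
    _ = (∫ θ, φ θ ∂(volume : Measure (Rd d)).toSphere) * ∫ r : Ioi (0 : ℝ), r.1 ^ 2 * ψ r
          ∂(.volumeIoiPow (Module.finrank ℝ (Rd d) - 1)) :=
        integral_prod_mul (fun θ : Metric.sphere (0 : Rd d) 1 => φ θ)
          (fun r : Ioi (0 : ℝ) => r.1 ^ 2 * ψ r)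
    _ = 0 := by
        refine mul_eq_zero_of_right _ ?_
        simp only [Measure.volumeIoiPow, ENNReal.ofReal]
        rw [integral_withDensity_eq_integral_smul
          ((measurable_subtype_coe.pow_const _).real_toNNReal),
          integral_subtype_comap measurableSet_Ioi fun a : ℝ =>
            Real.toNNReal (a ^ (Module.finrank ℝ (Rd d) - 1)) • (a ^ 2 * ψ a)]
        refine Eq.trans ?_ hψ
        refine setIntegral_congr_fun measurableSet_Ioi fun x hx => ?_
        simp only [finrank_euclideanSpace, Fintype.card_fin]
        rw [NNReal.smul_def, Real.coe_toNNReal _ (pow_nonneg (le_of_lt hx) _), smul_eq_mul]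

/-! ### The regularized kernel -/

/-- Minus the coefficient `γ_ε`, at scale `ε = 1`. -/
def coeffTwo (d : ℕ) (s : ℝ) : ℝ := (4 + d) * (d + 2 * s) * (3 + d + 2 * s) / (4 * (1 - s))

/-- The coefficient `ν_ε`, at scale `ε = 1`. -/
def coeffThree (d : ℕ) (s : ℝ) : ℝ := (5 + d) * (d + 2 * s) * (2 + d + 2 * s) / (6 * (1 - s))

/-- The ratio by which the regularized kernel may exceed the singular one. -/
def kernelRatio (d : ℕ) (s : ℝ) : ℝ := 1 + coeffTwo d s

lemma coeffTwo_nonneg {s : ℝ} (hs : s ∈ Ioo (0 : ℝ) 1) : 0 ≤ coeffTwo d s := by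
  have := sub_pos.2 hs.2
  have := hs.1
  unfold coeffTwo; positivity

lemma coeffThree_nonneg {s : ℝ} (hs : s ∈ Ioo (0 : ℝ) 1) : 0 ≤ coeffThree d s := by
  have := sub_pos.2 hs.2
  have := hs.1
  unfold coeffThree; positivity

lemma one_le_kernelRatio {s : ℝ} (hs : s ∈ Ioo (0 : ℝ) 1) : 1 ≤ kernelRatio d s :=
  le_add_of_nonneg_right (coeffTwo_nonneg hs)

lemma coeff_le {s : ℝ} (hs : s ∈ Ioo (0 : ℝ) 1) : 3 / 2 * coeffThree d s ≤ coeffTwo d s := by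
  have h1 := sub_pos.2 hs.2
  have h0 := hs.1
  have hd : (0 : ℝ) ≤ d := Nat.cast_nonneg d
  unfold coeffThree coeffTwo
  rw [show 3 / 2 * ((5 + (d : ℝ)) * (d + 2 * s) * (2 + d + 2 * s) / (6 * (1 - s))) =
    (5 + (d : ℝ)) * (d + 2 * s) * (2 + d + 2 * s) / (4 * (1 - s)) by field_simp; ring]
  gcongr ?_ / _
  nlinarith [mul_nonneg (by positivity : (0 : ℝ) ≤ d + 2 * s) h1.le]

lemma regKernel_of_lt {s ε r : ℝ} (hε : 0 < ε) (hr : r < ε) :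
    regKernel d s ε r = ε ^ (-((d : ℝ) + 2 * s)) *
      (1 + coeffTwo d s * (1 - (r / ε) ^ 2) - coeffThree d s * (1 - (r / ε) ^ 3)) := by
  have e2 : ε ^ (-(d : ℝ) - 2 * s - 2) = ε ^ (-((d : ℝ) + 2 * s)) / ε ^ 2 := by
    rw [← Real.rpow_natCast, ← Real.rpow_sub hε]; congr 1; push_cast; ring
  have e3 : ε ^ (-(d : ℝ) - 2 * s - 3) = ε ^ (-((d : ℝ) + 2 * s)) / ε ^ 3 := by
    rw [← Real.rpow_natCast, ← Real.rpow_sub hε]; congr 1; push_cast; ring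
  rw [regKernel, if_neg (not_le.2 hr), regGamma, regNu, e2, e3]
  change _ + -coeffTwo d s * _ * _ + coeffThree d s * _ * _ = _
  field_simp
  ring

lemma regKernel_of_le {s ε r : ℝ} (hr : ε ≤ r) :
    regKernel d s ε r = r ^ (-((d : ℝ) + 2 * s)) := if_pos hr

lemma regKernel_nonneg {s ε r : ℝ} (hs : s ∈ Ioo (0 : ℝ) 1) (hε : 0 < ε) (hr : 0 ≤ r) :
    0 ≤ regKernel d s ε r := by
  rcases le_or_gt ε r with h | h
  · rw [regKernel_of_le h]; positivity
  · rw [regKernel_of_lt hε h]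
    have ht0 : 0 ≤ r / ε := by positivity
    have ht1 : r / ε ≤ 1 := (div_le_one hε).2 h.le
    set t := r / ε
    refine mul_nonneg (by positivity) ?_
    -- `1 - t³ ≤ 3/2 (1 - t²)` on `[0, 1]`: this is why `coeff_le` has the factor `3/2`
    have h1 : 1 - t ^ 3 ≤ 3 / 2 * (1 - t ^ 2) := by
      nlinarith [mul_nonneg (sub_nonneg.2 ht1) (sub_nonneg.2 ht1), mul_nonneg ht0
        (mul_nonneg (sub_nonneg.2 ht1) (sub_nonneg.2 ht1))]
    have h2 : 0 ≤ 1 - t ^ 2 := by nlinarith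
    nlinarith [mul_le_mul_of_nonneg_left h1 (coeffThree_nonneg (d := d) hs),
      mul_le_mul_of_nonneg_right (coeff_le (d := d) hs) h2]

lemma regKernel_le_of_lt {s ε r : ℝ} (hs : s ∈ Ioo (0 : ℝ) 1) (hε : 0 < ε) (hr : 0 ≤ r)
    (h : r < ε) : regKernel d s ε r ≤ kernelRatio d s * ε ^ (-((d : ℝ) + 2 * s)) := by
  rw [regKernel_of_lt hε h, mul_comm]
  have ht0 : 0 ≤ r / ε := by positivity
  have ht1 : r / ε ≤ 1 := (div_le_one hε).2 h.le
  refine mul_le_mul_of_nonneg_right ?_ (by positivity)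
  have h2 : 0 ≤ 1 - (r / ε) ^ 3 := sub_nonneg.2 (pow_le_one₀ ht0 ht1)
  unfold kernelRatio
  nlinarith [mul_nonneg (coeffThree_nonneg (d := d) hs) h2,
    mul_nonneg (coeffTwo_nonneg (d := d) hs) (sq_nonneg (r / ε))]

lemma regKernel_le {s ε r : ℝ} (hs : s ∈ Ioo (0 : ℝ) 1) (hε : 0 < ε) (hr : 0 < r) :
    regKernel d s ε r ≤ kernelRatio d s * r ^ (-((d : ℝ) + 2 * s)) := by
  have hk := one_le_kernelRatio (d := d) hs
  have h0 := hs.1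
  rcases le_or_gt ε r with h | h
  · rw [regKernel_of_le h]
    exact le_mul_of_one_le_left (by positivity) hk
  · refine (regKernel_le_of_lt hs hε hr.le h).trans ?_
    have hexp : -((d : ℝ) + 2 * s) ≤ 0 := by linarith [(Nat.cast_nonneg d : (0 : ℝ) ≤ d)]
    exact mul_le_mul_of_nonneg_left (Real.rpow_le_rpow_of_nonpos hr h.le hexp) (by linarith)

lemma regKernel_measurable (s ε : ℝ) : Measurable (regKernel d s ε) := by
  unfold regKernel
  refine Measurable.ite measurableSet_Ici (by fun_prop) (by fun_prop)

/-- An integrable majorant of the regularized kernel. -/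
def kernelMajorant (d : ℕ) (s ε : ℝ) (y : Rd d) : ℝ :=
  kernelRatio d s * (ε ^ (-((d : ℝ) + 2 * s)) * innerPow d d ε y + outerPow d (2 * s) ε y)

lemma regKernel_le_majorant {s ε : ℝ} (hs : s ∈ Ioo (0 : ℝ) 1) (hε : 0 < ε) (y : Rd d) :
    regKernel d s ε ‖y‖ ≤ kernelMajorant d s ε y := by
  have hk := one_le_kernelRatio (d := d) hs
  unfold kernelMajorant innerPow outerPow
  rcases le_or_gt ε ‖y‖ with h | h
  · rw [if_neg (not_lt.2 h), if_pos h, mul_zero, zero_add, regKernel_of_le h,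
      show -((d : ℝ) + 2 * s) = -(2 * s) - d by ring]
    exact le_mul_of_one_le_left (by positivity) hk
  · rw [if_pos h, if_neg (not_le.2 h), sub_self, Real.rpow_zero, mul_one, add_zero]
    exact regKernel_le_of_lt hs hε (norm_nonneg _) h

lemma cast_pos_of_nontrivial [Nontrivial (Rd d)] : (0 : ℝ) < d := by
  exact_mod_cast (by simpa using (Module.finrank_pos : 0 < Module.finrank ℝ (Rd d)) : 0 < d)

lemma integrable_kernelMajorant [Nontrivial (Rd d)] {s ε : ℝ} (hs : s ∈ Ioo (0 : ℝ) 1)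
    (hε : 0 < ε) : Integrable (kernelMajorant d s ε) :=
  (((integrable_innerPow cast_pos_of_nontrivial).const_mul _).add
    (integrable_outerPow (by linarith [hs.1]) hε)).const_mul _

/-- The constant in the bound `∫ K_ε(|y|) dy ≤ C ε^{-2s}`. -/
def kernelMass (d : ℕ) (s : ℝ) : ℝ :=
  kernelRatio d s * (sphereArea d / d + sphereArea d / (2 * s))

lemma kernelMass_nonneg {s : ℝ} (hs : s ∈ Ioo (0 : ℝ) 1) : 0 ≤ kernelMass d s := by
  have := one_le_kernelRatio (d := d) hs
  have := sphereArea_nonneg d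
  have := hs.1
  unfold kernelMass; positivity

lemma integral_kernelMajorant [Nontrivial (Rd d)] {s ε : ℝ} (hs : s ∈ Ioo (0 : ℝ) 1)
    (hε : 0 < ε) : ∫ y, kernelMajorant d s ε y = kernelMass d s * ε ^ (-(2 * s)) := by
  have h2s : 0 < 2 * s := by linarith [hs.1]
  unfold kernelMajorant kernelMass
  rw [integral_const_mul, integral_add
    ((integrable_innerPow cast_pos_of_nontrivial).const_mul _) (integrable_outerPow h2s hε),
    integral_const_mul, integral_innerPow cast_pos_of_nontrivial hε, integral_outerPow h2s hε]
  have : ε ^ (-((d : ℝ) + 2 * s)) * ε ^ (d : ℝ) = ε ^ (-(2 * s)) := by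
    rw [← Real.rpow_add hε]; ring_nf
  rw [← this]; ring

/-- The coefficients `γ_ε`, `ν_ε` are chosen so that the regularization preserves the second
radial moment of the kernel. -/
lemma second_moment_eq_zero {s ε : ℝ} (hd : 1 ≤ d) (hs : s ∈ Ioo (0 : ℝ) 1) (hε : 0 < ε) :
    ∫ r in Ioi (0 : ℝ), r ^ (d - 1) * (r ^ 2 *
      (if r < ε then regKernel d s ε r - r ^ (-((d : ℝ) + 2 * s)) else 0)) = 0 := by
  have hs1 := sub_pos.2 hs.2
  set e := ε ^ (-((d : ℝ) + 2 * s)) with he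
  have hcongr : EqOn (fun r : ℝ => r ^ (d - 1) * (r ^ 2 *
      (if r < ε then regKernel d s ε r - r ^ (-((d : ℝ) + 2 * s)) else 0)))
      ((Iio ε).indicator fun r => e * (1 + coeffTwo d s - coeffThree d s) * r ^ (d + 1) -
        e * coeffTwo d s / ε ^ 2 * r ^ (d + 3) + e * coeffThree d s / ε ^ 3 * r ^ (d + 4) -
        r ^ (1 - 2 * s)) (Ioi 0) := by
    intro r hr
    have hr : 0 < r := hr
    by_cases h : r < ε
    · simp only [h, if_true, indicator_of_mem (show r ∈ Iio ε from h)]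
      rw [regKernel_of_lt hε h, ← he]
      have h1 : r ^ (1 - 2 * s) = r ^ (d + 1) * r ^ (-((d : ℝ) + 2 * s)) := by
        rw [← Real.rpow_natCast, ← Real.rpow_add hr]; congr 1; push_cast; ring
      rw [h1]
      obtain ⟨n, rfl⟩ : ∃ n, d = n + 1 := ⟨d - 1, by omega⟩
      rw [Nat.add_sub_cancel]
      field_simp
      ring
    · simp [h]
  rw [setIntegral_congr_fun measurableSet_Ioi hcongr, setIntegral_indicator measurableSet_Iio,
    Ioi_inter_Iio, ← integral_Ioc_eq_integral_Ioo, ← intervalIntegral.integral_of_le hε.le]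
  have i0 : ∀ n : ℕ, ∀ a : ℝ, IntervalIntegrable (fun r : ℝ => a * r ^ n) volume 0 ε :=
    fun n a => (by fun_prop : Continuous fun r : ℝ => a * r ^ n).intervalIntegrable _ _
  have i1 : IntervalIntegrable (fun r : ℝ => r ^ (1 - 2 * s)) volume 0 ε :=
    intervalIntegral.intervalIntegrable_rpow' (by linarith)
  rw [intervalIntegral.integral_sub (((i0 _ _).sub (i0 _ _)).add (i0 _ _)) i1,
    intervalIntegral.integral_add ((i0 _ _).sub (i0 _ _)) (i0 _ _),
    intervalIntegral.integral_sub (i0 _ _) (i0 _ _)]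
  simp only [intervalIntegral.integral_const_mul, integral_pow]
  rw [integral_rpow (Or.inl (by linarith)), Real.zero_rpow (by linarith)]
  have h1 : ε ^ (1 - 2 * s + 1) = e * ε ^ (d + 2) := by
    rw [he, ← Real.rpow_natCast, ← Real.rpow_add hε]; congr 1; push_cast; ring
  rw [h1]
  unfold coeffTwo coeffThree
  have hn : 1 - 2 * s + 1 = 2 * (1 - s) := by ring
  rw [hn]
  have hd0 : (0 : ℝ) ≤ d := Nat.cast_nonneg d
  push_cast
  have a1 : (d : ℝ) + 1 + 1 ≠ 0 := by positivity
  have a2 : (d : ℝ) + 3 + 1 ≠ 0 := by positivity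
  have a3 : (d : ℝ) + 4 + 1 ≠ 0 := by positivity
  simp only [zero_pow (Nat.succ_ne_zero _), sub_zero]
  field_simp
  ring

/-! ### The singular integral operator and the regularization error -/

/-- `L_η[w](x)`, with the principal value written through symmetric second differences. -/
def singOp (s : ℝ) (η : Metric.sphere (0 : Rd d) 1 → ℝ) (w : Rd d → ℝ) (x : Rd d) : ℝ :=
  1 / 2 * ∫ y : Rd d, secDiff w x y * ‖y‖ ^ (-((d : ℝ) + 2 * s)) * angular η y

lemma regOp_eq (s : ℝ) (η : Metric.sphere (0 : Rd d) 1 → ℝ) (ε : ℝ) (w : Rd d → ℝ) (x : Rd d) :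
    regOp s η ε w x = 1 / 2 * ∫ y : Rd d, secDiff w x y * regKernel d s ε ‖y‖ * angular η y := by
  unfold regOp secDiff
  congr 2 with y
  ring

lemma measurable_secDiff {w : Rd d → ℝ} (hw : Measurable w) (x : Rd d) :
    Measurable (secDiff w x) := by
  unfold secDiff; fun_prop

lemma abs_secDiff_le_of_bound {w : Rd d → ℝ} {B : ℝ} (hB : ∀ x, |w x| ≤ B) (x y : Rd d) :
    |secDiff w x y| ≤ 4 * B := by
  have h1 := abs_le.1 (hB x)
  have h2 := abs_le.1 (hB (x - y))
  have h3 := abs_le.1 (hB (x + y))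
  unfold secDiff
  rw [abs_le]; constructor <;> linarith [h1.1, h1.2, h2.1, h2.2, h3.1, h3.2]

lemma integrable_secDiff_mul_regKernel [Nontrivial (Rd d)] {s ε B : ℝ} (hs : s ∈ Ioo (0 : ℝ) 1)
    (hε : 0 < ε) {w : Rd d → ℝ} (hw : Measurable w) (hB : ∀ x, |w x| ≤ B) (x : Rd d) :
    Integrable fun y => secDiff w x y * regKernel d s ε ‖y‖ := by
  refine ((integrable_kernelMajorant hs hε).const_mul (4 * B)).mono'
    (((measurable_secDiff hw x).mul
      ((regKernel_measurable s ε).comp measurable_norm)).aestronglyMeasurable)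
    (Filter.Eventually.of_forall fun y => ?_)
  have h1 := abs_secDiff_le_of_bound hB x y
  rw [norm_mul, Real.norm_eq_abs, Real.norm_of_nonneg (regKernel_nonneg hs hε (norm_nonneg _))]
  exact mul_le_mul h1 (regKernel_le_majorant hs hε y) (regKernel_nonneg hs hε (norm_nonneg _))
    ((abs_nonneg _).trans h1)

lemma measurable_of_continuousOn_of_eq_zero {w : Rd d → ℝ} (hΩ : IsOpen Ω) (hw : ContinuousOn w Ω)
    (h0 : ∀ x, x ∉ Ω → w x = 0) : Measurable w := by
  classical
  have : Measurable (Ω.piecewise w fun _ => (0 : ℝ)) :=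
    hw.measurable_piecewise continuousOn_const hΩ.measurableSet
  convert this using 1
  ext x
  by_cases hx : x ∈ Ω
  · simp [hx]
  · simp [hx, h0 x hx]

namespace MemSClass

variable {s β M lam Lam : ℝ} {w : Rd d → ℝ} {η : Metric.sphere (0 : Rd d) 1 → ℝ}

lemma neg (h : MemSClass s β Ω M w) : MemSClass s β Ω M (-w) := by
  have hN : ∀ (b : ℝ) (A : Set (Rd d)) (N : ℝ), HolderNormLE b w A N →
      HolderNormLE b (-w) A N := by
    intro b A N hA
    have hneg : ∀ (i : ℕ) (x : Rd d), iteratedFDeriv ℝ i (-w) x = -iteratedFDeriv ℝ i w x :=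
      fun i x => iteratedFDeriv_neg_apply
    refine ⟨fun j hj x hx => ?_, fun x hx y hy => ?_⟩
    · rw [hneg, norm_neg]
      exact hA.1 j hj x hx
    · rw [hneg, hneg, ← neg_sub', norm_neg]
      exact hA.2 x hx y hy
  refine ⟨⟨h.1.1.neg, fun A hA hAΩ => ?_⟩, hN _ _ _ h.2.1, fun ρ hρ => hN _ _ _ (h.2.2 ρ hρ)⟩
  obtain ⟨N, hN'⟩ := h.1.2 A hA hAΩ
  exact ⟨N, hN _ _ _ hN'⟩

lemma abs_le_univ (h : MemSClass s β Ω M w) (hΩ : ConvexDomain Ω) (h0 : ∀ x, x ∉ Ω → w x = 0)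
    (x : Rd d) : |w x| ≤ M := by
  by_cases hx : x ∈ Ω
  · exact h.abs_le hx
  · rw [h0 x hx, abs_zero]; exact h.nonneg hΩ

lemma continuousOn (h : MemSClass s β Ω M w) : ContinuousOn w Ω := h.1.1.continuousOn

lemma measurable (h : MemSClass s β Ω M w) (hΩ : ConvexDomain Ω) (h0 : ∀ x, x ∉ Ω → w x = 0) :
    Measurable w := measurable_of_continuousOn_of_eq_zero hΩ.isOpen h.continuousOn h0

/-- The pointwise majorant of the integrand of `L_η[w](z)`. -/
lemma abs_secDiff_mul_le (h : MemSClass s β Ω M w) (hΩ : ConvexDomain Ω)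
    (h0 : ∀ x, x ∉ Ω → w x = 0) (hs : s ∈ Ioo (0 : ℝ) 1) (hβ : 2 * s < β)
    (hβ4 : β < 4) {z : Rd d} (hz : z ∈ Ω) {ρ : ℝ} (hρ : ρ ≤ bdist Ω z / 2) (hρ0 : 0 < ρ)
    (y : Rd d) :
    |secDiff w z y * ‖y‖ ^ (-((d : ℝ) + 2 * s))| ≤
      6 * M * ρ ^ (s - min β 2) * innerPow d (min β 2 - 2 * s) ρ y +
        4 * M * outerPow d (2 * s) ρ y := by
  have hM := h.nonneg hΩ
  have hβ0 : 0 < β := by linarith [hs.1]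
  have hb : 2 * s < min β 2 := lt_min hβ (by linarith [hs.2])
  rw [abs_mul, abs_of_nonneg (by positivity : 0 ≤ ‖y‖ ^ (-((d : ℝ) + 2 * s)))]
  unfold innerPow outerPow
  rcases le_or_gt ρ ‖y‖ with hy | hy
  · rw [if_neg (not_lt.2 hy), if_pos hy, mul_zero, zero_add,
      show -((d : ℝ) + 2 * s) = -(2 * s) - d by ring]
    exact mul_le_mul_of_nonneg_right (abs_secDiff_le_of_bound (h.abs_le_univ hΩ h0) z y)
      (by positivity)
  · rw [if_pos hy, if_neg (not_le.2 hy), mul_zero, add_zero]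
    have h1 := h.abs_secDiff_le hΩ hs hβ0 hβ4 hz (hy.le.trans hρ)
    rcases eq_or_ne y 0 with rfl | hy0
    · have : -((d : ℝ) + 2 * s) ≠ 0 := by
        have := hs.1
        have : (0 : ℝ) ≤ d := Nat.cast_nonneg d
        linarith
      rw [norm_zero, Real.zero_rpow this, mul_zero]
      positivity
    have hy' : 0 < ‖y‖ := norm_pos_iff.2 hy0
    have h2 : ‖y‖ ^ (min β 2 - 2 * s - d) = ‖y‖ ^ min β 2 * ‖y‖ ^ (-((d : ℝ) + 2 * s)) := by
      rw [← Real.rpow_add hy']; ring_nf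
    rw [h2, ← mul_assoc]
    refine mul_le_mul_of_nonneg_right (h1.trans ?_) (by positivity)
    have : (bdist Ω z / 2) ^ (s - min β 2) ≤ ρ ^ (s - min β 2) :=
      Real.rpow_le_rpow_of_nonpos hρ0 hρ (by linarith [hs.1])
    gcongr

lemma integrable_secDiff_majorant [Nontrivial (Rd d)] (s β M ρ : ℝ) (hs : s ∈ Ioo (0 : ℝ) 1)
    (hβ : 2 * s < β) (hρ0 : 0 < ρ) : Integrable fun y : Rd d =>
      6 * M * ρ ^ (s - min β 2) * innerPow d (min β 2 - 2 * s) ρ y +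
        4 * M * outerPow d (2 * s) ρ y := by
  have hb : 2 * s < min β 2 := lt_min hβ (by linarith [hs.2])
  exact ((integrable_innerPow (by linarith)).const_mul _).add
    ((integrable_outerPow (by linarith [hs.1]) hρ0).const_mul _)

lemma integrable_secDiff_mul [Nontrivial (Rd d)] (h : MemSClass s β Ω M w) (hΩ : ConvexDomain Ω)
    (h0 : ∀ x, x ∉ Ω → w x = 0) (hs : s ∈ Ioo (0 : ℝ) 1) (hβ : 2 * s < β)
    (hβ4 : β < 4) {z : Rd d} (hz : z ∈ Ω) :
    Integrable fun y => secDiff w z y * ‖y‖ ^ (-((d : ℝ) + 2 * s)) := by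
  have hρ0 : 0 < bdist Ω z / 2 := half_pos (hΩ.bdist_pos hz)
  refine (integrable_secDiff_majorant s β M _ hs hβ hρ0).mono'
    ((measurable_secDiff (h.measurable hΩ h0) z).mul (by fun_prop)).aestronglyMeasurable
    (Filter.Eventually.of_forall fun y => ?_)
  exact h.abs_secDiff_mul_le hΩ h0 hs hβ hβ4 hz le_rfl hρ0 y

/-- The quadratic part of the second difference does not contribute to the regularization error,
because the second moments agree; the remainder is of order `β` and gives the rate. -/
lemma abs_regOp_sub_singOp_le [Nontrivial (Rd d)] (h : MemSClass s β Ω M w) (hΩ : ConvexDomain Ω)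
    (h0 : ∀ x, x ∉ Ω → w x = 0) (hs : s ∈ Ioo (0 : ℝ) 1) (hβ : 2 * s < β)
    (hβ4 : β < 4) (hη : KernelClass lam Lam η) (hlam : 0 < lam) {z : Rd d} (hz : z ∈ Ω) {ε : ℝ}
    (hε : 0 < ε) (hεz : ε ≤ bdist Ω z / 2) :
    |regOp s η ε w z - singOp s η w z| ≤
      Lam * (kernelRatio d s * M * (sphereArea d / (β - 2 * s))) *
        ((bdist Ω z / 2) ^ (s - β) * ε ^ (β - 2 * s)) := by
  have hM := h.nonneg hΩ
  have hβ0 : 0 < β := by linarith [hs.1]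
  have hd1 : 1 ≤ d := by exact_mod_cast cast_pos_of_nontrivial (d := d)
  have hk := one_le_kernelRatio (d := d) hs
  set ρ := bdist Ω z / 2 with hρdef
  have hρ : 0 < ρ := half_pos (hΩ.bdist_pos hz)
  set ψ : ℝ → ℝ := fun r => if r < ε then regKernel d s ε r - r ^ (-((d : ℝ) + 2 * s)) else 0
    with hψ
  have hψm : Measurable ψ := by
    refine Measurable.ite measurableSet_Iio ((regKernel_measurable s ε).sub (by fun_prop))
      measurable_const
  have hψle : ∀ y : Rd d, y ≠ 0 →
      |ψ ‖y‖| ≤ if ‖y‖ < ε then kernelRatio d s * ‖y‖ ^ (-((d : ℝ) + 2 * s)) else 0 := by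
    intro y hy
    have hy' : 0 < ‖y‖ := norm_pos_iff.2 hy
    simp only [hψ]
    split_ifs with hlt
    · have h1 := regKernel_le (d := d) hs hε hy'
      have h2 := regKernel_nonneg (d := d) hs hε hy'.le
      have h3 : ‖y‖ ^ (-((d : ℝ) + 2 * s)) ≤ kernelRatio d s * ‖y‖ ^ (-((d : ℝ) + 2 * s)) :=
        le_mul_of_one_le_left (by positivity) hk
      have h4 : 0 ≤ ‖y‖ ^ (-((d : ℝ) + 2 * s)) := by positivity
      rw [_root_.abs_le]; constructor <;> linarith
    · simp
  -- the majorant of the quadratic term times the kernel difference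
  have hquad : Integrable fun y => quadTerm β w z y * ψ ‖y‖ := by
    refine ((integrable_innerPow (d := d) (p := 2 - 2 * s) (ρ := ε)
      (by linarith [hs.2])).const_mul (4 * M * ρ ^ (s - 2) * kernelRatio d s)).mono'
      (((quadTerm_continuous β w z).measurable.mul
        (hψm.comp measurable_norm)).aestronglyMeasurable) (Filter.Eventually.of_forall fun y => ?_)
    have h1 := h.abs_quadTerm_le hΩ hs hβ0 hβ4 hz y
    rcases eq_or_ne y 0 with rfl | hy0
    · have h2 : quadTerm β w z 0 = 0 := by
        have := quadTerm_smul β w z (0 : Rd d) 0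
        simpa using this
      rw [h2, zero_mul, norm_zero]
      exact mul_nonneg (by positivity) (innerPow_nonneg _ _ _)
    have hy' : 0 < ‖y‖ := norm_pos_iff.2 hy0
    rw [norm_mul, Real.norm_eq_abs, Real.norm_eq_abs]
    refine (mul_le_mul h1 (hψle y hy0) (abs_nonneg _) (by positivity)).trans (le_of_eq ?_)
    unfold innerPow
    split_ifs
    · rw [show (2 : ℝ) - 2 * s - d = 2 + -((d : ℝ) + 2 * s) by ring, Real.rpow_add hy',
        Real.rpow_two]
      ring
    · simp
  have hzero : ∫ y, quadTerm β w z y * ψ ‖y‖ * angular η y = 0 := by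
    have := integral_homogeneous_mul_radial_eq_zero
      (φ := fun y => quadTerm β w z y * angular η y) (ψ := ψ)
      (fun r hr y => by simp only [quadTerm_smul, angular_smul η hr]; ring)
      (second_moment_eq_zero hd1 hs hε)
    rw [← this]
    congr 1 with y
    ring
  have hdiff : Integrable fun y => secDiff w z y * ψ ‖y‖ := by
    refine ((integrable_secDiff_mul_regKernel hs hε (h.measurable hΩ h0)
      (h.abs_le_univ hΩ h0) z).sub (h.integrable_secDiff_mul hΩ h0 hs hβ hβ4 hz)).congr
      (Filter.Eventually.of_forall fun y => ?_)
    simp only [Pi.sub_apply, hψ]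
    split_ifs with hlt
    · ring
    · rw [regKernel_of_le (not_lt.1 hlt)]; ring
  have heq : regOp s η ε w z - singOp s η w z =
      1 / 2 * ∫ y, ((secDiff w z y + quadTerm β w z y) * ψ ‖y‖) * angular η y := by
    rw [regOp_eq, singOp, ← mul_sub, ← integral_sub
      (hη.integrable_mul hlam (integrable_secDiff_mul_regKernel hs hε (h.measurable hΩ h0)
        (h.abs_le_univ hΩ h0) z))
      (hη.integrable_mul hlam (h.integrable_secDiff_mul hΩ h0 hs hβ hβ4 hz))]
    have e1 : ∫ y, ((secDiff w z y + quadTerm β w z y) * ψ ‖y‖) * angular η y =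
        ∫ y, secDiff w z y * ψ ‖y‖ * angular η y := by
      rw [← add_zero (∫ y, secDiff w z y * ψ ‖y‖ * angular η y), ← hzero, ← integral_add
        (hη.integrable_mul hlam hdiff) (hη.integrable_mul hlam hquad)]
      congr 1 with y
      ring
    rw [e1]
    congr 2 with y
    simp only [hψ]
    split_ifs with hlt
    · ring
    · rw [regKernel_of_le (not_lt.1 hlt)]; ring
  rw [heq, abs_mul, abs_of_pos (by norm_num : (0 : ℝ) < 1 / 2)]
  have hpow : 0 < β - 2 * s := by linarith
  have key := hη.abs_integral_mul_le hlam
    (g := fun y => (secDiff w z y + quadTerm β w z y) * ψ ‖y‖)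
    ((integrable_innerPow (d := d) (ρ := ε) hpow).const_mul
      (2 * M * ρ ^ (s - β) * kernelRatio d s)) (fun y => by
      rcases eq_or_ne y 0 with rfl | hy0
      · have h1 := h.abs_secDiff_add_quadTerm_le hΩ hβ0 hβ4 hz (y := 0)
          (by rw [norm_zero]; exact hρ.le)
        rw [norm_zero, Real.zero_rpow hβ0.ne', mul_zero] at h1
        rw [abs_eq_zero.1 (le_antisymm h1 (abs_nonneg _)), zero_mul, abs_zero]
        exact mul_nonneg (by positivity) (innerPow_nonneg _ _ _)
      have hy' : 0 < ‖y‖ := norm_pos_iff.2 hy0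
      rw [abs_mul]
      unfold innerPow
      have h2 := hψle y hy0
      split_ifs at h2 ⊢ with hlt
      · have h1 := h.abs_secDiff_add_quadTerm_le hΩ hβ0 hβ4 hz (hlt.le.trans hεz)
        refine (mul_le_mul h1 h2 (abs_nonneg _) (by positivity)).trans (le_of_eq ?_)
        rw [show β - 2 * s - d = β + -((d : ℝ) + 2 * s) by ring, Real.rpow_add hy']
        ring
      · rw [le_antisymm h2 (abs_nonneg _)]; simp)
  rw [integral_const_mul, integral_innerPow hpow hε] at key
  refine (mul_le_mul_of_nonneg_left key (by norm_num)).trans (le_of_eq ?_)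
  ring

end MemSClass

/-! ### The discrete comparison estimate -/

/-- The integral of `(3D)^{-d-2s}` over a ball of radius `D = 1`; up to the ellipticity constant, this
is the factor in the lower bound `L_{η,ε}[1_Ω] ≥ C δ^{-2s}`. -/
def barrierConst (d : ℕ) (s : ℝ) : ℝ :=
  (volume : Measure (Rd d)).real (Metric.ball 0 1) * 3 ^ (-((d : ℝ) + 2 * s))

lemma barrierConst_pos (d : ℕ) (s : ℝ) : 0 < barrierConst d s := by
  unfold barrierConst
  have : 0 < (volume : Measure (Rd d)).real (Metric.ball 0 1) :=
    ENNReal.toReal_pos (Metric.measure_ball_pos _ _ one_pos).ne' measure_ball_lt_top.ne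
  positivity

lemma integral_indicator_ball [Nontrivial (Rd d)] {s D : ℝ} (hD : 0 < D) (p : Rd d) :
    ∫ y, (Metric.ball p D).indicator (fun _ => (3 * D) ^ (-((d : ℝ) + 2 * s))) y =
      barrierConst d s * D ^ (-(2 * s)) := by
  rw [integral_indicator measurableSet_ball, setIntegral_const, measureReal_def,
    Measure.addHaar_ball _ _ hD.le, smul_eq_mul, ENNReal.toReal_mul,
    ENNReal.toReal_ofReal (by positivity), finrank_euclideanSpace, Fintype.card_fin,
    Real.mul_rpow (by norm_num) hD.le, barrierConst, measureReal_def]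
  have : D ^ d * D ^ (-((d : ℝ) + 2 * s)) = D ^ (-(2 * s)) := by
    rw [← Real.rpow_natCast, ← Real.rpow_add hD]; ring_nf
  rw [← this]; ring

/-- Since `Ω` is convex, its complement contains a ball of radius `δ(z)` at distance `δ(z)` from `z`,
on which the kernel of `L_{η,ε}` is at least of order `δ(z)^{-d-2s}`. Hence a function that is, up to errors `E₁` near `z` and
`E₂` elsewhere, maximal at `z` with value `m`, has `L_{η,ε}[w](z)` at least of order
`m δ(z)^{-2s}`, up to the errors. -/
lemma regOp_lower_bound [Nontrivial (Rd d)] {s lam Lam : ℝ}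
    {η : Metric.sphere (0 : Rd d) 1 → ℝ} (hΩ : ConvexDomain Ω)
    (hs : s ∈ Ioo (0 : ℝ) 1) (hη : KernelClass lam Lam η) (hlam : 0 < lam)
    {z : Rd d} (hz : z ∈ Ω) {ε : ℝ} (hε : 0 < ε) (hεz : ε ≤ bdist Ω z / 2) {w : Rd d → ℝ}
    (hw : Measurable w) {B : ℝ} (hB : ∀ x, |w x| ≤ B) (hw0 : ∀ x, x ∉ Ω → w x = 0)
    {m E₁ E₂ : ℝ} (hm : 0 ≤ m) (hwz : w z = m) (hE₁ : 0 ≤ E₁) (hE₂ : 0 ≤ E₂)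
    (h₁ : ∀ x ∈ Ω, ‖x - z‖ < bdist Ω z / 2 → w x ≤ m + E₁)
    (h₂ : ∀ x ∈ Ω, w x ≤ m + E₂) :
    lam / 2 * barrierConst d s * bdist Ω z ^ (-(2 * s)) * m ≤ regOp s η ε w z +
      Lam * (kernelMass d s * ε ^ (-(2 * s)) * E₁ +
        sphereArea d / (2 * s) * (bdist Ω z / 2) ^ (-(2 * s)) * E₂) := by
  have hD := hΩ.bdist_pos hz
  have h2s : 0 < 2 * s := by linarith [hs.1]
  set D := bdist Ω z with hDdef
  obtain ⟨p, hp, hpball⟩ := hΩ.exists_ball_compl hz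
  set I : Rd d → ℝ := (Metric.ball p D).indicator (fun _ => (3 * D) ^ (-((d : ℝ) + 2 * s))) with hI
  have hIint : Integrable I := by
    refine IntegrableOn.integrable_indicator ?_ measurableSet_ball
    exact integrableOn_const measure_ball_lt_top.ne
  set F : Rd d → ℝ := fun y => E₁ * kernelMajorant d s ε y + E₂ * outerPow d (2 * s) (D / 2) y
    with hF
  have hFint : Integrable F := ((integrable_kernelMajorant hs hε).const_mul _).add
    ((integrable_outerPow h2s (half_pos hD)).const_mul _)
  have hFnn : ∀ y, 0 ≤ F y := fun y => add_nonneg (mul_nonneg hE₁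
    ((regKernel_nonneg hs hε (norm_nonneg _)).trans (regKernel_le_majorant hs hε y)))
    (mul_nonneg hE₂ (outerPow_nonneg _ _ _))
  have hdn : (0 : ℝ) ≤ d := Nat.cast_nonneg d
  -- on the ball of exterior points the kernel is at least `(3D)^{-d-2s}`
  have hIle : ∀ y, I y ≤ regKernel d s ε ‖y‖ := by
    intro y
    by_cases hy : y ∈ Metric.ball p D
    · rw [hI, indicator_of_mem hy]
      rw [mem_ball_iff_norm] at hy
      have hy1 : ‖y‖ ≤ 3 * D := by
        have := norm_add_le (y - p) p
        rw [sub_add_cancel] at this; linarith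
      have hy2 : D ≤ ‖y‖ := by
        have := norm_add_le (p - y) y
        rw [sub_add_cancel, norm_sub_rev] at this; linarith
      rw [regKernel_of_le (by linarith)]
      exact Real.rpow_le_rpow_of_nonpos (by linarith) hy1 (by linarith)
    · rw [hI, indicator_of_notMem hy]
      exact regKernel_nonneg hs hε (norm_nonneg _)
  have hupper : ∀ y, (w (z + y) - m) * regKernel d s ε ‖y‖ ≤ F y - m * I y := by
    intro y
    have hK := regKernel_nonneg (d := d) hs hε (norm_nonneg y)
    have hKm := regKernel_le_majorant (d := d) hs hε y
    by_cases hyΩ : z + y ∈ Ω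
    · have hyI : I y = 0 := indicator_of_notMem (fun hy => hpball y hy hyΩ) _
      rw [hyI, mul_zero, sub_zero]
      rcases lt_or_ge ‖y‖ (D / 2) with hlt | hge
      · have := h₁ _ hyΩ (by simpa using hlt)
        have h3 : (w (z + y) - m) * regKernel d s ε ‖y‖ ≤ E₁ * kernelMajorant d s ε y :=
          mul_le_mul (by linarith) hKm hK hE₁
        exact h3.trans (le_add_of_nonneg_right (mul_nonneg hE₂ (outerPow_nonneg _ _ _)))
      · have := h₂ _ hyΩ
        have h3 : (w (z + y) - m) * regKernel d s ε ‖y‖ ≤ E₂ * outerPow d (2 * s) (D / 2) y := by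
          rw [outerPow, if_pos hge, show -(2 * s) - (d : ℝ) = -((d : ℝ) + 2 * s) by ring,
            regKernel_of_le (hεz.trans hge)]
          exact mul_le_mul_of_nonneg_right (by linarith) (by positivity)
        refine h3.trans (le_add_of_nonneg_left (mul_nonneg hE₁ (hK.trans hKm)))
    · rw [hw0 _ hyΩ]
      nlinarith [hFnn y, mul_le_mul_of_nonneg_left (hIle y) hm]
  set G : Rd d → ℝ := fun y => m * I y - F y with hG
  have hGint : Integrable G := (hIint.const_mul m).sub hFint
  have hlow : ∀ y, G y + G (-y) ≤ secDiff w z y * regKernel d s ε ‖y‖ := by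
    intro y
    have a1 := hupper y
    have a2 := hupper (-y)
    rw [norm_neg, ← sub_eq_add_neg] at a2
    simp only [hG, secDiff, hwz]
    linarith
  have hmono : ∫ y, (G y + G (-y)) * angular η y ≤
      ∫ y, secDiff w z y * regKernel d s ε ‖y‖ * angular η y := by
    refine integral_mono_ae (hη.integrable_mul hlam (hGint.add hGint.comp_neg))
      (hη.integrable_mul hlam (integrable_secDiff_mul_regKernel hs hε hw hB z)) ?_
    filter_upwards [hη.ae_bounds] with y hy
    exact mul_le_mul_of_nonneg_right (hlow y) (hlam.le.trans hy.1)
  have hsym : ∫ y, (G y + G (-y)) * angular η y = 2 * ∫ y, G y * angular η y := by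
    have e1 : ∫ y, G (-y) * angular η y = ∫ y, G y * angular η y := by
      rw [← integral_neg_eq_self]
      simp only [neg_neg, hη.angular_neg]
    simp only [add_mul]
    rw [integral_add (hη.integrable_mul hlam hGint) (hη.integrable_mul hlam hGint.comp_neg), e1]
    ring
  have hGlow : lam * (m * ∫ y, I y) - Lam * ∫ y, F y ≤ ∫ y, G y * angular η y := by
    rw [← integral_const_mul, ← integral_const_mul, ← integral_const_mul,
      ← integral_sub ((hIint.const_mul m).const_mul lam) (hFint.const_mul Lam)]
    refine integral_mono_ae (((hIint.const_mul m).const_mul lam).sub (hFint.const_mul Lam))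
      (hη.integrable_mul hlam hGint) ?_
    filter_upwards [hη.ae_bounds] with y hy
    have hInn : 0 ≤ m * I y := mul_nonneg hm (indicator_nonneg (fun _ _ => by positivity) _)
    simp only [hG]
    nlinarith [mul_le_mul_of_nonneg_right hy.1 hInn, mul_le_mul_of_nonneg_right hy.2 (hFnn y)]
  have hIval : ∫ y, I y = barrierConst d s * D ^ (-(2 * s)) := integral_indicator_ball hD p
  have hFval : ∫ y, F y = E₁ * (kernelMass d s * ε ^ (-(2 * s))) +
      E₂ * (sphereArea d / (2 * s) * (D / 2) ^ (-(2 * s))) := by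
    rw [hF, integral_add ((integrable_kernelMajorant hs hε).const_mul _)
      ((integrable_outerPow h2s (half_pos hD)).const_mul _), integral_const_mul,
      integral_const_mul, integral_kernelMajorant hs hε, integral_outerPow h2s (half_pos hD)]
  rw [hIval, hFval] at hGlow
  rw [hsym] at hmono
  rw [regOp_eq]
  have hpos : 0 ≤ lam * barrierConst d s * D ^ (-(2 * s)) * m := by
    have := (barrierConst_pos d s).le
    positivity
  nlinarith

/-! ### Weak solutions of class `S^β` solve the equation pointwise -/

lemma measurePreserving_shear_right :
    MeasurePreserving (fun z : Rd d × Rd d => (z.1, z.1 + z.2)) volume volume :=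
  measurePreserving_prod_add volume volume

lemma measurableEmbedding_shear_right :
    MeasurableEmbedding (fun z : Rd d × Rd d => (z.1, z.1 + z.2)) :=
  (MeasurableEquiv.shearAddRight (Rd d)).measurableEmbedding

lemma measurePreserving_shear_left :
    MeasurePreserving (fun z : Rd d × Rd d => (z.1 + z.2, z.2)) volume volume :=
  measurePreserving_add_prod volume volume

lemma measurableEmbedding_shear_left :
    MeasurableEmbedding (fun z : Rd d × Rd d => (z.1 + z.2, z.2)) := by
  have := ((MeasurableEquiv.prodComm.trans (MeasurableEquiv.shearAddRight (Rd d))).trans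
    MeasurableEquiv.prodComm).measurableEmbedding
  convert this using 1
  ext z : 1
  simp [add_comm, MeasurableEquiv.shearAddRight, MeasurableEquiv.prodComm]

/-- The energy density of `v` in the variables `x` and `t = y - x`. -/
lemma integrable_energy_iff {s : ℝ} {v : Rd d → ℝ} :
    Integrable (fun p : Rd d × Rd d => (v p.1 - v p.2) ^ 2 / ‖p.1 - p.2‖ ^ ((d : ℝ) + 2 * s))
      volume ↔
    Integrable (fun p : Rd d × Rd d =>
      (v p.1 - v (p.1 + p.2)) ^ 2 * ‖p.2‖ ^ (-((d : ℝ) + 2 * s))) volume := by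
  rw [← measurePreserving_shear_right.integrable_comp_emb measurableEmbedding_shear_right]
  refine integrable_congr (Filter.Eventually.of_forall fun p => ?_)
  simp only [Function.comp_apply, sub_add_cancel_left, norm_neg, Real.rpow_neg (norm_nonneg _)]
  rfl

lemma memTildeH_of_smooth [Nontrivial (Rd d)] {s : ℝ} (hs : s ∈ Ioo (0 : ℝ) 1) {v : Rd d → ℝ}
    (hv : ContDiff ℝ 1 v) (hc : HasCompactSupport v) (hvΩ : tsupport v ⊆ Ω) :
    MemTildeH s Ω v := by
  refine ⟨fun x hx => image_eq_zero_of_notMem_tsupport fun h => hx (hvΩ h),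
    hv.continuous.memLp_of_hasCompactSupport hc, integrable_energy_iff.2 ?_⟩
  obtain ⟨L, hL⟩ := hv.lipschitzWith_of_hasCompactSupport hc one_ne_zero
  obtain ⟨B, hB⟩ := hc.exists_bound_of_continuous hv.continuous
  have hB0 : 0 ≤ B := (norm_nonneg _).trans (hB 0)
  set S := tsupport v
  set χ : Rd d → ℝ := S.indicator fun _ => 1 with hχ
  have hχi : Integrable χ := by
    refine IntegrableOn.integrable_indicator ?_ (isClosed_tsupport v).measurableSet
    exact integrableOn_const (IsCompact.measure_lt_top hc).ne
  set ψ : Rd d → ℝ := fun t => L ^ 2 * innerPow d (2 - 2 * s) 1 t +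
    (2 * B) ^ 2 * outerPow d (2 * s) 1 t with hψ
  have hψi : Integrable ψ := ((integrable_innerPow (by linarith [hs.2])).const_mul _).add
    ((integrable_outerPow (by linarith [hs.1]) one_pos).const_mul _)
  have hψ0 : ∀ t, 0 ≤ ψ t := fun t => add_nonneg
    (mul_nonneg (by positivity) (innerPow_nonneg _ _ _))
    (mul_nonneg (by positivity) (outerPow_nonneg _ _ _))
  have h1 : Integrable (fun p : Rd d × Rd d => χ p.1 * ψ p.2) volume := hχi.mul_prod hψi
  have h2 : Integrable (fun p : Rd d × Rd d => χ (p.1 + p.2) * ψ p.2) volume :=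
    measurePreserving_shear_left.integrable_comp_of_integrable h1
  have hvm := hv.continuous.measurable
  refine (h1.add h2).mono' (by fun_prop) (Filter.Eventually.of_forall fun p => ?_)
  obtain ⟨x, t⟩ := p
  simp only [Pi.add_apply, ← add_mul]
  rw [norm_mul, Real.norm_of_nonneg (by positivity), Real.norm_of_nonneg (by positivity)]
  have hχ0 : ∀ x, 0 ≤ χ x := fun x => indicator_nonneg (fun _ _ => zero_le_one) x
  by_cases hx : x ∈ S ∨ x + t ∈ S
  · have hχ1 : 1 ≤ χ x + χ (x + t) := by
      rcases hx with hx | hx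
      · have : χ x = 1 := indicator_of_mem hx _
        linarith [hχ0 (x + t)]
      · have : χ (x + t) = 1 := indicator_of_mem hx _
        linarith [hχ0 x]
    refine le_trans ?_ (le_mul_of_one_le_left (hψ0 t) hχ1)
    simp only [hψ, innerPow, outerPow]
    rcases le_or_gt 1 ‖t‖ with ht | ht
    · rw [if_neg (not_lt.2 ht), if_pos ht, mul_zero, zero_add,
        show -((d : ℝ) + 2 * s) = -(2 * s) - d by ring]
      refine mul_le_mul_of_nonneg_right (sq_le_sq' ?_ ?_) (by positivity)
      all_goals
        have a1 := abs_le.1 (hB x)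
        have a2 := abs_le.1 (hB (x + t))
        linarith [a1.1, a1.2, a2.1, a2.2]
    · rw [if_pos ht, if_neg (not_le.2 ht), mul_zero, add_zero]
      rcases eq_or_ne t 0 with rfl | ht0
      · simp only [add_zero, sub_self]
        rw [zero_pow two_ne_zero, zero_mul]
        positivity
      · have hl := hL.dist_le_mul x (x + t)
        rw [Real.dist_eq, dist_self_add_right] at hl
        have ht' : 0 < ‖t‖ := norm_pos_iff.2 ht0
        rw [show (2 : ℝ) - 2 * s - d = 2 + -((d : ℝ) + 2 * s) by ring, Real.rpow_add ht',
          Real.rpow_two, ← mul_assoc, ← mul_pow, ← sq_abs]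
        gcongr
  · rw [not_or] at hx
    rw [image_eq_zero_of_notMem_tsupport hx.1, image_eq_zero_of_notMem_tsupport hx.2, sub_self,
      zero_pow two_ne_zero, zero_mul]
    exact mul_nonneg (add_nonneg (hχ0 _) (hχ0 _)) (hψ0 t)

/-- Off a neighborhood of the diagonal all terms can be integrated separately, and the symmetric
form turns into the operator applied to `u`. -/
lemma integral_form_eq_secDiff {u v k : Rd d → ℝ} (hu : Measurable u) {B : ℝ}
    (huB : ∀ x, |u x| ≤ B) (hv : Integrable v) (hk : Integrable k) :
    ∫ p : Rd d × Rd d, (u p.1 - u (p.1 + p.2)) * (v p.1 - v (p.1 + p.2)) * k p.2 =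
      ∫ p : Rd d × Rd d, v p.1 * secDiff u p.1 p.2 * k p.2 := by
  have i0 : Integrable (fun p : Rd d × Rd d => v p.1 * k p.2) volume := hv.mul_prod hk
  have hbd : ∀ g : Rd d × Rd d → Rd d, Measurable g →
      Integrable (fun p : Rd d × Rd d => u (g p) * (v p.1 * k p.2)) volume := fun g hg =>
    i0.bdd_mul (hu.comp hg).aestronglyMeasurable (Filter.Eventually.of_forall fun p => huB _)
  have i1 := hbd (fun p => p.1) (by fun_prop)
  have i2 := hbd (fun p => p.1 + p.2) (by fun_prop)
  have i3 := hbd (fun p => p.1 - p.2) (by fun_prop)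
  have j1 := measurePreserving_shear_left.integrable_comp_of_integrable i1
  have j3 := measurePreserving_shear_left.integrable_comp_of_integrable i3
  have e1 := measurePreserving_shear_left.integral_comp measurableEmbedding_shear_left
    (fun p : Rd d × Rd d => u p.1 * (v p.1 * k p.2))
  have e3 := measurePreserving_shear_left.integral_comp measurableEmbedding_shear_left
    (fun p : Rd d × Rd d => u (p.1 - p.2) * (v p.1 * k p.2))
  simp only [Function.comp_def, add_sub_cancel_right] at j1 j3 e1 e3
  have l : ∫ p : Rd d × Rd d, (u p.1 - u (p.1 + p.2)) * (v p.1 - v (p.1 + p.2)) * k p.2 =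
      (∫ p : Rd d × Rd d, u p.1 * (v p.1 * k p.2)) -
      (∫ p : Rd d × Rd d, u (p.1 + p.2) * (v p.1 * k p.2)) -
      (∫ p : Rd d × Rd d, u p.1 * (v (p.1 + p.2) * k p.2)) +
      ∫ p : Rd d × Rd d, u (p.1 + p.2) * (v (p.1 + p.2) * k p.2) := by
    have k1 : Integrable (fun p : Rd d × Rd d => u p.1 * (v p.1 * k p.2) -
      u (p.1 + p.2) * (v p.1 * k p.2)) volume := i1.sub i2
    have k2 : Integrable (fun p : Rd d × Rd d => u p.1 * (v p.1 * k p.2) -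
      u (p.1 + p.2) * (v p.1 * k p.2) - u p.1 * (v (p.1 + p.2) * k p.2)) volume := k1.sub j3
    rw [← integral_sub i1 i2, ← integral_sub k1 j3, ← integral_add k2 j1]
    congr 1 with p
    ring
  have r : ∫ p : Rd d × Rd d, v p.1 * secDiff u p.1 p.2 * k p.2 =
      (∫ p : Rd d × Rd d, u p.1 * (v p.1 * k p.2)) +
      (∫ p : Rd d × Rd d, u p.1 * (v p.1 * k p.2)) -
      (∫ p : Rd d × Rd d, u (p.1 - p.2) * (v p.1 * k p.2)) -
      ∫ p : Rd d × Rd d, u (p.1 + p.2) * (v p.1 * k p.2) := by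
    have k1 : Integrable (fun p : Rd d × Rd d => u p.1 * (v p.1 * k p.2) +
      u p.1 * (v p.1 * k p.2)) volume := i1.add i1
    have k2 : Integrable (fun p : Rd d × Rd d => u p.1 * (v p.1 * k p.2) +
      u p.1 * (v p.1 * k p.2) - u (p.1 - p.2) * (v p.1 * k p.2)) volume := k1.sub i3
    rw [← integral_add i1 i1, ← integral_sub k1 i3, ← integral_sub k2 i2]
    congr 1 with p
    simp only [secDiff]
    ring
  rw [l, r, e1, e3]
  ring

namespace MemSClass

variable {s β M lam Lam : ℝ} {f u : Rd d → ℝ} {η : Metric.sphere (0 : Rd d) 1 → ℝ}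

/-- Testing the weak formulation with a smooth function supported near an interior point. -/
lemma integrable_and_integral_mul_singOp [Nontrivial (Rd d)] (h : MemSClass s β Ω M u)
    (hΩ : ConvexDomain Ω)
    (hs : s ∈ Ioo (0 : ℝ) 1) (hβ : 2 * s < β) (hβ4 : β < 4) (hη : KernelClass lam Lam η)
    (hlam : 0 < lam) (hu : IsWeakSolution s η Ω f u) {z : Rd d} (hz : z ∈ Ω) {v : Rd d → ℝ}
    (hv : ContDiff ℝ 1 v) (hc : HasCompactSupport v)
    (hvz : tsupport v ⊆ Metric.ball z (bdist Ω z / 2)) :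
    Integrable (fun x => v x * singOp s η u x) ∧
      ∫ x, v x * singOp s η u x = ∫ x in Ω, f x * v x := by
  have h0 := hu.1.1
  have hD := hΩ.bdist_pos hz
  have hballΩ : Metric.ball z (bdist Ω z / 2) ⊆ Ω :=
    (Metric.ball_subset_ball (by linarith)).trans (hΩ.ball_subset hz)
  have hvT : MemTildeH s Ω v := memTildeH_of_smooth hs hv hc (hvz.trans hballΩ)
  have hum := h.measurable hΩ h0
  have huM := h.abs_le_univ hΩ h0
  have hvm := hv.continuous.measurable
  have hvi : Integrable v := hv.continuous.integrable_of_hasCompactSupport hc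
  have ham : AEStronglyMeasurable (fun p : Rd d × Rd d => angular η p.2) volume :=
    hη.aemeasurable.aestronglyMeasurable.comp_snd
  have hab : ∀ᵐ p : Rd d × Rd d, ‖angular η p.2‖ ≤ Lam :=
    Measure.quasiMeasurePreserving_snd.ae (hη.ae_abs_le hlam)
  set A : ℝ := (d : ℝ) + 2 * s with hA
  set k : Rd d → ℝ := fun t => ‖t‖ ^ (-A) * angular η t with hk
  set F : Rd d × Rd d → ℝ := fun p =>
    (u p.1 - u (p.1 + p.2)) * (v p.1 - v (p.1 + p.2)) * k p.2 with hF
  have hFi : Integrable F volume := by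
    have h1 := ((integrable_energy_iff.1 hu.1.2.2).add (integrable_energy_iff.1 hvT.2.2))
    have h2 : Integrable (fun p : Rd d × Rd d =>
        (u p.1 - u (p.1 + p.2)) * (v p.1 - v (p.1 + p.2)) * ‖p.2‖ ^ (-A)) volume := by
      refine h1.mono' (by fun_prop) (Filter.Eventually.of_forall fun p => ?_)
      rw [norm_mul, Real.norm_of_nonneg (by positivity : 0 ≤ ‖p.2‖ ^ (-A)), Pi.add_apply,
        ← add_mul]
      refine mul_le_mul_of_nonneg_right ?_ (by positivity)
      rw [Real.norm_eq_abs, _root_.abs_le]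
      constructor <;> nlinarith [sq_nonneg (u p.1 - u (p.1 + p.2) + (v p.1 - v (p.1 + p.2))),
        sq_nonneg (u p.1 - u (p.1 + p.2) - (v p.1 - v (p.1 + p.2))),
        sq_nonneg (u p.1 - u (p.1 + p.2)), sq_nonneg (v p.1 - v (p.1 + p.2))]
    refine (h2.mul_bdd ham hab).congr (Filter.Eventually.of_forall fun p => ?_)
    simp only [hF, hk]; ring
  have hweak : 1 / 2 * ∫ p, F p = ∫ x in Ω, f x * v x := by
    have e := measurePreserving_shear_right.integral_comp measurableEmbedding_shear_right
      (fun p : Rd d × Rd d => (u p.1 - u p.2) * (v p.1 - v p.2) * angular η (p.1 - p.2)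
        / ‖p.1 - p.2‖ ^ ((d : ℝ) + 2 * s))
    rw [← hu.2 v hvT, ← e]
    congr 2 with p
    simp only [hF, hk, sub_add_cancel_left, norm_neg, hη.angular_neg]
    rw [Real.rpow_neg (norm_nonneg _)]
    ring
  -- the majorant near the support of `v`
  set ρ := bdist Ω z / 4 with hρ
  have hρ0 : 0 < ρ := by positivity
  set Ψ : Rd d → ℝ := fun y => 6 * M * ρ ^ (s - min β 2) * innerPow d (min β 2 - 2 * s) ρ y +
        4 * M * outerPow d (2 * s) ρ y with hΨ
  have hΨi : Integrable Ψ := integrable_secDiff_majorant s β M ρ hs hβ hρ0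
  set H : Rd d × Rd d → ℝ := fun p => v p.1 * secDiff u p.1 p.2 * k p.2 with hH
  have hHle : ∀ x t, |v x * secDiff u x t * ‖t‖ ^ (-A)| ≤ |v x| * Ψ t := by
    intro x t
    by_cases hx : x ∈ tsupport v
    · have hxz := hvz hx
      rw [mem_ball_iff_norm] at hxz
      have hbx := hΩ.ball_half_bdist hxz.le
      rw [mul_assoc, abs_mul]
      exact mul_le_mul_of_nonneg_left (h.abs_secDiff_mul_le hΩ h0 hs hβ hβ4 (hballΩ (hvz hx))
        (by rw [hρ]; linarith) hρ0 t) (abs_nonneg _)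
    · simp [image_eq_zero_of_notMem_tsupport hx]
  have hsecm : Measurable fun p : Rd d × Rd d => secDiff u p.1 p.2 := by
    unfold secDiff; fun_prop
  have hprod : Integrable (fun p : Rd d × Rd d => |v p.1| * Ψ p.2) volume := hvi.abs.mul_prod hΨi
  have hHi : Integrable H volume := by
    have h2 : Integrable (fun p : Rd d × Rd d =>
        v p.1 * secDiff u p.1 p.2 * ‖p.2‖ ^ (-A)) volume :=
      hprod.mono' (by fun_prop) (Filter.Eventually.of_forall fun p => hHle _ _)
    refine (h2.mul_bdd ham hab).congr (Filter.Eventually.of_forall fun p => ?_)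
    simp only [hH, hk]; ring
  -- removal of the neighborhood `|t| < 1 / (n + 1)` of the diagonal
  set χ : ℕ → Rd d → ℝ := fun n t => if 1 / ((n : ℝ) + 1) ≤ ‖t‖ then 1 else 0 with hχ
  have hχm : ∀ n, Measurable (χ n) := fun n =>
    Measurable.ite (measurableSet_le measurable_const measurable_norm) measurable_const
      measurable_const
  have hχ1 : ∀ n t, ‖χ n t‖ ≤ 1 := fun n t => by simp only [hχ]; split_ifs <;> simp
  have hχlim : ∀ t : Rd d, t ≠ 0 → Filter.Tendsto (fun n => χ n t) Filter.atTop (nhds 1) := by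
    intro t ht
    refine tendsto_const_nhds.congr' ?_
    have := (tendsto_one_div_add_atTop_nhds_zero_nat (𝕜 := ℝ)).eventually_le_const
      (norm_pos_iff.2 ht)
    filter_upwards [this] with n hn
    exact (if_pos hn).symm
  have hlim : ∀ G : Rd d × Rd d → ℝ, Integrable G volume → (∀ x, G (x, 0) = 0) →
      Filter.Tendsto (fun n => ∫ p, χ n p.2 * G p) Filter.atTop (nhds (∫ p, G p)) := by
    intro G hG hG0
    refine tendsto_integral_of_dominated_convergence (fun p => ‖G p‖)
      (fun n => ((hχm n).comp measurable_snd).aestronglyMeasurable.mul hG.aestronglyMeasurable)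
      hG.norm (fun n => Filter.Eventually.of_forall fun p => ?_)
      (Filter.Eventually.of_forall fun p => ?_)
    · rw [norm_mul]
      exact mul_le_of_le_one_left (norm_nonneg _) (hχ1 n _)
    · obtain ⟨x, t⟩ := p
      rcases eq_or_ne t 0 with rfl | ht
      · simp [hG0]
      · simpa using (hχlim t ht).mul_const (G (x, t))
  have hFH : ∫ p, F p = ∫ p, H p := by
    refine tendsto_nhds_unique (hlim F hFi fun x => by simp [hF]) ?_
    refine (hlim H hHi fun x => by simp [hH, secDiff]; ring_nf; simp).congr fun n => ?_
    have hkn : Integrable fun t => χ n t * k t := by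
      have := hη.integrable_mul hlam (integrable_outerPow (d := d) (p := 2 * s)
        (ρ := 1 / ((n : ℝ) + 1)) (by linarith [hs.1]) (by positivity))
      refine this.congr (Filter.Eventually.of_forall fun t => ?_)
      simp only [outerPow, hχ, hk, hA, show -((d : ℝ) + 2 * s) = -(2 * s) - d by ring]
      split_ifs <;> ring
    have := integral_form_eq_secDiff hum huM hvi hkn
    calc ∫ p, χ n p.2 * H p
        = ∫ p : Rd d × Rd d, v p.1 * secDiff u p.1 p.2 * (χ n p.2 * k p.2) := by
          congr 1 with p; simp only [hH]; ring
      _ = _ := this.symm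
      _ = _ := by congr 1 with p; simp only [hF]; ring
  have hinner : ∀ x, ∫ t, H (x, t) = 2 * (v x * singOp s η u x) := by
    intro x
    have : ∀ t, H (x, t) = v x * (secDiff u x t * ‖t‖ ^ (-A) * angular η t) := fun t => by
      simp only [hH, hk]; ring
    simp only [this, integral_const_mul, singOp, ← hA]
    ring
  have hint : Integrable fun x => 2 * (v x * singOp s η u x) := by
    have := Integrable.integral_prod_left (μ := (volume : Measure (Rd d)))
      (ν := (volume : Measure (Rd d))) hHi
    simpa only [hinner] using this
  refine ⟨(hint.const_mul (1 / 2)).congr (Filter.Eventually.of_forall fun x => by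
    simp only; ring), ?_⟩
  rw [← hweak, hFH]
  have hfub : ∫ p, H p = ∫ x, ∫ t, H (x, t) :=
    integral_prod (μ := (volume : Measure (Rd d))) (ν := (volume : Measure (Rd d))) H hHi
  rw [hfub]
  simp only [hinner]
  rw [integral_const_mul]
  ring

lemma continuousAt_of_notMem_frontier (h : MemSClass s β Ω M u) (hΩ : ConvexDomain Ω)
    (h0 : ∀ x, x ∉ Ω → u x = 0) {x : Rd d} (hx : x ∉ frontier Ω) : ContinuousAt u x := by
  by_cases hxΩ : x ∈ Ω
  · exact h.continuousOn.continuousAt (hΩ.isOpen.mem_nhds hxΩ)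
  · have hxc : x ∈ (closure Ω)ᶜ := fun hc => hx (hΩ.mem_frontier_of_mem_closure hc hxΩ)
    refine (continuousAt_const (y := (0 : ℝ))).congr ?_
    filter_upwards [isClosed_closure.isOpen_compl.mem_nhds hxc] with y hy
    exact (h0 y fun hyΩ => hy (subset_closure hyΩ)).symm

lemma continuousOn_singOp [Nontrivial (Rd d)] (h : MemSClass s β Ω M u)
    (hΩ : ConvexDomain Ω) (h0 : ∀ x, x ∉ Ω → u x = 0)
    (hs : s ∈ Ioo (0 : ℝ) 1) (hβ : 2 * s < β) (hβ4 : β < 4) (hη : KernelClass lam Lam η)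
    (hlam : 0 < lam) : ContinuousOn (singOp s η u) Ω := by
  intro z hz
  refine ContinuousAt.continuousWithinAt ?_
  have hD := hΩ.bdist_pos hz
  set ρ := bdist Ω z / 4 with hρ
  have hρ0 : 0 < ρ := by positivity
  have hum := h.measurable hΩ h0
  have hnull : volume (frontier Ω) = 0 := hΩ.convex.addHaar_frontier volume
  refine ContinuousAt.mul continuousAt_const ?_
  refine continuousAt_of_dominated (bound := fun y => (6 * M * ρ ^ (s - min β 2) *
    innerPow d (min β 2 - 2 * s) ρ y + 4 * M * outerPow d (2 * s) ρ y) * Lam)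
    (Filter.Eventually.of_forall fun x => ?_) ?_
    ((integrable_secDiff_majorant s β M ρ hs hβ hρ0).mul_const _) ?_
  · exact ((measurable_secDiff hum x).mul (by fun_prop)).aestronglyMeasurable.mul
      hη.aemeasurable.aestronglyMeasurable
  · filter_upwards [Metric.ball_mem_nhds z (half_pos hD)] with x hx
    have hx' := hx
    rw [mem_ball_iff_norm] at hx'
    have hbx := hΩ.ball_half_bdist hx'.le
    have hxΩ : x ∈ Ω := hΩ.ball_subset hz (Metric.ball_subset_ball (by linarith) hx)
    filter_upwards [hη.ae_abs_le hlam] with y hy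
    rw [norm_mul]
    have := h.abs_secDiff_mul_le hΩ h0 hs hβ hβ4 hxΩ (ρ := ρ) (by rw [hρ]; linarith) hρ0 y
    exact mul_le_mul this hy (norm_nonneg _) ((abs_nonneg _).trans this)
  · have n1 : ∀ᵐ y : Rd d, z + y ∉ frontier Ω :=
      (measurePreserving_add_left (volume : Measure (Rd d)) z).quasiMeasurePreserving.ae
        (measure_eq_zero_iff_ae_notMem.1 hnull)
    have n2 : ∀ᵐ y : Rd d, z - y ∉ frontier Ω :=
      (Measure.measurePreserving_sub_left (volume : Measure (Rd d)) z).quasiMeasurePreserving.ae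
        (measure_eq_zero_iff_ae_notMem.1 hnull)
    filter_upwards [n1, n2] with y hy1 hy2
    have c0 : ContinuousAt u z :=
      h.continuousAt_of_notMem_frontier hΩ h0 fun hf => hΩ.notMem_of_mem_frontier hf hz
    have c1 : ContinuousAt (fun x => u (x + y)) z :=
      ContinuousAt.comp (f := fun x : Rd d => x + y)
        (h.continuousAt_of_notMem_frontier hΩ h0 hy1) (by fun_prop)
    have c2 : ContinuousAt (fun x => u (x - y)) z :=
      ContinuousAt.comp (f := fun x : Rd d => x - y)
        (h.continuousAt_of_notMem_frontier hΩ h0 hy2) (by fun_prop)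
    exact ((((continuousAt_const.mul c0).sub c2).sub c1).mul continuousAt_const).mul
      continuousAt_const

/-- By the regularity of `u` both sides of the equation are continuous, so it holds everywhere. -/
theorem singOp_eq [Nontrivial (Rd d)] (h : MemSClass s β Ω M u) (hΩ : ConvexDomain Ω)
    (hs : s ∈ Ioo (0 : ℝ) 1) (hβ : 2 * s < β) (hβ4 : β < 4) (hη : KernelClass lam Lam η)
    (hlam : 0 < lam) (hu : IsWeakSolution s η Ω f u) (hf : ContinuousOn f Ω) {z : Rd d}
    (hz : z ∈ Ω) : singOp s η u z = f z := by
  have hD := hΩ.bdist_pos hz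
  set U := Metric.ball z (bdist Ω z / 2) with hU
  have hUΩ : U ⊆ Ω := (Metric.ball_subset_ball (by linarith)).trans (hΩ.ball_subset hz)
  have hc1 : ContinuousOn (singOp s η u) U :=
    (h.continuousOn_singOp hΩ hu.1.1 hs hβ hβ4 hη hlam).mono hUΩ
  have hc2 : ContinuousOn f U := hf.mono hUΩ
  have hloc : LocallyIntegrableOn (fun x => singOp s η u x - f x) U volume :=
    (hc1.sub hc2).locallyIntegrableOn measurableSet_ball
  have hae := Metric.isOpen_ball.ae_eq_zero_of_integral_contDiff_smul_eq_zero hloc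
    fun v hv hvc hvU => by
      obtain ⟨i1, e1⟩ := h.integrable_and_integral_mul_singOp hΩ hs hβ hβ4 hη hlam hu hz
        (hv.of_le (by exact_mod_cast le_top)) hvc hvU
      have hfv : ∀ x, x ∉ tsupport v → f x * v x = 0 := fun x hx => by
        rw [image_eq_zero_of_notMem_tsupport hx, mul_zero]
      have i2 : Integrable fun x => f x * v x := by
        have : IntegrableOn (fun x => f x * v x) (tsupport v) :=
          ((hc2.mono hvU).mul hv.continuous.continuousOn).integrableOn_compact hvc
        exact this.integrable_of_forall_notMem_eq_zero hfv
      have e2 : ∫ x in Ω, f x * v x = ∫ x, f x * v x :=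
        setIntegral_eq_integral_of_forall_compl_eq_zero fun x hx =>
          hfv x fun hxv => hx (hUΩ (hvU hxv))
      rw [e2] at e1
      simp only [smul_eq_mul, mul_sub]
      have i3 : Integrable fun x => v x * f x := by simpa only [mul_comm] using i2
      rw [integral_sub i1 i3, e1, sub_eq_zero]
      simp only [mul_comm]
  have heq : singOp s η u =ᵐ[volume.restrict U] f := by
    refine (ae_restrict_iff' measurableSet_ball).2 ?_
    filter_upwards [hae] with x hx hxU
    exact sub_eq_zero.1 (hx hxU)
  exact Measure.eqOn_open_of_ae_eq heq Metric.isOpen_ball hc1 hc2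
    (Metric.mem_ball_self (half_pos hD))

end MemSClass

/-! ### Boundary values -/

namespace MemSClass

variable {s β M lam Lam : ℝ} {f u : Rd d → ℝ} {η : Metric.sphere (0 : Rd d) 1 → ℝ}

/-- The constant in `singOp_lower_bound`. -/
def nearConst (d : ℕ) (s β M : ℝ) : ℝ :=
  3 * M * (sphereArea d / (min β 2 - 2 * s)) + M * (sphereArea d / s)

/-- The exterior of `Ω`, where `u` vanishes, contributes at least a multiple of `u(z) δ(z)^{-2s}`
to `L_η[u](z)`; the variation of `u` inside `Ω` contributes only `O(δ(z)^{-s})`. -/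
lemma singOp_lower_bound [Nontrivial (Rd d)] (h : MemSClass s β Ω M u) (hΩ : ConvexDomain Ω)
    (h0 : ∀ x, x ∉ Ω → u x = 0)
    (hs : s ∈ Ioo (0 : ℝ) 1) (hβ : 2 * s < β) (hβ4 : β < 4) (hη : KernelClass lam Lam η)
    (hlam : 0 < lam) {z : Rd d} (hz : z ∈ Ω) (hm : 0 ≤ u z) :
    lam * barrierConst d s * bdist Ω z ^ (-(2 * s)) * u z ≤
      singOp s η u z + Lam * nearConst d s β M * (bdist Ω z / 2) ^ (-s) := by
  have hM := h.nonneg hΩ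
  have hD := hΩ.bdist_pos hz
  have hβ0 : 0 < β := by linarith [hs.1]
  have hb : 2 * s < min β 2 := lt_min hβ (by linarith [hs.2])
  have hdn : (0 : ℝ) ≤ d := Nat.cast_nonneg d
  set D := bdist Ω z with hDdef
  set ρ := D / 2 with hρdef
  have hρ : 0 < ρ := half_pos hD
  obtain ⟨p, hp, hpball⟩ := hΩ.exists_ball_compl hz
  set I : Rd d → ℝ := (Metric.ball p D).indicator (fun _ => (3 * D) ^ (-((d : ℝ) + 2 * s))) with hI
  have hIint : Integrable I := by
    refine IntegrableOn.integrable_indicator ?_ measurableSet_ball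
    exact integrableOn_const measure_ball_lt_top.ne
  have hI0 : ∀ y, 0 ≤ I y := fun y => indicator_nonneg (fun _ _ => by positivity) _
  set P : Rd d → ℝ := fun y => 6 * M * ρ ^ (s - min β 2) * innerPow d (min β 2 - 2 * s) ρ y +
    2 * M * outerPow d s ρ y with hP
  have hPi1 := (integrable_innerPow (d := d) (p := min β 2 - 2 * s) (ρ := ρ)
    (by linarith)).const_mul (6 * M * ρ ^ (s - min β 2))
  have hPi2 := (integrable_outerPow (d := d) hs.1 hρ).const_mul (2 * M)
  have hPint : Integrable P := hPi1.add hPi2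
  have hP0 : ∀ y, 0 ≤ P y := fun y => add_nonneg
    (mul_nonneg (by positivity) (innerPow_nonneg _ _ _))
    (mul_nonneg (by positivity) (outerPow_nonneg _ _ _))
  have hInorm : ∀ y ∈ Metric.ball p D, ‖y‖ ≤ 3 * D ∧ D ≤ ‖y‖ := by
    intro y hy
    rw [mem_ball_iff_norm] at hy
    have h1 := norm_add_le (y - p) p
    have h2 := norm_add_le (p - y) y
    rw [sub_add_cancel] at h1 h2
    rw [norm_sub_rev] at h2
    constructor <;> linarith
  have hfar : ∀ y, ρ ≤ ‖y‖ → u z * I y - M * outerPow d s ρ y ≤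
      (u z - u (z + y)) * ‖y‖ ^ (-((d : ℝ) + 2 * s)) := by
    intro y hy
    have hy0 : 0 < ‖y‖ := hρ.trans_le hy
    rw [outerPow, if_pos hy]
    have e : ‖y‖ ^ (-s - (d : ℝ)) = ‖y‖ ^ s * ‖y‖ ^ (-((d : ℝ) + 2 * s)) := by
      rw [← Real.rpow_add hy0]; ring_nf
    have hK : 0 ≤ ‖y‖ ^ (-((d : ℝ) + 2 * s)) := by positivity
    rw [e]
    by_cases hyΩ : z + y ∈ Ω
    · have hyI : I y = 0 := indicator_of_notMem (fun hy => hpball y hy hyΩ) _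
      have := _root_.abs_le.1 (h.abs_sub_le hs hz hyΩ)
      rw [sub_add_cancel_left, norm_neg] at this
      rw [hyI]
      nlinarith [mul_le_mul_of_nonneg_right this.1 hK]
    · have hIle : I y ≤ ‖y‖ ^ (-((d : ℝ) + 2 * s)) := by
        by_cases hyb : y ∈ Metric.ball p D
        · rw [hI, indicator_of_mem hyb]
          exact Real.rpow_le_rpow_of_nonpos hy0 (hInorm y hyb).1 (by linarith [hs.1])
        · rw [hI, indicator_of_notMem hyb]; exact hK
      rw [h0 _ hyΩ, sub_zero]
      have : 0 ≤ M * (‖y‖ ^ s * ‖y‖ ^ (-((d : ℝ) + 2 * s))) := by positivity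
      nlinarith [mul_le_mul_of_nonneg_left hIle hm]
  have hlow : ∀ y, u z * (I y + I (-y)) - P y ≤
      secDiff u z y * ‖y‖ ^ (-((d : ℝ) + 2 * s)) := by
    intro y
    rcases le_or_gt ρ ‖y‖ with hy | hy
    · have a1 := hfar y hy
      have a2 := hfar (-y) (by rwa [norm_neg])
      have e : outerPow d s ρ (-y) = outerPow d s ρ y := by simp [outerPow]
      rw [norm_neg, e, ← sub_eq_add_neg] at a2
      simp only [hP, innerPow, if_neg (not_lt.2 hy), secDiff]
      linarith
    · have b1 : I y = 0 := indicator_of_notMem (fun hb => by linarith [(hInorm y hb).2]) _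
      have b2 : I (-y) = 0 := indicator_of_notMem (fun hb => by
        have := (hInorm _ hb).2
        rw [norm_neg] at this
        linarith) _
      have := h.abs_secDiff_mul_le hΩ h0 hs hβ hβ4 hz le_rfl hρ y
      have e : outerPow d (2 * s) ρ y = 0 := by rw [outerPow, if_neg (not_le.2 hy)]
      rw [e, mul_zero, add_zero] at this
      have e' : outerPow d s ρ y = 0 := by rw [outerPow, if_neg (not_le.2 hy)]
      simp only [hP, b1, b2, e']
      linarith [(_root_.abs_le.1 this).1]
  have hIs : Integrable fun y => I y + I (-y) := hIint.add hIint.comp_neg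
  have hmono : ∫ y, (lam * u z * (I y + I (-y)) - Lam * P y) ≤
      ∫ y, secDiff u z y * ‖y‖ ^ (-((d : ℝ) + 2 * s)) * angular η y := by
    refine integral_mono_ae ((hIs.const_mul _).sub (hPint.const_mul _))
      (hη.integrable_mul hlam (h.integrable_secDiff_mul hΩ h0 hs hβ hβ4 hz)) ?_
    filter_upwards [hη.ae_bounds] with y hy
    have c1 := mul_le_mul_of_nonneg_right (hlow y) (hlam.le.trans hy.1)
    have c2 := mul_le_mul_of_nonneg_right hy.1 (mul_nonneg hm (add_nonneg (hI0 y) (hI0 (-y))))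
    have c3 := mul_le_mul_of_nonneg_right hy.2 (hP0 y)
    nlinarith
  have hIval : ∫ y, I y = barrierConst d s * D ^ (-(2 * s)) := integral_indicator_ball hD p
  have hIneg : ∫ y, I (-y) = ∫ y, I y := integral_neg_eq_self I volume
  have hpow : ρ ^ (s - min β 2) * ρ ^ (min β 2 - 2 * s) = ρ ^ (-s) := by
    rw [← Real.rpow_add hρ]; ring_nf
  have hPval : ∫ y, P y = 2 * nearConst d s β M * ρ ^ (-s) := by
    rw [hP, integral_add hPi1 hPi2, integral_const_mul, integral_const_mul,
      integral_innerPow (by linarith) hρ, integral_outerPow hs.1 hρ, nearConst, ← hpow]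
    ring
  rw [integral_sub (hIs.const_mul _) (hPint.const_mul _), integral_const_mul, integral_const_mul,
    integral_add hIint hIint.comp_neg, hIneg, hIval, hPval] at hmono
  rw [singOp]
  linarith

lemma singOp_neg (s : ℝ) (η : Metric.sphere (0 : Rd d) 1 → ℝ) (w : Rd d → ℝ) (x : Rd d) :
    singOp s η (-w) x = -singOp s η w x := by
  unfold singOp secDiff
  rw [← mul_neg, ← integral_neg]
  congr 2 with y
  simp only [Pi.neg_apply]
  ring

/-- A solution with bounded right-hand side vanishes on the boundary. Membership in `S^β` does not
prescribe boundary values, and for `s < 1/2` neither does the energy space; it is the equation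
that forces them, because otherwise `L_η[u]` would blow up like `δ^{-2s}`. -/
lemma abs_le_bdist_rpow [Nontrivial (Rd d)] (h : MemSClass s β Ω M u) (hΩ : ConvexDomain Ω)
    (h0 : ∀ x, x ∉ Ω → u x = 0)
    (hs : s ∈ Ioo (0 : ℝ) 1) (hβ : 2 * s < β) (hβ4 : β < 4) (hη : KernelClass lam Lam η)
    (hlam : 0 < lam) {B : ℝ} (hB : ∀ x ∈ Ω, |singOp s η u x| ≤ B) {x : Rd d} (hx : x ∈ Ω) :
    |u x| ≤ M * bdist Ω x ^ s := by
  have hc : 0 < lam * barrierConst d s := mul_pos hlam (barrierConst_pos d s)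
  set N := Lam * nearConst d s β M with hN
  set c := lam * barrierConst d s with hcdef
  have hdecay : ∀ z ∈ Ω,
      |u z| ≤ (B * bdist Ω z ^ (2 * s) + N * 2 ^ s * bdist Ω z ^ s) / c := by
    intro z hz
    have hD := hΩ.bdist_pos hz
    have key : c * bdist Ω z ^ (-(2 * s)) * |u z| ≤ B + N * (bdist Ω z / 2) ^ (-s) := by
      have hBz := _root_.abs_le.1 (hB z hz)
      rcases le_total 0 (u z) with hm | hm
      · rw [abs_of_nonneg hm]
        have := h.singOp_lower_bound hΩ h0 hs hβ hβ4 hη hlam hz hm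
        linarith [hBz.2]
      · rw [abs_of_nonpos hm]
        have := h.neg.singOp_lower_bound hΩ (fun x hx => by simp [h0 x hx]) hs hβ hβ4 hη hlam hz
          (by simpa using hm)
        rw [singOp_neg] at this
        simp only [Pi.neg_apply] at this
        linarith [hBz.1]
    have e1 : bdist Ω z ^ (-(2 * s)) * bdist Ω z ^ (2 * s) = 1 := by
      rw [← Real.rpow_add hD]; simp
    have e2 : (bdist Ω z / 2) ^ (-s) * bdist Ω z ^ (2 * s) = 2 ^ s * bdist Ω z ^ s := by
      rw [Real.div_rpow hD.le (by norm_num), Real.rpow_neg (by norm_num : (0 : ℝ) ≤ 2),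
        div_inv_eq_mul, mul_right_comm, ← Real.rpow_add hD, mul_comm]
      ring_nf
    rw [le_div_iff₀ hc]
    have := mul_le_mul_of_nonneg_right key (Real.rpow_nonneg hD.le (2 * s))
    calc |u z| * c = c * (bdist Ω z ^ (-(2 * s)) * bdist Ω z ^ (2 * s)) * |u z| := by
          rw [e1]; ring
      _ = c * bdist Ω z ^ (-(2 * s)) * |u z| * bdist Ω z ^ (2 * s) := by ring
      _ ≤ _ := this
      _ = B * bdist Ω z ^ (2 * s) +
          N * ((bdist Ω z / 2) ^ (-s) * bdist Ω z ^ (2 * s)) := by ring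
      _ = _ := by rw [e2]; ring
  have hDx := hΩ.bdist_pos hx
  have hM := h.nonneg hΩ
  obtain ⟨q, hq, hqx⟩ := hΩ.exists_frontier_dist_eq x
  rw [dist_eq_norm, norm_sub_rev] at hqx
  -- points of the segment from `x` to its nearest boundary point
  set y : ℕ → Rd d := fun n => x + (1 - 1 / ((n : ℝ) + 1)) • (q - x) with hy
  have hn : ∀ n : ℕ, 0 < 1 / ((n : ℝ) + 1) ∧ 1 / ((n : ℝ) + 1) ≤ 1 := fun n =>
    ⟨by positivity, by rw [div_le_one (by positivity)]; linarith [(Nat.cast_nonneg n : (0 : ℝ) ≤ n)]⟩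
  have hyx : ∀ n, ‖y n - x‖ = (1 - 1 / ((n : ℝ) + 1)) * bdist Ω x := fun n => by
    simp only [hy, add_sub_cancel_left, norm_smul]
    rw [Real.norm_of_nonneg (by linarith [(hn n).2]), hqx]
  have hyΩ : ∀ n, y n ∈ Ω := fun n => by
    apply hΩ.ball_subset hx
    rw [mem_ball_iff_norm, hyx]
    nlinarith [(hn n).1]
  have hyq : ∀ n, bdist Ω (y n) ≤ 1 / ((n : ℝ) + 1) * bdist Ω x := fun n => by
    refine (Metric.infDist_le_dist_of_mem hq).trans (le_of_eq ?_)
    rw [dist_eq_norm, show y n - q = (-(1 / ((n : ℝ) + 1))) • (q - x) by simp only [hy]; module,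
      norm_smul, norm_neg, Real.norm_of_nonneg (hn n).1.le, hqx]
  have hlim0 : Filter.Tendsto (fun n => bdist Ω (y n)) Filter.atTop (nhds 0) := by
    refine squeeze_zero (fun n => (hΩ.bdist_pos (hyΩ n)).le) hyq ?_
    simpa using (tendsto_one_div_add_atTop_nhds_zero_nat (𝕜 := ℝ)).mul_const (bdist Ω x)
  have hpow : ∀ a : ℝ, 0 < a →
      Filter.Tendsto (fun n => bdist Ω (y n) ^ a) Filter.atTop (nhds 0) := fun a ha => by
    have := hlim0.rpow_const (p := a) (Or.inr ha.le)
    rwa [Real.zero_rpow ha.ne'] at this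
  have hlim : Filter.Tendsto (fun n => (B * bdist Ω (y n) ^ (2 * s) +
      N * 2 ^ s * bdist Ω (y n) ^ s) / c + M * bdist Ω x ^ s) Filter.atTop
      (nhds ((B * 0 + N * 2 ^ s * 0) / c + M * bdist Ω x ^ s)) :=
    (((hpow (2 * s) (by linarith [hs.1])).const_mul B).add
      ((hpow s hs.1).const_mul _)).div_const c |>.add_const _
  rw [mul_zero, mul_zero, add_zero, zero_div, zero_add] at hlim
  refine ge_of_tendsto' hlim fun n => ?_
  have h1 := hdecay (y n) (hyΩ n)
  have h2 := h.abs_sub_le hs hx (hyΩ n)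
  have h3 : ‖x - y n‖ ^ s ≤ bdist Ω x ^ s := by
    refine Real.rpow_le_rpow (norm_nonneg _) ?_ hs.1.le
    rw [norm_sub_rev, hyx]
    nlinarith [(hn n).1]
  have h4 : |u x| ≤ |u (y n)| + |u x - u (y n)| := by
    have := abs_add_le (u (y n)) (u x - u (y n))
    rwa [add_sub_cancel] at this
  nlinarith [mul_le_mul_of_nonneg_left h3 hM]

end MemSClass

/-! ### Patches of a shape regular mesh -/

section Mesh

variable {K : Geometry.SimplicialComplex ℝ (Rd d)}

namespace IsTriangulation

lemma exists_element (hK : IsTriangulation Ω K) {x : Rd d} (hx : x ∈ closure Ω) :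
    ∃ t ∈ elements K, x ∈ cell t := by
  rw [← hK.2.1, Geometry.SimplicialComplex.mem_space_iff] at hx
  obtain ⟨t, ht, hxt⟩ := hx
  obtain ⟨t', ht', htt'⟩ := hK.2.2 t ht
  exact ⟨t', ht', convexHull_mono (by exact_mod_cast htt') hxt⟩

lemma finite_elements (hK : IsTriangulation Ω K) : (elements K).Finite :=
  hK.1.subset fun _ ht => ht.1

lemma finite_vertices (hK : IsTriangulation Ω K) : K.vertices.Finite :=
  (hK.1.preimage Finset.singleton_injective.injOn).subset fun _ hx => hx

lemma cell_subset (hK : IsTriangulation Ω K) {t : Finset (Rd d)} (ht : t ∈ elements K) :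
    cell t ⊆ closure Ω := by
  rw [← hK.2.1]; exact Geometry.SimplicialComplex.convexHull_subset_space ht.1

lemma patch_subset (hK : IsTriangulation Ω K) (z : Rd d) : patch K z ⊆ closure Ω :=
  iUnion₂_subset fun _ ht => hK.cell_subset ht.1

lemma isClosed_patch (hK : IsTriangulation Ω K) (z : Rd d) : IsClosed (patch K z) :=
  (hK.finite_elements.subset fun _ ht => ht.1).isClosed_biUnion fun t _ =>
    (t.finite_toSet.isCompact_convexHull ℝ).isClosed

end IsTriangulation

lemma isBounded_cell (t : Finset (Rd d)) : Bornology.IsBounded (cell t) :=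
  (t.finite_toSet.isCompact_convexHull ℝ).isBounded

lemma dist_le_diam_cell {t : Finset (Rd d)} {x y : Rd d} (hx : x ∈ cell t) (hy : y ∈ cell t) :
    dist x y ≤ Metric.diam (cell t) := Metric.dist_le_diam_of_mem (isBounded_cell t) hx hy

lemma mem_vertices_of_mem {t : Finset (Rd d)} (ht : t ∈ elements K) {v : Rd d} (hv : v ∈ t) :
    v ∈ K.vertices :=
  K.down_closed ht.1 (Finset.singleton_subset_iff.2 hv) (Finset.singleton_nonempty v)

lemma mem_of_mem_vertices {t : Finset (Rd d)} (ht : t ∈ elements K) {z : Rd d}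
    (hz : z ∈ K.vertices) (hzt : z ∈ cell t) : z ∈ t := by
  have h1 : z ∈ convexHull ℝ (({z} : Finset (Rd d)) : Set (Rd d)) :=
    subset_convexHull ℝ _ (by simp)
  have h2 := K.inter_subset_convexHull hz ht.1 ⟨h1, hzt⟩
  obtain ⟨y, hy⟩ := convexHull_nonempty_iff.1 ⟨z, h2⟩
  have : y = z := by simpa using hy.1
  rw [← this]; exact hy.2

/-- The barycentric coordinate of the vertex `z` of the simplex `t`. -/
lemma exists_barycentric {t : Finset (Rd d)} (ht : t ∈ elements K) {z : Rd d} (hz : z ∈ t) :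
    ∃ g : Rd d →ᵃ[ℝ] ℝ, g z = 1 ∧ ∀ v ∈ t, v ≠ z → g v = 0 := by
  have hind := K.indep ht.1
  have htop : affineSpan ℝ (range ((↑) : t → Rd d)) = ⊤ := by
    rw [hind.affineSpan_eq_top_iff_card_eq_finrank_add_one]
    simp [ht.2]
  let b : AffineBasis t ℝ (Rd d) := ⟨_, hind, htop⟩
  refine ⟨b.coord ⟨z, hz⟩, b.coord_apply_eq ⟨z, hz⟩, fun v hv hvz => ?_⟩
  exact b.coord_apply_ne (i := ⟨z, hz⟩) (j := ⟨v, hv⟩) fun h => hvz (congrArg Subtype.val h).symm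

lemma barycentric_mem_Icc {t : Finset (Rd d)} {z : Rd d} {g : Rd d →ᵃ[ℝ] ℝ} (hgz : g z = 1)
    (hg : ∀ v ∈ t, v ≠ z → g v = 0) {x : Rd d} (hx : x ∈ cell t) : g x ∈ Icc (0 : ℝ) 1 := by
  have : cell t ⊆ g ⁻¹' Icc (0 : ℝ) 1 := by
    refine convexHull_min (fun v hv => ?_) ((convex_Icc 0 1).affine_preimage g)
    rcases eq_or_ne v z with rfl | hvz
    · simp [hgz]
    · simp [hg v hv hvz]
  exact this hx

/-- An affine function with values in `[0, 1]` on a ball of radius `r` is `1/(2r)`-Lipschitz. -/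
lemma affine_sub_le {g : Rd d →ᵃ[ℝ] ℝ} {a : Rd d} {r : ℝ} (hr : 0 ≤ r)
    (hg : ∀ x ∈ Metric.closedBall a r, g x ∈ Icc (0 : ℝ) 1) (x y : Rd d) :
    (g x - g y) * (2 * r) ≤ ‖x - y‖ := by
  rcases eq_or_ne x y with rfl | hxy
  · simp
  have hn : 0 < ‖x - y‖ := norm_pos_iff.2 (sub_ne_zero.2 hxy)
  set v := (r / ‖x - y‖) • (x - y) with hv
  have hvn : ‖v‖ = r := by
    rw [hv, norm_smul, Real.norm_of_nonneg (by positivity)]; field_simp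
  have h1 := (hg (a + v) (by simp [hvn])).2
  have h2 := (hg (a - v) (by simp [hvn])).1
  have e1 : g (a + v) - g (a - v) = 2 * (r / ‖x - y‖) * (g x - g y) := by
    have hlin : ∀ p q : Rd d, g p - g q = g.linear (p - q) := fun p q => by
      rw [← vsub_eq_sub p q, g.linearMap_vsub, vsub_eq_sub]
    rw [hlin, hlin, show a + v - (a - v) = (2 * (r / ‖x - y‖)) • (x - y) by rw [hv]; module,
      map_smul, smul_eq_mul]
  have h3 : 2 * (r / ‖x - y‖) * (g x - g y) ≤ 1 := by rw [← e1]; linarith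
  rw [show 2 * (r / ‖x - y‖) * (g x - g y) = (g x - g y) * (2 * r) / ‖x - y‖ by ring,
    div_le_one hn] at h3
  exact h3

/-- A point of an element at which the barycentric coordinate of the interior vertex `z` is
positive is an interior point of the patch of `z`. -/
lemma patch_mem_nhds (hΩ : ConvexDomain Ω) (hK : IsTriangulation Ω K) {t : Finset (Rd d)}
    (ht : t ∈ elements K) {z : Rd d} (hzΩ : z ∈ Ω) {g : Rd d →ᵃ[ℝ] ℝ}
    (hgz : g z = 1) (hg : ∀ v ∈ t, v ≠ z → g v = 0) {p : Rd d} (hp : p ∈ cell t) (hgp : 0 < g p) :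
    patch K z ∈ nhds p := by
  have hpΩ : p ∈ Ω := by
    by_contra hpΩ
    obtain ⟨f, hf⟩ := geometric_hahn_banach_open_point hΩ.convex hΩ.isOpen hpΩ
    have hfc : ∀ y ∈ closure Ω, f y ≤ f p := fun y hy =>
      closure_minimal (fun a ha => (hf a ha).le) (isClosed_le f.continuous continuous_const) hy
    have hfz := hf z hzΩ
    let G : Rd d →ᵃ[ℝ] ℝ := f.toLinearMap.toAffineMap + (f p - f z) • g
    have hG : ∀ y, G y = f y + (f p - f z) * g y := fun y => rfl
    have : cell t ⊆ G ⁻¹' Iic (f p) := by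
      refine convexHull_min (fun v hv => ?_) ((convex_Iic _).affine_preimage G)
      rw [mem_preimage, mem_Iic, hG]
      rcases eq_or_ne v z with rfl | hvz
      · rw [hgz]; linarith
      · rw [hg v hv hvz, mul_zero, add_zero]
        exact hfc v (hK.cell_subset ht (subset_convexHull ℝ _ hv))
    have hGp := this hp
    rw [mem_preimage, mem_Iic, hG] at hGp
    nlinarith [mul_pos (sub_pos.2 hfz) hgp]
  -- every element that contains `p` has `z` as a vertex
  have hel : ∀ t' ∈ elements K, p ∈ cell t' → z ∈ t' := by
    intro t' ht' hp'
    by_contra hz'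
    have h1 := K.inter_subset_convexHull ht.1 ht'.1 ⟨hp, hp'⟩
    have : convexHull ℝ ((t : Set (Rd d)) ∩ t') ⊆ g ⁻¹' Iic 0 := by
      refine convexHull_min (fun v hv => ?_) ((convex_Iic _).affine_preimage g)
      have hvz : v ≠ z := fun h => hz' (h ▸ hv.2)
      simp [hg v hv.1 hvz]
    exact absurd (this h1) (not_le.2 hgp)
  have hclosed : IsClosed (⋃ t' ∈ {t' ∈ elements K | p ∉ cell t'}, cell t') :=
    (hK.finite_elements.subset fun _ h => h.1).isClosed_biUnion fun t' _ =>
      (t'.finite_toSet.isCompact_convexHull ℝ).isClosed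
  have hpn : p ∉ ⋃ t' ∈ {t' ∈ elements K | p ∉ cell t'}, cell t' := by
    simp only [mem_iUnion, not_exists]
    exact fun t' ht' hpt => ht'.2 hpt
  filter_upwards [hΩ.isOpen.mem_nhds hpΩ, hclosed.isOpen_compl.mem_nhds hpn] with y hy hy'
  obtain ⟨t', ht', hyt'⟩ := hK.exists_element (subset_closure hy)
  have hpt' : p ∈ cell t' := by
    by_contra hpt'
    exact hy' (mem_biUnion (show t' ∈ {t' ∈ elements K | p ∉ cell t'} from ⟨ht', hpt'⟩) hyt')
  exact mem_biUnion (show t' ∈ {t' ∈ elements K | z ∈ cell t'} from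
    ⟨ht', subset_convexHull ℝ _ (hel t' ht' hpt')⟩) hyt'

/-- A ray from `z` can leave the patch of `z` only where the barycentric coordinate of `z`
vanishes, and shape regularity bounds the gradient of this coordinate. -/
lemma ball_subset_patch (hΩ : ConvexDomain Ω) (hK : IsTriangulation Ω K) {κ : ℝ} (hκ : 0 < κ)
    (hS : ShapeRegular κ K) {z : Rd d} (hz : z ∈ K.vertices) (hzΩ : z ∈ Ω) {r : ℝ}
    (hr : ∀ t ∈ elements K, z ∈ cell t → r ≤ 2 * κ * Metric.diam (cell t)) :
    Metric.ball z r ⊆ patch K z := by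
  have hint : ∀ p ∈ patch K z, p ∈ Metric.ball z r ∨ p = z → p ∈ interior (patch K z) := by
    intro p hp hpr
    simp only [patch, mem_iUnion, exists_prop] at hp
    obtain ⟨t, ⟨ht, hzt⟩, hpt⟩ := hp
    obtain ⟨g, hgz, hg⟩ := exists_barycentric ht (mem_of_mem_vertices ht hz hzt)
    refine mem_interior_iff_mem_nhds.2 (patch_mem_nhds hΩ hK ht hzΩ hgz hg hpt ?_)
    rcases hpr with hpr | rfl
    · refine lt_of_le_of_ne (barycentric_mem_Icc hgz hg hpt).1 fun h0 => ?_
      obtain ⟨a, ha⟩ := hS t ht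
      have := affine_sub_le (g := g) (by positivity)
        (fun x hx => barycentric_mem_Icc hgz hg (ha hx)) z p
      rw [hgz, ← h0] at this
      rw [mem_ball_iff_norm, norm_sub_rev] at hpr
      linarith [hr t ht hzt]
    · rw [hgz]; exact one_pos
  rcases le_or_gt r 0 with hr0 | hr0
  · rw [Metric.ball_eq_empty.2 hr0]; exact empty_subset _
  have hzp : z ∈ patch K z := by
    obtain ⟨t, ht, hzt⟩ := hK.exists_element (subset_closure hzΩ)
    exact mem_biUnion (show t ∈ {t ∈ elements K | z ∈ cell t} from ⟨ht, hzt⟩) hzt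
  refine ((convex_ball z r).isPreconnected.subset_of_closure_inter_subset isOpen_interior
    ⟨z, Metric.mem_ball_self hr0, hint z hzp (Or.inr rfl)⟩ ?_).trans interior_subset
  rintro p ⟨hp, hpr⟩
  exact hint p ((hK.isClosed_patch z).closure_subset_iff.2 interior_subset hp) (Or.inl hpr)

lemma le_bdist_of_ball_subset_patch (hΩ : ConvexDomain Ω) (hK : IsTriangulation Ω K) {z : Rd d}
    {r : ℝ} (h : Metric.ball z r ⊆ patch K z) : r ≤ bdist Ω z := by
  refine hΩ.le_bdist_of_ball_subset ?_
  rw [← hΩ.interior_closure]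
  exact interior_maximal (h.trans (hK.patch_subset z)) Metric.isOpen_ball

lemma patchSize_le_bdist (hΩ : ConvexDomain Ω) (hK : IsTriangulation Ω K) (z : Rd d) :
    patchSize K z ≤ bdist Ω z :=
  csSup_le ⟨0, by simp⟩ fun _ h => le_bdist_of_ball_subset_patch hΩ hK h

lemma le_patchSize (hΩ : ConvexDomain Ω) (hK : IsTriangulation Ω K) {κ : ℝ} (hκ : 0 < κ)
    (hS : ShapeRegular κ K) {z : Rd d} (hz : z ∈ K.vertices) (hzΩ : z ∈ Ω) {r : ℝ}
    (hr : ∀ t ∈ elements K, z ∈ cell t → r ≤ 2 * κ * Metric.diam (cell t)) : r ≤ patchSize K z :=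
  le_csSup ⟨_, fun _ h => le_bdist_of_ball_subset_patch hΩ hK h⟩
    (ball_subset_patch hΩ hK hκ hS hz hzΩ hr)

lemma patchSize_le [Nontrivial (Rd d)] {z : Rd d} {H : ℝ} (hH : 0 ≤ H)
    (h : ∀ t ∈ elements K, z ∈ cell t → Metric.diam (cell t) ≤ H) : patchSize K z ≤ H := by
  refine csSup_le ⟨0, by simp⟩ fun r hr => le_of_forall_lt fun r' hr' => ?_
  by_contra! hle
  obtain ⟨r'', h1, h2⟩ := exists_between hr'
  have h3 : 0 < r'' := hH.trans_lt (hle.trans_lt h1)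
  obtain ⟨e, he⟩ := exists_norm_eq (Rd d) h3.le
  have hmem : z + e ∈ patch K z := hr (by rw [mem_ball_iff_norm, add_sub_cancel_left, he]; exact h2)
  simp only [patch, mem_iUnion, exists_prop] at hmem
  obtain ⟨t, ⟨ht, hzt⟩, het⟩ := hmem
  have := dist_le_diam_cell het hzt
  rw [dist_eq_norm, add_sub_cancel_left, he] at this
  linarith [h t ht hzt]

/-! ### Distances on a graded mesh -/

lemma setDist_le_bdist (hΩ : ConvexDomain Ω) {t : Finset (Rd d)} {x : Rd d} (hx : x ∈ cell t) :
    setDist (cell t) (frontier Ω) ≤ bdist Ω x := by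
  refine (Metric.le_infDist hΩ.frontier_nonempty).2 fun b hb => csInf_le ⟨0, ?_⟩ ⟨x, hx, b, hb, rfl⟩
  rintro _ ⟨a, -, b, -, rfl⟩
  exact dist_nonneg

lemma le_setDist (hΩ : ConvexDomain Ω) {t : Finset (Rd d)} (ht : (cell t).Nonempty) {ρ : ℝ}
    (h : ∀ a ∈ cell t, ρ ≤ bdist Ω a) : ρ ≤ setDist (cell t) (frontier Ω) := by
  refine le_csInf (ht.image2 hΩ.frontier_nonempty) ?_
  rintro _ ⟨a, ha, b, hb, rfl⟩
  exact (h a ha).trans (Metric.infDist_le_dist_of_mem hb)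

lemma bdist_le_setDist_add (hΩ : ConvexDomain Ω) {t : Finset (Rd d)} {x : Rd d} (hx : x ∈ cell t) :
    bdist Ω x ≤ setDist (cell t) (frontier Ω) + Metric.diam (cell t) := by
  have : bdist Ω x - Metric.diam (cell t) ≤ setDist (cell t) (frontier Ω) :=
    le_setDist hΩ ⟨x, hx⟩ fun a ha => by
      have h1 := hΩ.le_bdist_add x a
      have h2 := dist_le_diam_cell hx ha
      rw [dist_eq_norm] at h2
      linarith
  linarith

lemma bdist_le_diam_of_touching {t : Finset (Rd d)} {x : Rd d}
    (hx : x ∈ cell t) (ht : (cell t ∩ frontier Ω).Nonempty) :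
    bdist Ω x ≤ Metric.diam (cell t) := by
  obtain ⟨q, hqt, hq⟩ := ht
  exact (Metric.infDist_le_dist_of_mem hq).trans (dist_le_diam_cell hx hqt)

lemma mem_of_mem_cell (hΩ : ConvexDomain Ω) (hK : IsTriangulation Ω K) {t : Finset (Rd d)}
    (ht : t ∈ elements K) (hne : cell t ∩ frontier Ω = ∅) {x : Rd d} (hx : x ∈ cell t) :
    x ∈ Ω := by
  by_contra hxΩ
  exact (hne.subset ⟨hx, hΩ.mem_frontier_of_mem_closure (hK.cell_subset ht hx) hxΩ⟩ :
    x ∈ (∅ : Set (Rd d)))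

lemma cell_nonempty {t : Finset (Rd d)} (ht : t ∈ elements K) : (cell t).Nonempty :=
  convexHull_nonempty_iff.2 (by exact_mod_cast K.nonempty_of_mem_faces ht.1)

/-- On an element that does not touch the boundary, `δ` is at least its minimum over the interior
vertices, because the superlevel sets of `δ` are convex. -/
lemma le_setDist_of_vertices (hΩ : ConvexDomain Ω) (hK : IsTriangulation Ω K) {ρ : ℝ}
    (hρ : ∀ z ∈ K.vertices ∩ Ω, ρ ≤ bdist Ω z) {t : Finset (Rd d)} (ht : t ∈ elements K)
    (hne : cell t ∩ frontier Ω = ∅) : ρ ≤ setDist (cell t) (frontier Ω) := by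
  have : cell t ⊆ {x ∈ Ω | ρ ≤ bdist Ω x} := by
    refine convexHull_min (fun v hv => ?_) (hΩ.convex_superlevel ρ)
    have hvΩ : v ∈ Ω := mem_of_mem_cell hΩ hK ht hne (subset_convexHull ℝ _ hv)
    exact ⟨hvΩ, hρ v ⟨mem_vertices_of_mem ht hv, hvΩ⟩⟩
  exact le_setDist hΩ (cell_nonempty ht) fun a ha => (this ha).2

end Mesh

/-- Quantitative consequences of shape regularity and grading: interior vertices and elements that
do not touch the boundary have distance at least of order `h^μ` to it, the distance to the boundary
is comparable on such elements, and `h_z ≈ h δ(z)^{(μ-1)/μ}`. -/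
structure MeshBounds (Ω : Set (Rd d)) (K : Geometry.SimplicialComplex ℝ (Rd d))
    (μ h c₁ c₂ c₃ c₄ : ℝ) : Prop where
  le_bdist : ∀ z ∈ K.vertices ∩ Ω, c₁ * h ^ μ ≤ bdist Ω z
  le_setDist : ∀ t ∈ elements K, cell t ∩ frontier Ω = ∅ →
    c₁ * h ^ μ ≤ setDist (cell t) (frontier Ω)
  bdist_le : ∀ t ∈ elements K, cell t ∩ frontier Ω = ∅ → ∀ x ∈ cell t,
    bdist Ω x ≤ c₂ * setDist (cell t) (frontier Ω)
  le_patchSize : ∀ z ∈ K.vertices ∩ Ω, c₃ * (h * bdist Ω z ^ ((μ - 1) / μ)) ≤ patchSize K z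
  patchSize_le : ∀ z ∈ K.vertices ∩ Ω, patchSize K z ≤ c₄ * (h * bdist Ω z ^ ((μ - 1) / μ))

/-- The smallest distance `δ` of an interior vertex to the boundary satisfies `δ ≳ h^μ` or
`δ ≳ h δ^{(μ-1)/μ}`, and both give the same lower bound. -/
lemma vertex_bdist_lower_bound {K : Geometry.SimplicialComplex ℝ (Rd d)} {μ κ c h : ℝ}
    (hμ : 1 ≤ μ) (hκ : 0 < κ) (hc : 0 < c) (hΩ : ConvexDomain Ω) (hh : 0 < h)
    (hK : IsTriangulation Ω K) (hS : ShapeRegular κ K) (hG : IsGraded Ω μ c h K) :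
    ∀ z ∈ K.vertices ∩ Ω, min (2 * κ / c) ((2 * κ / c) ^ μ) * h ^ μ ≤ bdist Ω z := by
  intro z hz
  have hμ0 : 0 < μ := by linarith
  obtain ⟨z₀, hz₀, hmin⟩ := (hK.finite_vertices.inter_of_left Ω).exists_minimalFor
    (bdist Ω) _ ⟨z, hz⟩
  have hmin' : ∀ y ∈ K.vertices ∩ Ω, bdist Ω z₀ ≤ bdist Ω y := fun y hy =>
    (le_total (bdist Ω z₀) (bdist Ω y)).elim id fun h' => hmin hy h'
  refine le_trans ?_ (hmin' z hz)
  set δ := bdist Ω z₀ with hδ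
  have hδ0 : 0 < δ := hΩ.bdist_pos hz₀.2
  have hhμ : 0 < h ^ μ := Real.rpow_pos_of_pos hh μ
  have hge := (le_patchSize hΩ hK hκ hS hz₀.1 hz₀.2
    (r := 2 * κ * min (c⁻¹ * h ^ μ) (c⁻¹ * (h * δ ^ ((μ - 1) / μ)))) fun t ht _ => by
      refine mul_le_mul_of_nonneg_left ?_ (by positivity)
      rcases (cell t ∩ frontier Ω).eq_empty_or_nonempty with he | hne
      · refine (min_le_right _ _).trans (le_trans ?_ ((hG t ht).2 he).1)
        have h1 := le_setDist_of_vertices hΩ hK hmin' ht he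
        have h2 : 0 ≤ (μ - 1) / μ := div_nonneg (by linarith) hμ0.le
        gcongr
      · exact (min_le_left _ _).trans ((hG t ht).1 hne).1).trans (patchSize_le_bdist hΩ hK z₀)
  rw [← hδ] at hge
  rcases le_total (c⁻¹ * h ^ μ) (c⁻¹ * (h * δ ^ ((μ - 1) / μ))) with h1 | h1
  · rw [min_eq_left h1] at hge
    calc _ ≤ 2 * κ / c * h ^ μ := by gcongr; exact min_le_left _ _
      _ = 2 * κ * (c⁻¹ * h ^ μ) := by ring
      _ ≤ δ := hge
  · rw [min_eq_right h1] at hge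
    have e1 : δ ^ ((μ - 1) / μ) * δ ^ (1 / μ) = δ := by
      rw [← Real.rpow_add hδ0, ← add_div, sub_add_cancel, div_self hμ0.ne', Real.rpow_one]
    have hp : 0 < δ ^ ((μ - 1) / μ) := Real.rpow_pos_of_pos hδ0 _
    have h2 : 2 * κ / c * h ≤ δ ^ (1 / μ) := by
      refine le_of_mul_le_mul_left ?_ hp
      rw [e1]
      refine le_trans (le_of_eq ?_) hge
      ring
    have h3 := Real.rpow_le_rpow (by positivity) h2 hμ0.le
    rw [← Real.rpow_mul hδ0.le, one_div_mul_cancel hμ0.ne', Real.rpow_one,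
      Real.mul_rpow (by positivity) hh.le] at h3
    refine le_trans ?_ h3
    gcongr
    exact min_le_right _ _

lemma exists_meshBounds {μ κ c : ℝ} (hμ : 1 ≤ μ) (hκ : 0 < κ) (hc : 0 < c) :
    ∃ c₁ c₂ c₃ c₄ : ℝ, 0 < c₁ ∧ 1 ≤ c₂ ∧ 0 < c₃ ∧ 0 < c₄ ∧
      ∀ (d : ℕ) (Ω : Set (Rd d)) (h : ℝ) (K : Geometry.SimplicialComplex ℝ (Rd d)),
        Nontrivial (Rd d) → ConvexDomain Ω → 0 < h → IsTriangulation Ω K → ShapeRegular κ K →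
          IsGraded Ω μ c h K → MeshBounds Ω K μ h c₁ c₂ c₃ c₄ := by
  have hμ0 : 0 < μ := by linarith
  set ν := (μ - 1) / μ with hν
  have hν0 : 0 ≤ ν := div_nonneg (by linarith) hμ0.le
  have hν1 : μ * ν = μ - 1 := by rw [hν]; field_simp
  set c₁ := min (2 * κ / c) ((2 * κ / c) ^ μ) with hc₁
  have hc₁0 : 0 < c₁ := lt_min (by positivity) (by positivity)
  set c₂ := 1 + c * c₁ ^ (-(1 / μ)) with hc₂
  have hc₂1 : 1 ≤ c₂ := le_add_of_nonneg_right (by positivity)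
  refine ⟨c₁, c₂, 2 * κ * min (c⁻¹ * c ^ (-ν)) (c⁻¹ * c₂ ^ (-ν)), max (c * c₁ ^ (-ν)) c,
    hc₁0, hc₂1, by positivity, by positivity, fun d Ω h K _ hΩ hh hK hS hG => ?_⟩
  have hhμ : 0 < h ^ μ := Real.rpow_pos_of_pos hh μ
  have hvert := vertex_bdist_lower_bound hμ hκ hc hΩ hh hK hS hG
  rw [← hc₁] at hvert
  have helem : ∀ t ∈ elements K, cell t ∩ frontier Ω = ∅ →
      c₁ * h ^ μ ≤ setDist (cell t) (frontier Ω) := fun t ht hne =>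
    le_setDist_of_vertices hΩ hK hvert ht hne
  have hmulμ : h * (h ^ μ) ^ ν = h ^ μ := by
    rw [← Real.rpow_mul hh.le, hν1, Real.rpow_sub_one hh.ne']; field_simp
  have hcomp : ∀ t ∈ elements K, cell t ∩ frontier Ω = ∅ → ∀ x ∈ cell t,
      bdist Ω x ≤ c₂ * setDist (cell t) (frontier Ω) := by
    intro t ht hne x hx
    have h1 := bdist_le_setDist_add hΩ hx
    have h2 := ((hG t ht).2 hne).2
    have h3 := helem t ht hne
    set D := setDist (cell t) (frontier Ω)
    have hD0 : 0 < D := (by positivity : 0 < c₁ * h ^ μ).trans_le h3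
    have h4 : h ≤ c₁ ^ (-(1 / μ)) * D ^ (1 / μ) := by
      have h5 : h ^ μ ≤ D / c₁ := by rw [le_div_iff₀ hc₁0]; linarith
      have h6 := Real.rpow_le_rpow hhμ.le h5 (by positivity : 0 ≤ 1 / μ)
      rw [← Real.rpow_mul hh.le, mul_one_div_cancel hμ0.ne', Real.rpow_one,
        Real.div_rpow hD0.le hc₁0.le] at h6
      rw [Real.rpow_neg hc₁0.le]
      refine h6.trans (le_of_eq ?_)
      ring
    have e1 : D ^ (1 / μ) * D ^ ν = D := by
      rw [← Real.rpow_add hD0, hν, ← add_div, add_sub_cancel, div_self hμ0.ne', Real.rpow_one]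
    calc bdist Ω x ≤ D + c * (h * D ^ ν) := by linarith
      _ ≤ D + c * (c₁ ^ (-(1 / μ)) * D ^ (1 / μ) * D ^ ν) := by gcongr
      _ = c₂ * D := by rw [mul_assoc, e1, hc₂]; ring
  refine ⟨hvert, helem, hcomp, fun z hz => ?_, fun z hz => ?_⟩
  · have hδ := hΩ.bdist_pos hz.2
    refine le_patchSize hΩ hK hκ hS hz.1 hz.2 fun t ht hzt => ?_
    rw [mul_assoc]
    refine mul_le_mul_of_nonneg_left ?_ (by positivity)
    rcases (cell t ∩ frontier Ω).eq_empty_or_nonempty with he | hne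
    · refine le_trans ?_ ((hG t ht).2 he).1
      have h1 := hcomp t ht he z hzt
      have h3 := helem t ht he
      set D := setDist (cell t) (frontier Ω)
      have hD0 : 0 < D := (by positivity : 0 < c₁ * h ^ μ).trans_le h3
      have h2 : c₂ ^ (-ν) * bdist Ω z ^ ν ≤ D ^ ν := by
        have := Real.rpow_le_rpow hδ.le h1 hν0
        rw [Real.mul_rpow (by positivity) hD0.le] at this
        rw [Real.rpow_neg (by positivity), inv_mul_le_iff₀ (by positivity)]
        exact this
      calc _ ≤ c⁻¹ * c₂ ^ (-ν) * (h * bdist Ω z ^ ν) := by gcongr; exact min_le_right _ _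
        _ = c⁻¹ * (h * (c₂ ^ (-ν) * bdist Ω z ^ ν)) := by ring
        _ ≤ _ := by gcongr
    · refine le_trans ?_ ((hG t ht).1 hne).1
      have h1 : bdist Ω z ≤ c * h ^ μ :=
        (bdist_le_diam_of_touching hzt hne).trans ((hG t ht).1 hne).2
      have h2 : c ^ (-ν) * bdist Ω z ^ ν ≤ (h ^ μ) ^ ν := by
        have := Real.rpow_le_rpow hδ.le h1 hν0
        rw [Real.mul_rpow (by positivity) hhμ.le] at this
        rw [Real.rpow_neg (by positivity), inv_mul_le_iff₀ (by positivity)]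
        exact this
      calc _ ≤ c⁻¹ * c ^ (-ν) * (h * bdist Ω z ^ ν) := by gcongr; exact min_le_left _ _
        _ = c⁻¹ * (h * (c ^ (-ν) * bdist Ω z ^ ν)) := by ring
        _ ≤ c⁻¹ * (h * (h ^ μ) ^ ν) := by gcongr
        _ = _ := by rw [hmulμ]
  · have hδ := hΩ.bdist_pos hz.2
    refine patchSize_le (by positivity) fun t ht hzt => ?_
    rcases (cell t ∩ frontier Ω).eq_empty_or_nonempty with he | hne
    · refine ((hG t ht).2 he).2.trans ?_
      have h1 := setDist_le_bdist hΩ hzt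
      have h3 := helem t ht he
      have hD0 : 0 < setDist (cell t) (frontier Ω) :=
        (by positivity : 0 < c₁ * h ^ μ).trans_le h3
      refine mul_le_mul (le_max_right _ _) ?_ (by positivity) (by positivity)
      gcongr
    · refine ((hG t ht).1 hne).2.trans ?_
      have h1 : h ^ μ ≤ bdist Ω z / c₁ := by
        rw [le_div_iff₀ hc₁0, mul_comm]; exact hvert z hz
      have h2 := Real.rpow_le_rpow hhμ.le h1 hν0
      rw [Real.div_rpow hδ.le hc₁0.le] at h2
      calc c * h ^ μ = c * (h * (h ^ μ) ^ ν) := by rw [hmulμ]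
        _ ≤ c * (h * (bdist Ω z ^ ν / c₁ ^ ν)) := by gcongr
        _ = c * c₁ ^ (-ν) * (h * bdist Ω z ^ ν) := by rw [Real.rpow_neg hc₁0.le]; ring
        _ ≤ _ := by gcongr; exact le_max_left _ _

/-! ### Powers of the mesh size and of the distance to the boundary -/

lemma rpow_le_of_comparable {a b A q : ℝ} (ha : 0 < a) (hb : 0 < b) (hA : 0 < A)
    (hab : a ≤ A * b) (hba : b ≤ A * a) : a ^ q ≤ A ^ |q| * b ^ q := by
  rcases le_total 0 q with hq | hq
  · rw [abs_of_nonneg hq, ← Real.mul_rpow hA.le hb.le]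
    exact Real.rpow_le_rpow ha.le hab hq
  · rw [abs_of_nonpos hq, Real.rpow_neg hA.le, ← Real.inv_rpow hA.le,
      ← Real.mul_rpow (inv_nonneg.2 hA.le) hb.le]
    refine Real.rpow_le_rpow_of_nonpos (by positivity) ?_ hq
    rw [inv_mul_le_iff₀ hA]; exact hba

/-- The two error regimes: at distance of order one from the boundary the rate is `h^p`, at the
smallest admissible distance `h^μ` it is `h^{μ s}`. -/
lemma rpow_mul_rpow_le {h δ c₁ R μ s p : ℝ} (hh : 0 < h) (hμ : 0 < μ) (hc₁ : 0 < c₁)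
    (hδ : c₁ * h ^ μ ≤ δ) (hδR : δ ≤ R) :
    h ^ p * δ ^ (s - p / μ) ≤
      (R ^ (s - p / μ) + c₁ ^ (s - p / μ)) * max (h ^ (μ * s)) (h ^ p) := by
  have hhμ : 0 < h ^ μ := Real.rpow_pos_of_pos hh μ
  have hδ0 : 0 < δ := (mul_pos hc₁ hhμ).trans_le hδ
  have hR : 0 < R := hδ0.trans_le hδR
  rw [add_mul]
  have n1 : 0 ≤ R ^ (s - p / μ) * max (h ^ (μ * s)) (h ^ p) := by positivity
  have n2 : 0 ≤ c₁ ^ (s - p / μ) * max (h ^ (μ * s)) (h ^ p) := by positivity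
  rcases le_total 0 (s - p / μ) with hq | hq
  · have h1 := Real.rpow_le_rpow hδ0.le hδR hq
    calc h ^ p * δ ^ (s - p / μ) ≤ max (h ^ (μ * s)) (h ^ p) * R ^ (s - p / μ) := by
          gcongr; exact le_max_right _ _
      _ ≤ _ := by linarith
  · have h1 := Real.rpow_le_rpow_of_nonpos (mul_pos hc₁ hhμ) hδ hq
    rw [Real.mul_rpow hc₁.le hhμ.le, ← Real.rpow_mul hh.le] at h1
    have e : h ^ p * h ^ (μ * (s - p / μ)) = h ^ (μ * s) := by
      rw [← Real.rpow_add hh]; congr 1; field_simp; ring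
    calc h ^ p * δ ^ (s - p / μ) ≤ h ^ p * (c₁ ^ (s - p / μ) * h ^ (μ * (s - p / μ))) := by gcongr
      _ = c₁ ^ (s - p / μ) * h ^ (μ * s) := by rw [← e]; ring
      _ ≤ c₁ ^ (s - p / μ) * max (h ^ (μ * s)) (h ^ p) := by gcongr; exact le_max_left _ _
      _ ≤ _ := by linarith

/-! ### The interpolation error -/

/-- Functions of class `S^β` that vanish off `Ω` and on the boundary, quantitatively
`|u| ≤ M δ^s`. -/
structure ZeroTraceSClass (s β : ℝ) (Ω : Set (Rd d)) (M : ℝ) (u : Rd d → ℝ) : Prop where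
  memS : MemSClass s β Ω M u
  zero : ∀ x, x ∉ Ω → u x = 0
  abs_le : ∀ x ∈ Ω, |u x| ≤ M * bdist Ω x ^ s

lemma ZeroTraceSClass.neg {s β M : ℝ} {u : Rd d → ℝ} (h : ZeroTraceSClass s β Ω M u) :
    ZeroTraceSClass s β Ω M (-u) :=
  ⟨h.memS.neg, fun x hx => by simp [h.zero x hx], fun x hx => by simpa using h.abs_le x hx⟩

/-- The error at `x` of the affine interpolation of `u` in the vertices of any element that contains
`x` is at most `E`; the interpolant is written through the convex combinations representing `x`. -/
def InterpErrorLE (K : Geometry.SimplicialComplex ℝ (Rd d)) (u : Rd d → ℝ) (x : Rd d)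
    (E : ℝ) : Prop :=
  ∀ t ∈ elements K, x ∈ cell t → ∀ a : Rd d → ℝ, (∀ v ∈ t, 0 ≤ a v) → ∑ v ∈ t, a v = 1 →
    ∑ v ∈ t, a v • v = x → |u x - ∑ v ∈ t, a v * u v| ≤ E

lemma InterpErrorLE.sub_le {K : Geometry.SimplicialComplex ℝ (Rd d)} {u uh : Rd d → ℝ} {x : Rd d}
    {E m : ℝ} (h : InterpErrorLE K u x E) (hK : IsTriangulation Ω K) (huh : MemFE0 Ω K uh)
    (hx : x ∈ closure Ω) (hm : ∀ t ∈ elements K, ∀ v ∈ t, u v - uh v ≤ m) :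
    u x - uh x ≤ m + E := by
  obtain ⟨t, ht, hxt⟩ := hK.exists_element hx
  obtain ⟨a, ha0, ha1, hax⟩ := Finset.mem_convexHull'.1 hxt
  have h1 := (_root_.abs_le.1 (h t ht hxt a ha0 ha1 hax)).2
  obtain ⟨g, hg⟩ := huh.2.2 t ht
  have h2 : uh x = ∑ v ∈ t, a v * uh v := by
    have hgx : g x = ∑ v ∈ t, a v * g v := by
      have hdec : ∀ y, g y = g.linear y + g 0 := fun y => congrFun g.decomp y
      have e1 : ∑ v ∈ t, a v * g v = ∑ v ∈ t, (a v * g.linear v + a v * g 0) :=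
        Finset.sum_congr rfl fun v _ => by rw [hdec v, mul_add]
      rw [e1, Finset.sum_add_distrib, ← Finset.sum_mul, ha1, one_mul, hdec x, ← hax, map_sum]
      simp
    rw [hg hxt, hgx]
    exact Finset.sum_congr rfl fun v hv => by rw [hg (subset_convexHull ℝ _ hv)]
  have h3 : ∑ v ∈ t, a v * u v - ∑ v ∈ t, a v * uh v ≤ m := by
    rw [← Finset.sum_sub_distrib]
    calc ∑ v ∈ t, (a v * u v - a v * uh v) ≤ ∑ v ∈ t, a v * m :=
          Finset.sum_le_sum fun v hv => by
            rw [← mul_sub]; exact mul_le_mul_of_nonneg_left (hm t ht v hv) (ha0 v hv)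
      _ = m := by rw [← Finset.sum_mul, ha1, one_mul]
  linarith

namespace ZeroTraceSClass

variable {s β M μ c h : ℝ} {u : Rd d → ℝ} {K : Geometry.SimplicialComplex ℝ (Rd d)}

lemma interp_error_of_touching (hu : ZeroTraceSClass s β Ω M u) (hΩ : ConvexDomain Ω)
    (hs : s ∈ Ioo (0 : ℝ) 1) (hc : 0 < c) (hh : 0 < h) (hG : IsGraded Ω μ c h K)
    {t : Finset (Rd d)} (ht : t ∈ elements K) (hne : (cell t ∩ frontier Ω).Nonempty) {x : Rd d}
    (hx : x ∈ cell t) {a : Rd d → ℝ} (ha0 : ∀ v ∈ t, 0 ≤ a v) (ha1 : ∑ v ∈ t, a v = 1) :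
    |u x - ∑ v ∈ t, a v * u v| ≤ 2 * M * c ^ s * h ^ (μ * s) := by
  have hM := hu.memS.nonneg hΩ
  have hd : ∀ y ∈ cell t, |u y| ≤ M * c ^ s * h ^ (μ * s) := by
    intro y hy
    by_cases hyΩ : y ∈ Ω
    · refine (hu.abs_le y hyΩ).trans ?_
      have h1 := (bdist_le_diam_of_touching hy hne).trans ((hG t ht).1 hne).2
      have h2 := Real.rpow_le_rpow (hΩ.bdist_pos hyΩ).le h1 hs.1.le
      rw [Real.mul_rpow hc.le (by positivity), ← Real.rpow_mul hh.le] at h2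
      rw [mul_assoc]
      exact mul_le_mul_of_nonneg_left h2 hM
    · rw [hu.zero y hyΩ, abs_zero]; positivity
  have h1 : |∑ v ∈ t, a v * u v| ≤ M * c ^ s * h ^ (μ * s) := by
    refine (Finset.abs_sum_le_sum_abs _ _).trans ?_
    calc ∑ v ∈ t, |a v * u v| ≤ ∑ v ∈ t, a v * (M * c ^ s * h ^ (μ * s)) :=
          Finset.sum_le_sum fun v hv => by
            rw [abs_mul, abs_of_nonneg (ha0 v hv)]
            exact mul_le_mul_of_nonneg_left (hd v (subset_convexHull ℝ _ hv)) (ha0 v hv)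
      _ = _ := by rw [← Finset.sum_mul, ha1, one_mul]
  refine (abs_sub _ _).trans ?_
  linarith [hd x hx]

lemma interp_error_of_not_touching (hu : ZeroTraceSClass s β Ω M u) (hΩ : ConvexDomain Ω)
    (hs : s ∈ Ioo (0 : ℝ) 1) (hβ : s < β) (hβ4 : β < 4) (hμ : 1 ≤ μ) (hc : 0 < c) (hh : 0 < h)
    (hK : IsTriangulation Ω K) (hG : IsGraded Ω μ c h K)
    {t : Finset (Rd d)} (ht : t ∈ elements K) (hne : cell t ∩ frontier Ω = ∅)
    (hD : 0 < setDist (cell t) (frontier Ω)) {x : Rd d}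
    (hx : x ∈ cell t) {a : Rd d → ℝ} (ha0 : ∀ v ∈ t, 0 ≤ a v) (ha1 : ∑ v ∈ t, a v = 1)
    (hax : ∑ v ∈ t, a v • v = x) :
    |u x - ∑ v ∈ t, a v * u v| ≤ 10 * M * 2 ^ (min β 2 - s) * c ^ min β 2 *
      (h ^ min β 2 * setDist (cell t) (frontier Ω) ^ (s - min β 2 / μ)) := by
  have hM := hu.memS.nonneg hΩ
  have hμ0 : 0 < μ := by linarith
  have hb0 : 0 < min β 2 := lt_min (hs.1.trans hβ) two_pos
  set D := setDist (cell t) (frontier Ω) with hDdef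
  set b := min β 2 with hb
  obtain ⟨L, hL⟩ := hu.memS.exists_linear_approx hΩ hs hβ hβ4 hD x
  set E := 10 * M * (D / 2) ^ (s - b) * Metric.diam (cell t) ^ b with hE
  have hv : ∀ v ∈ t, |u v - u x - L (v - x)| ≤ E := by
    intro v hv
    have hvc : v ∈ cell t := subset_convexHull ℝ _ hv
    have h1 := hL (v - x) fun τ hτ => by
      have hmem : x + τ • (v - x) ∈ cell t :=
        (convex_convexHull ℝ _).add_smul_sub_mem hx hvc hτ
      exact ⟨mem_of_mem_cell hΩ hK ht hne hmem, setDist_le_bdist hΩ hmem⟩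
    rw [add_sub_cancel] at h1
    refine h1.trans ?_
    have h2 : ‖v - x‖ ≤ Metric.diam (cell t) := by
      rw [← dist_eq_norm]; exact dist_le_diam_cell hvc hx
    rw [hE]
    gcongr
  have hsum : ∑ v ∈ t, a v * (u v - u x - L (v - x)) = ∑ v ∈ t, a v * u v - u x := by
    have e1 : ∑ v ∈ t, a v * L (v - x) = 0 := by
      have : ∑ v ∈ t, a v • (v - x) = 0 := by
        simp only [smul_sub]
        rw [Finset.sum_sub_distrib, hax, ← Finset.sum_smul, ha1, one_smul, sub_self]
      have h2 := congrArg L this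
      rw [map_sum, map_zero] at h2
      simpa using h2
    have e2 : ∀ v, a v * (u v - u x - L (v - x)) = a v * u v - a v * u x - a v * L (v - x) :=
      fun v => by ring
    rw [Finset.sum_congr rfl fun v _ => e2 v, Finset.sum_sub_distrib, Finset.sum_sub_distrib,
      ← Finset.sum_mul, ha1, one_mul]
    linarith
  have h1 : |u x - ∑ v ∈ t, a v * u v| ≤ E := by
    rw [abs_sub_comm, ← hsum]
    refine (Finset.abs_sum_le_sum_abs _ _).trans ?_
    calc ∑ v ∈ t, |a v * (u v - u x - L (v - x))| ≤ ∑ v ∈ t, a v * E :=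
          Finset.sum_le_sum fun v hvt => by
            rw [abs_mul, abs_of_nonneg (ha0 v hvt)]
            exact mul_le_mul_of_nonneg_left (hv v hvt) (ha0 v hvt)
      _ = _ := by rw [← Finset.sum_mul, ha1, one_mul]
  refine h1.trans ?_
  have h2 := Real.rpow_le_rpow Metric.diam_nonneg ((hG t ht).2 hne).2 hb0.le
  rw [← hDdef, Real.mul_rpow hc.le (by positivity), Real.mul_rpow hh.le (by positivity),
    ← Real.rpow_mul hD.le] at h2
  have e2 : (D / 2) ^ (s - b) = 2 ^ (b - s) * D ^ (s - b) := by
    rw [Real.div_rpow hD.le (by norm_num), ← neg_sub b s, Real.rpow_neg (by norm_num : (0:ℝ) ≤ 2)]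
    field_simp
  have e3 : D ^ (s - b) * D ^ ((μ - 1) / μ * b) = D ^ (s - b / μ) := by
    rw [← Real.rpow_add hD]; congr 1; field_simp; ring
  calc E ≤ 10 * M * (D / 2) ^ (s - b) * (c ^ b * (h ^ b * D ^ ((μ - 1) / μ * b))) := by
        rw [hE]; gcongr
    _ = 10 * M * 2 ^ (b - s) * c ^ b * (h ^ b * (D ^ (s - b) * D ^ ((μ - 1) / μ * b))) := by
        rw [e2]; ring
    _ = _ := by rw [e3]

end ZeroTraceSClass

lemma ConvexDomain.bdist_le_diam (hΩ : ConvexDomain Ω) {x : Rd d} (hx : x ∈ Ω) :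
    bdist Ω x ≤ Metric.diam (closure Ω) := by
  obtain ⟨q, hq⟩ := hΩ.frontier_nonempty
  exact (Metric.infDist_le_dist_of_mem hq).trans
    (Metric.dist_le_diam_of_mem hΩ.isBounded.closure (subset_closure hx)
      (frontier_subset_closure hq))

/-- Some element touches the boundary, which bounds the mesh size in terms of `diam Ω`. -/
lemma mesh_size_le {K : Geometry.SimplicialComplex ℝ (Rd d)} {μ c h : ℝ} (hμ : 0 < μ) (hc : 0 < c)
    (hh : 0 < h) (hΩ : ConvexDomain Ω) (hK : IsTriangulation Ω K) (hG : IsGraded Ω μ c h K) :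
    h ≤ (c * Metric.diam (closure Ω)) ^ (1 / μ) := by
  obtain ⟨q, hq⟩ := hΩ.frontier_nonempty
  obtain ⟨t, ht, hqt⟩ := hK.exists_element (frontier_subset_closure hq)
  have h1 := ((hG t ht).1 ⟨q, hqt, hq⟩).1
  have h2 := Metric.diam_mono (hK.cell_subset ht) hΩ.isBounded.closure
  have h3 : h ^ μ ≤ c * Metric.diam (closure Ω) := by
    rw [← inv_mul_le_iff₀ hc]; exact h1.trans h2
  have h4 := Real.rpow_le_rpow (by positivity) h3 (by positivity : 0 ≤ 1 / μ)
  rwa [← Real.rpow_mul hh.le, mul_one_div_cancel hμ.ne', Real.rpow_one] at h4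

/-- The interpolation error, locally around an interior vertex `z` in terms of `δ(z)`, and
globally. -/
lemma exists_interpError_const {s β μ c c₁ c₂ M : ℝ} (hs : s ∈ Ioo (0 : ℝ) 1) (hβ : s < β)
    (hβ4 : β < 4) (hμ : 1 ≤ μ) (hc : 0 < c) (hc₁ : 0 < c₁) (hc₂ : 1 ≤ c₂) (hM : 0 ≤ M)
    (hΩ : ConvexDomain Ω) :
    ∃ C₁ C₂ : ℝ, 0 ≤ C₁ ∧ 0 ≤ C₂ ∧ ∀ (u : Rd d → ℝ), ZeroTraceSClass s β Ω M u →
      ∀ (h c₃ c₄ : ℝ) (K : Geometry.SimplicialComplex ℝ (Rd d)), 0 < h → IsTriangulation Ω K →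
      IsGraded Ω μ c h K → MeshBounds Ω K μ h c₁ c₂ c₃ c₄ →
      (∀ z ∈ K.vertices ∩ Ω, ∀ x ∈ Ω, ‖x - z‖ < bdist Ω z / 2 →
        InterpErrorLE K u x (C₁ * (h ^ min β 2 * bdist Ω z ^ (s - min β 2 / μ)))) ∧
      ∀ x ∈ Ω, InterpErrorLE K u x (C₂ * max (h ^ (μ * s)) (h ^ min β 2)) := by
  have hμ0 : 0 < μ := by linarith
  set b := min β 2 with hb
  set q := s - b / μ with hq
  set R := Metric.diam (closure Ω) with hR
  have hR0 : 0 ≤ R := Metric.diam_nonneg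
  set k₁ := 10 * M * 2 ^ (b - s) * c ^ b with hk₁
  set k₂ := 2 * M * c ^ s with hk₂
  have hk₁0 : 0 ≤ k₁ := by positivity
  have hk₂0 : 0 ≤ k₂ := by positivity
  set A := max c₁⁻¹ (2 * c) with hA
  have hA0 : 0 < A := lt_max_of_lt_left (by positivity)
  refine ⟨k₁ * (2 * c₂) ^ |q| + k₂ * A ^ |q|, k₁ * (R ^ q + c₁ ^ q) + k₂, by positivity,
    by positivity, fun u hu h c₃ c₄ K hh hK hG hMB => ⟨fun z hz x hx hxz => ?_, fun x hx => ?_⟩⟩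
  · intro t ht hxt a ha0 ha1 hax
    have hhμ : 0 < h ^ μ := Real.rpow_pos_of_pos hh μ
    have hδ := hΩ.bdist_pos hz.2
    have hδx := hΩ.ball_half_bdist hxz.le
    have hδx' : bdist Ω x ≤ 2 * bdist Ω z := by
      have := hΩ.le_bdist_add x z
      linarith
    have n1 : 0 ≤ k₁ * (2 * c₂) ^ |q| * (h ^ b * bdist Ω z ^ q) := by positivity
    have n2 : 0 ≤ k₂ * A ^ |q| * (h ^ b * bdist Ω z ^ q) := by positivity
    rw [add_mul]
    rcases (cell t ∩ frontier Ω).eq_empty_or_nonempty with he | hne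
    · have hlow := hMB.le_setDist t ht he
      have hup := hMB.bdist_le t ht he x hxt
      have hle := setDist_le_bdist hΩ hxt
      have h1 := hu.interp_error_of_not_touching hΩ hs hβ hβ4 hμ hc hh hK hG ht he
        ((by positivity : 0 < c₁ * h ^ μ).trans_le hlow) hxt ha0 ha1 hax
      set D := setDist (cell t) (frontier Ω)
      have hD : 0 < D := (by positivity : 0 < c₁ * h ^ μ).trans_le hlow
      have h2 : D ^ q ≤ (2 * c₂) ^ |q| * bdist Ω z ^ q :=
        rpow_le_of_comparable hD hδ (by positivity) (by nlinarith) (by linarith)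
      calc _ ≤ k₁ * (h ^ b * D ^ q) := h1
        _ ≤ k₁ * (h ^ b * ((2 * c₂) ^ |q| * bdist Ω z ^ q)) := by gcongr
        _ = k₁ * (2 * c₂) ^ |q| * (h ^ b * bdist Ω z ^ q) := by ring
        _ ≤ _ := by linarith
    · have h1 := hu.interp_error_of_touching hΩ hs hc hh hG ht hne hxt ha0 ha1
      have h3 : bdist Ω x ≤ c * h ^ μ :=
        (bdist_le_diam_of_touching hxt hne).trans ((hG t ht).1 hne).2
      have h4 := hMB.le_bdist z hz
      have h2 : (h ^ μ) ^ q ≤ A ^ |q| * bdist Ω z ^ q := by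
        refine rpow_le_of_comparable hhμ hδ hA0 ?_ ?_
        · calc h ^ μ = c₁⁻¹ * (c₁ * h ^ μ) := by field_simp
            _ ≤ A * bdist Ω z := mul_le_mul (le_max_left _ _) h4 (by positivity) hA0.le
        · calc bdist Ω z ≤ 2 * c * h ^ μ := by linarith
            _ ≤ A * h ^ μ := mul_le_mul_of_nonneg_right (le_max_right _ _) hhμ.le
      have e : h ^ (μ * s) = h ^ b * (h ^ μ) ^ q := by
        rw [← Real.rpow_mul hh.le, ← Real.rpow_add hh, hq]; congr 1; field_simp; ring
      calc _ ≤ k₂ * h ^ (μ * s) := h1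
        _ ≤ k₂ * (h ^ b * (A ^ |q| * bdist Ω z ^ q)) := by rw [e]; gcongr
        _ = k₂ * A ^ |q| * (h ^ b * bdist Ω z ^ q) := by ring
        _ ≤ _ := by linarith
  · intro t ht hxt a ha0 ha1 hax
    have hhμ : 0 < h ^ μ := Real.rpow_pos_of_pos hh μ
    have n0 : 0 ≤ max (h ^ (μ * s)) (h ^ b) := le_max_of_le_left (by positivity)
    have n1 : 0 ≤ k₁ * (R ^ q + c₁ ^ q) * max (h ^ (μ * s)) (h ^ b) := by positivity
    have n2 : 0 ≤ k₂ * max (h ^ (μ * s)) (h ^ b) := by positivity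
    rw [add_mul]
    rcases (cell t ∩ frontier Ω).eq_empty_or_nonempty with he | hne
    · have hlow := hMB.le_setDist t ht he
      have hle := (setDist_le_bdist hΩ hxt).trans (hΩ.bdist_le_diam hx)
      have h1 := hu.interp_error_of_not_touching hΩ hs hβ hβ4 hμ hc hh hK hG ht he
        ((by positivity : 0 < c₁ * h ^ μ).trans_le hlow) hxt ha0 ha1 hax
      have h2 := rpow_mul_rpow_le (s := s) (p := b) hh hμ0 hc₁ hlow hle
      calc _ ≤ k₁ * (h ^ b * setDist (cell t) (frontier Ω) ^ q) := h1
        _ ≤ k₁ * ((R ^ q + c₁ ^ q) * max (h ^ (μ * s)) (h ^ b)) := by gcongr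
        _ = k₁ * (R ^ q + c₁ ^ q) * max (h ^ (μ * s)) (h ^ b) := by ring
        _ ≤ _ := by linarith
    · have h1 := hu.interp_error_of_touching hΩ hs hc hh hG ht hne hxt ha0 ha1
      calc _ ≤ k₂ * h ^ (μ * s) := h1
        _ ≤ k₂ * max (h ^ (μ * s)) (h ^ b) := by gcongr; exact le_max_left _ _
        _ ≤ _ := by linarith

/-! ### The regularization scale -/

lemma regScale_eq {K : Geometry.SimplicialComplex ℝ (Rd d)} {z : Rd d}
    (hz : 0 ≤ patchSize K z) : regScale Ω K z = (patchSize K z * bdist Ω z / 4) ^ (1 / 2 : ℝ) := by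
  have hδ : 0 ≤ bdist Ω z := Metric.infDist_nonneg
  have h4 : (4 : ℝ) ^ (1 / 2 : ℝ) = 2 := by
    rw [← Real.sqrt_eq_rpow, show (4 : ℝ) = 2 ^ 2 by norm_num, Real.sqrt_sq (by norm_num)]
  rw [Real.div_rpow (by positivity) (by norm_num), Real.mul_rpow hz hδ, h4, regScale]
  ring

lemma regScale_rpow {K : Geometry.SimplicialComplex ℝ (Rd d)} {z : Rd d}
    (hz : 0 ≤ patchSize K z) (p : ℝ) :
    regScale Ω K z ^ p = (patchSize K z * bdist Ω z / 4) ^ (p / 2) := by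
  have hδ : 0 ≤ bdist Ω z := Metric.infDist_nonneg
  rw [regScale_eq hz, ← Real.rpow_mul (by positivity)]
  congr 1; ring

lemma regScale_le {K : Geometry.SimplicialComplex ℝ (Rd d)} {z : Rd d}
    (hz : 0 ≤ patchSize K z) (hzδ : patchSize K z ≤ bdist Ω z) :
    regScale Ω K z ≤ bdist Ω z / 2 := by
  have hδ : 0 ≤ bdist Ω z := Metric.infDist_nonneg
  rw [regScale_eq hz, ← Real.sqrt_eq_rpow]
  refine Real.sqrt_le_iff.2 ⟨by positivity, ?_⟩
  nlinarith

lemma regScale_pos {K : Geometry.SimplicialComplex ℝ (Rd d)} {z : Rd d}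
    (hz : 0 < patchSize K z) (hδ : 0 < bdist Ω z) : 0 < regScale Ω K z := by
  unfold regScale; positivity

/-- The regularization error at an interior vertex, multiplied by `δ^{2s}`. -/
lemma regularization_rate {K : Geometry.SimplicialComplex ℝ (Rd d)} {s β μ h c₄ : ℝ} {z : Rd d}
    (hμ : 0 < μ) (hh : 0 < h) (hβ : 2 * s < β) (hc₄ : 0 < c₄) (hz : 0 < patchSize K z)
    (hδ : 0 < bdist Ω z) (hup : patchSize K z ≤ c₄ * (h * bdist Ω z ^ ((μ - 1) / μ))) :
    bdist Ω z ^ (2 * s) * ((bdist Ω z / 2) ^ (s - β) * regScale Ω K z ^ (β - 2 * s)) ≤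
      2 ^ (β - s) * c₄ ^ (β / 2 - s) *
        (h ^ (β / 2 - s) * bdist Ω z ^ (s - (β / 2 - s) / μ)) := by
  set δ := bdist Ω z
  set p := β / 2 - s with hp
  have hp0 : 0 < p := by rw [hp]; linarith
  have h1 : regScale Ω K z ^ (β - 2 * s) ≤ c₄ ^ p * (h ^ p * δ ^ ((μ - 1) / μ * p)) * δ ^ p := by
    rw [regScale_rpow hz.le, show (β - 2 * s) / 2 = p by rw [hp]; ring,
      Real.rpow_mul hδ.le, ← Real.mul_rpow hh.le (by positivity),
      ← Real.mul_rpow hc₄.le (by positivity), ← Real.mul_rpow (by positivity) hδ.le]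
    refine Real.rpow_le_rpow (by positivity) ?_ hp0.le
    calc patchSize K z * δ / 4 ≤ patchSize K z * δ := by linarith [mul_pos hz hδ]
      _ ≤ _ := by gcongr
  have e1 : (δ / 2) ^ (s - β) = 2 ^ (β - s) * δ ^ (s - β) := by
    rw [Real.div_rpow hδ.le (by norm_num), ← neg_sub β s, Real.rpow_neg (by norm_num : (0:ℝ) ≤ 2)]
    field_simp
  have e2 : δ ^ (2 * s) * δ ^ (s - β) * (δ ^ ((μ - 1) / μ * p) * δ ^ p) = δ ^ (s - p / μ) := by
    rw [← Real.rpow_add hδ, ← Real.rpow_add hδ, ← Real.rpow_add hδ]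
    congr 1; rw [hp]; field_simp; ring
  rw [e1]
  calc _ ≤ δ ^ (2 * s) * (2 ^ (β - s) * δ ^ (s - β) *
        (c₄ ^ p * (h ^ p * δ ^ ((μ - 1) / μ * p)) * δ ^ p)) := by gcongr
    _ = 2 ^ (β - s) * c₄ ^ p * (h ^ p *
        (δ ^ (2 * s) * δ ^ (s - β) * (δ ^ ((μ - 1) / μ * p) * δ ^ p))) := by ring
    _ = _ := by rw [e2]

/-- The contribution of the interpolation error near an interior vertex, multiplied by
`δ^{2s}`. -/
lemma interpolation_rate {K : Geometry.SimplicialComplex ℝ (Rd d)} {s b μ h c₃ : ℝ} {z : Rd d}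
    (hμ : 0 < μ) (hh : 0 < h) (hs : 0 < s) (hc₃ : 0 < c₃) (hz : 0 < patchSize K z)
    (hδ : 0 < bdist Ω z) (hlow : c₃ * (h * bdist Ω z ^ ((μ - 1) / μ)) ≤ patchSize K z) :
    bdist Ω z ^ (2 * s) * (regScale Ω K z ^ (-(2 * s)) *
        (h ^ b * bdist Ω z ^ (s - b / μ))) ≤
      (c₃ / 4) ^ (-s) * (h ^ (b - s) * bdist Ω z ^ (s - (b - s) / μ)) := by
  set δ := bdist Ω z
  have h1 : regScale Ω K z ^ (-(2 * s)) ≤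
      (c₃ / 4) ^ (-s) * (h ^ (-s) * δ ^ ((μ - 1) / μ * -s)) * δ ^ (-s) := by
    rw [regScale_rpow hz.le, show -(2 * s) / 2 = -s by ring,
      Real.rpow_mul hδ.le, ← Real.mul_rpow hh.le (by positivity),
      ← Real.mul_rpow (by positivity) (by positivity), ← Real.mul_rpow (by positivity) hδ.le]
    refine Real.rpow_le_rpow_of_nonpos (by positivity) ?_ (by linarith)
    calc _ = c₃ * (h * δ ^ ((μ - 1) / μ)) * δ / 4 := by ring
      _ ≤ _ := by gcongr
  have e1 : h ^ (-s) * h ^ b = h ^ (b - s) := by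
    rw [← Real.rpow_add hh]; congr 1; ring
  have e2 : δ ^ (2 * s) * (δ ^ ((μ - 1) / μ * -s) * δ ^ (-s) * δ ^ (s - b / μ)) =
      δ ^ (s - (b - s) / μ) := by
    rw [← Real.rpow_add hδ, ← Real.rpow_add hδ, ← Real.rpow_add hδ]
    congr 1; field_simp; ring
  calc _ ≤ δ ^ (2 * s) * ((c₃ / 4) ^ (-s) * (h ^ (-s) * δ ^ ((μ - 1) / μ * -s)) * δ ^ (-s) *
        (h ^ b * δ ^ (s - b / μ))) := by gcongr
    _ = (c₃ / 4) ^ (-s) * ((h ^ (-s) * h ^ b) *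
        (δ ^ (2 * s) * (δ ^ ((μ - 1) / μ * -s) * δ ^ (-s) * δ ^ (s - b / μ)))) := by ring
    _ = _ := by rw [e1, e2]

/-! ### The error estimate -/

namespace MemFE0

variable {K : Geometry.SimplicialComplex ℝ (Rd d)} {w : Rd d → ℝ}

lemma measurable (hw : MemFE0 Ω K w) (hΩ : ConvexDomain Ω) : Measurable w :=
  measurable_of_continuousOn_of_eq_zero hΩ.isOpen (hw.1.mono subset_closure) hw.2.1

lemma exists_bound (hw : MemFE0 Ω K w) (hΩ : ConvexDomain Ω) : ∃ B, ∀ x, |w x| ≤ B := by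
  have hcomp : IsCompact (closure Ω) := hΩ.isBounded.isCompact_closure
  obtain ⟨B, hB⟩ := hcomp.exists_bound_of_continuousOn hw.1
  refine ⟨max B 0, fun x => ?_⟩
  by_cases hx : x ∈ Ω
  · exact (hB x (subset_closure hx)).trans (le_max_left _ _)
  · rw [hw.2.1 x hx, abs_zero]; exact le_max_right _ _

lemma neg (hw : MemFE0 Ω K w) : MemFE0 Ω K (-w) := by
  refine ⟨hw.1.neg, fun x hx => by simp [hw.2.1 x hx], fun t ht => ?_⟩
  obtain ⟨g, hg⟩ := hw.2.2 t ht
  exact ⟨-g, fun x hx => by simp [hg hx]⟩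

end MemFE0

lemma regOp_sub [Nontrivial (Rd d)] {s ε lam Lam B₁ B₂ : ℝ} {η : Metric.sphere (0 : Rd d) 1 → ℝ}
    (hs : s ∈ Ioo (0 : ℝ) 1) (hε : 0 < ε) (hη : KernelClass lam Lam η) (hlam : 0 < lam)
    {w₁ w₂ : Rd d → ℝ} (h₁ : Measurable w₁) (hB₁ : ∀ x, |w₁ x| ≤ B₁) (h₂ : Measurable w₂)
    (hB₂ : ∀ x, |w₂ x| ≤ B₂) (x : Rd d) :
    regOp s η ε (w₁ - w₂) x = regOp s η ε w₁ x - regOp s η ε w₂ x := by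
  rw [regOp_eq, regOp_eq, regOp_eq, ← mul_sub, ← integral_sub
    (hη.integrable_mul hlam (integrable_secDiff_mul_regKernel hs hε h₁ hB₁ x))
    (hη.integrable_mul hlam (integrable_secDiff_mul_regKernel hs hε h₂ hB₂ x))]
  congr 2 with y
  simp only [secDiff, Pi.sub_apply]
  ring

lemma regOp_neg (s ε : ℝ) (η : Metric.sphere (0 : Rd d) 1 → ℝ) (w : Rd d → ℝ) (x : Rd d) :
    regOp s η ε (-w) x = -regOp s η ε w x := by
  rw [regOp_eq, regOp_eq, ← mul_neg, ← integral_neg]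
  congr 2 with y
  simp only [secDiff, Pi.neg_apply]
  ring

/-- The bound on the largest nodal error: at the interior vertex `z` where it is attained, all the
error contributions are measured against `L_{η,ε}[1_Ω](z) ≈ δ(z)^{-2s}`. -/
lemma exists_nodal_const [Nontrivial (Rd d)] {s β μ lam Lam c₁ c₃ c₄ C₀ C₁ C₂ R : ℝ}
    (hs : s ∈ Ioo (0 : ℝ) 1) (hβ : 2 * s < β) (hμ : 1 ≤ μ) (hlam : 0 < lam) (hLam : lam ≤ Lam)
    (hc₁ : 0 < c₁) (hc₃ : 0 < c₃) (hc₄ : 0 < c₄) (hC₀ : 0 ≤ C₀) (hC₁ : 0 ≤ C₁) (hC₂ : 0 ≤ C₂)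
    (hΩ : ConvexDomain Ω) (hR : ∀ x ∈ Ω, bdist Ω x ≤ R) :
    ∃ C : ℝ, 0 ≤ C ∧ ∀ (η : Metric.sphere (0 : Rd d) 1 → ℝ), KernelClass lam Lam η →
      ∀ (h c₂ rate : ℝ) (K : Geometry.SimplicialComplex ℝ (Rd d)), 0 < h →
      IsTriangulation Ω K → MeshBounds Ω K μ h c₁ c₂ c₃ c₄ →
      h ^ (μ * s) ≤ rate → h ^ (min β 2 - s) ≤ rate → h ^ (β / 2 - s) ≤ rate →
      ∀ (w : Rd d → ℝ) (B : ℝ), Measurable w → (∀ x, |w x| ≤ B) → (∀ x, x ∉ Ω → w x = 0) →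
      ∀ z ∈ K.vertices ∩ Ω, 0 ≤ w z →
      regOp s η (regScale Ω K z) w z ≤
        C₀ * ((bdist Ω z / 2) ^ (s - β) * regScale Ω K z ^ (β - 2 * s)) →
      (∀ x ∈ Ω, ‖x - z‖ < bdist Ω z / 2 →
        w x ≤ w z + C₁ * (h ^ min β 2 * bdist Ω z ^ (s - min β 2 / μ))) →
      (∀ x ∈ Ω, w x ≤ w z + C₂ * rate) → w z ≤ C * rate := by
  have hμ0 : 0 < μ := by linarith
  have hLam0 : 0 < Lam := hlam.trans_le hLam
  have hR0 : 0 ≤ R := (hΩ.bdist_pos hΩ.nonempty.some_mem).le.trans (hR _ hΩ.nonempty.some_mem)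
  set b := min β 2 with hb
  have hk : 0 < lam / 2 * barrierConst d s := mul_pos (by positivity) (barrierConst_pos d s)
  set k := lam / 2 * barrierConst d s with hkdef
  have hmass := kernelMass_nonneg (d := d) hs
  have harea := sphereArea_nonneg d
  have hs0 := hs.1
  set Q : ℝ → ℝ := fun p => R ^ (s - p / μ) + c₁ ^ (s - p / μ) with hQ
  have hQ0 : ∀ p, 0 ≤ Q p := fun p => by positivity
  set C := (C₀ * (2 ^ (β - s) * c₄ ^ (β / 2 - s)) * Q (β / 2 - s) +
    Lam * (kernelMass d s * C₁ * (c₃ / 4) ^ (-s) * Q (b - s) +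
      sphereArea d / (2 * s) * 2 ^ (2 * s) * C₂)) / k with hC
  have hQ1 := hQ0 (β / 2 - s)
  have hQ2 := hQ0 (b - s)
  refine ⟨C, by positivity, fun η hη h c₂ rate K hh hK hMB hr1 hr2 hr3 w B hwm hwB hw0 z hz hwz
    hreg hnear hfar => ?_⟩
  have hδ := hΩ.bdist_pos hz.2
  have hlow := hMB.le_patchSize z hz
  have hup := hMB.patchSize_le z hz
  have hps : 0 < patchSize K z := lt_of_lt_of_le (by positivity) hlow
  have hpsδ := patchSize_le_bdist hΩ hK z
  have hε : 0 < regScale Ω K z := regScale_pos hps hδ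
  have hεz : regScale Ω K z ≤ bdist Ω z / 2 := regScale_le hps.le hpsδ
  have hrate : 0 ≤ rate := (by positivity : 0 ≤ h ^ (μ * s)).trans hr1
  have hmain := regOp_lower_bound hΩ hs hη hlam hz.2 hε hεz hwm hwB hw0 hwz rfl
    (E₁ := C₁ * (h ^ b * bdist Ω z ^ (s - b / μ))) (E₂ := C₂ * rate)
    (by positivity) (by positivity) hnear hfar
  have t1 := regularization_rate hμ0 hh hβ hc₄ hps hδ hup
  have t2 := interpolation_rate (b := b) hμ0 hh hs0 hc₃ hps hδ hlow
  have hδlow := hMB.le_bdist z hz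
  have r1 := rpow_mul_rpow_le (s := s) (p := β / 2 - s) hh hμ0 hc₁ hδlow (hR z hz.2)
  have r2 := rpow_mul_rpow_le (s := s) (p := b - s) hh hμ0 hc₁ hδlow (hR z hz.2)
  have r1' := r1.trans (mul_le_mul_of_nonneg_left (max_le hr1 hr3) hQ1)
  have r2' := r2.trans (mul_le_mul_of_nonneg_left (max_le hr1 hr2) hQ2)
  set δ := bdist Ω z with hδdef
  set ε := regScale Ω K z with hεdef
  have e1 : δ ^ (2 * s) * δ ^ (-(2 * s)) = 1 := by
    rw [← Real.rpow_add hδ]; simp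
  have e2 : δ ^ (2 * s) * (δ / 2) ^ (-(2 * s)) = 2 ^ (2 * s) := by
    rw [Real.div_rpow hδ.le (by norm_num), ← mul_div_assoc, e1,
      Real.rpow_neg (by norm_num : (0 : ℝ) ≤ 2)]
    simp
  have hδs : 0 ≤ δ ^ (2 * s) := by positivity
  have f1 : δ ^ (2 * s) * regOp s η ε w z ≤
      C₀ * (2 ^ (β - s) * c₄ ^ (β / 2 - s)) * Q (β / 2 - s) * rate := by
    calc _ ≤ δ ^ (2 * s) * (C₀ * ((δ / 2) ^ (s - β) * ε ^ (β - 2 * s))) := by gcongr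
      _ = C₀ * (δ ^ (2 * s) * ((δ / 2) ^ (s - β) * ε ^ (β - 2 * s))) := by ring
      _ ≤ C₀ * (2 ^ (β - s) * c₄ ^ (β / 2 - s) * (Q (β / 2 - s) * rate)) := by
          refine mul_le_mul_of_nonneg_left (t1.trans ?_) hC₀
          exact mul_le_mul_of_nonneg_left r1' (by positivity)
      _ = _ := by ring
  have f2 : δ ^ (2 * s) * (kernelMass d s * ε ^ (-(2 * s)) *
      (C₁ * (h ^ b * δ ^ (s - b / μ)))) ≤
      kernelMass d s * C₁ * (c₃ / 4) ^ (-s) * Q (b - s) * rate := by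
    calc _ = kernelMass d s * C₁ * (δ ^ (2 * s) * (ε ^ (-(2 * s)) *
          (h ^ b * δ ^ (s - b / μ)))) := by ring
      _ ≤ kernelMass d s * C₁ * ((c₃ / 4) ^ (-s) * (Q (b - s) * rate)) := by
          refine mul_le_mul_of_nonneg_left (t2.trans ?_) (by positivity)
          exact mul_le_mul_of_nonneg_left r2' (by positivity)
      _ = _ := by ring
  have f3 : δ ^ (2 * s) * (sphereArea d / (2 * s) * (δ / 2) ^ (-(2 * s)) * (C₂ * rate)) =
      sphereArea d / (2 * s) * 2 ^ (2 * s) * C₂ * rate := by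
    rw [← e2]; ring
  have hfin := mul_le_mul_of_nonneg_left hmain hδs
  rw [hC, div_mul_eq_mul_div, le_div_iff₀ hk]
  calc w z * k = (δ ^ (2 * s) * δ ^ (-(2 * s))) * (k * w z) := by rw [e1]; ring
    _ = δ ^ (2 * s) * (k * δ ^ (-(2 * s)) * w z) := by ring
    _ ≤ _ := hfin
    _ = δ ^ (2 * s) * regOp s η ε w z + Lam * (δ ^ (2 * s) * (kernelMass d s * ε ^ (-(2 * s)) *
          (C₁ * (h ^ b * δ ^ (s - b / μ)))) + δ ^ (2 * s) * (sphereArea d / (2 * s) *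
          (δ / 2) ^ (-(2 * s)) * (C₂ * rate))) := by ring
    _ ≤ _ := by
      rw [f3]
      have := mul_le_mul_of_nonneg_left f2 hLam0.le
      linarith

/-- The one-sided error estimate for functions that solve the regularized equation at the interior
vertices up to the regularization error. -/
lemma exists_one_sided_const [Nontrivial (Rd d)] {s β μ lam Lam κ c M C₀ : ℝ}
    (hs : s ∈ Ioo (0 : ℝ) 1) (hβ : 2 * s < β) (hβ4 : β < 4) (hμ : 1 ≤ μ) (hlam : 0 < lam)
    (hLam : lam ≤ Lam) (hκ : 0 < κ) (hc : 0 < c) (hM : 0 ≤ M) (hC₀ : 0 ≤ C₀)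
    (hΩ : ConvexDomain Ω) :
    ∃ C : ℝ, 0 ≤ C ∧ ∀ (η : Metric.sphere (0 : Rd d) 1 → ℝ), KernelClass lam Lam η →
      ∀ (u : Rd d → ℝ), ZeroTraceSClass s β Ω M u →
      ∀ (h rate : ℝ) (K : Geometry.SimplicialComplex ℝ (Rd d)), 0 < h →
      IsTriangulation Ω K → ShapeRegular κ K → IsGraded Ω μ c h K →
      h ^ (μ * s) ≤ rate → h ^ (min β 2 - s) ≤ rate → h ^ (β / 2 - s) ≤ rate →
      ∀ uh : Rd d → ℝ, MemFE0 Ω K uh →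
      (∀ z ∈ K.vertices ∩ Ω, 0 < regScale Ω K z → regScale Ω K z ≤ bdist Ω z / 2 →
        regOp s η (regScale Ω K z) (u - uh) z ≤
          C₀ * ((bdist Ω z / 2) ^ (s - β) * regScale Ω K z ^ (β - 2 * s))) →
      ∀ x ∈ Ω, u x - uh x ≤ C * rate := by
  have hμ0 : 0 < μ := by linarith
  obtain ⟨c₁, c₂, c₃, c₄, hc₁, hc₂, hc₃, hc₄, hMB⟩ := exists_meshBounds hμ hκ hc
  obtain ⟨C₁, C₂, hC₁, hC₂, hI⟩ := exists_interpError_const hs (by linarith [hs.1]) hβ4 hμ hc hc₁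
    hc₂ hM hΩ
  set b := min β 2 with hb
  set H := (c * Metric.diam (closure Ω)) ^ (1 / μ) with hH
  have hH0 : 0 ≤ H := by have : 0 ≤ Metric.diam (closure Ω) := Metric.diam_nonneg; positivity
  have hG0 : 0 ≤ C₂ * (1 + H ^ s) := by positivity
  obtain ⟨C, hC, hN⟩ := exists_nodal_const hs hβ hμ hlam hLam hc₁ hc₃ hc₄ hC₀ hC₁ hG0 hΩ
    (R := Metric.diam (closure Ω)) fun x hx => hΩ.bdist_le_diam hx
  refine ⟨C + C₂ * (1 + H ^ s), by positivity, fun η hη u hu h rate K hh hK hS hG hr1 hr2 hr3 uh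
    huh hreg x hx => ?_⟩
  have hmb := hMB d Ω h K ‹_› hΩ hh hK hS hG
  obtain ⟨hloc, hglob⟩ := hI u hu h c₃ c₄ K hh hK hG hmb
  have hrate : 0 ≤ rate := (by positivity : 0 ≤ h ^ (μ * s)).trans hr1
  obtain ⟨B, hB⟩ := huh.exists_bound hΩ
  have huB := hu.memS.abs_le_univ hΩ hu.zero
  -- the global interpolation error in terms of the rate
  have hmax : C₂ * max (h ^ (μ * s)) (h ^ b) ≤ C₂ * (1 + H ^ s) * rate := by
    rw [mul_assoc]
    refine mul_le_mul_of_nonneg_left (max_le ?_ ?_) hC₂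
    · nlinarith [mul_nonneg (by positivity : 0 ≤ H ^ s) hrate]
    · have e : h ^ b = h ^ s * h ^ (b - s) := by rw [← Real.rpow_add hh]; congr 1; ring
      have h1 : h ^ s ≤ H ^ s :=
        Real.rpow_le_rpow hh.le (mesh_size_le hμ0 hc hh hΩ hK hG) hs.1.le
      have h2 : h ^ s * h ^ (b - s) ≤ H ^ s * rate := mul_le_mul h1 hr2 (by positivity)
        (by positivity)
      rw [e]; nlinarith
  set m := C * rate with hm
  have hm0 : 0 ≤ m := by positivity
  have hvert : ∀ z ∈ K.vertices ∩ Ω, u z - uh z ≤ m := by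
    by_contra! hcon
    obtain ⟨z₁, hz₁, hz₁m⟩ := hcon
    obtain ⟨z, hz, hmaxz⟩ := (hK.finite_vertices.inter_of_left Ω).exists_maximalFor
      (fun y => u y - uh y) _ ⟨z₁, hz₁⟩
    have hmax' : ∀ y ∈ K.vertices ∩ Ω, u y - uh y ≤ u z - uh z := fun y hy =>
      (le_total (u y - uh y) (u z - uh z)).elim id fun h' => hmaxz hy h'
    have hpos : 0 ≤ u z - uh z := by linarith [hmax' z₁ hz₁]
    have hnode : ∀ t ∈ elements K, ∀ v ∈ t, u v - uh v ≤ u z - uh z := fun t ht v hv => by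
      by_cases hvΩ : v ∈ Ω
      · exact hmax' v ⟨mem_vertices_of_mem ht hv, hvΩ⟩
      · rw [hu.zero v hvΩ, huh.2.1 v hvΩ, sub_zero]; exact hpos
    have hδ := hΩ.bdist_pos hz.2
    have hps : 0 < patchSize K z := lt_of_lt_of_le (by positivity) (hmb.le_patchSize z hz)
    have := hN η hη h c₂ rate K hh hK hmb hr1 hr2 hr3 (u - uh) (M + B)
      ((hu.memS.measurable hΩ hu.zero).sub (huh.measurable hΩ))
      (fun y => (abs_sub _ _).trans (add_le_add (huB y) (hB y)))
      (fun y hy => by simp [hu.zero y hy, huh.2.1 y hy]) z hz hpos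
      (hreg z hz (regScale_pos hps hδ) (regScale_le hps.le (patchSize_le_bdist hΩ hK z)))
      (fun y hy hyz => (hloc z hz y hy hyz).sub_le hK huh (subset_closure hy) hnode)
      (fun y hy => ((hglob y hy).sub_le hK huh (subset_closure hy) hnode).trans
        (by simpa using hmax))
    simp only [Pi.sub_apply] at this
    linarith [hmax' z₁ hz₁]
  have hnode : ∀ t ∈ elements K, ∀ v ∈ t, u v - uh v ≤ m := fun t ht v hv => by
    by_cases hvΩ : v ∈ Ω
    · exact hvert v ⟨mem_vertices_of_mem ht hv, hvΩ⟩
    · rw [hu.zero v hvΩ, huh.2.1 v hvΩ, sub_zero]; exact hm0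
  have := (hglob x hx).sub_le hK huh (subset_closure hx) hnode
  rw [add_mul]
  linarith

end TwoScale
end

theorem theorem4p5 (d : ℕ) (hd : 1 ≤ d) (Ω : Set (TwoScale.Rd d))
    (hΩ : TwoScale.IsConvexPolytope Ω)
    (s β μ lam Lam κ c M : ℝ)
    (hs : s ∈ Set.Ioo (0 : ℝ) 1)
    (hβ : 2 * s < β) (hβ4 : β ≤ 4)
    (hβN : ∀ n : ℕ, β ≠ n) (hβsN : ∀ n : ℕ, β - 2 * s ≠ n)
    (hμ : 1 ≤ μ) (hlam : 0 < lam) (hLam : lam ≤ Lam)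
    (hκ : 0 < κ) (hc : 0 < c) :
    ∃ C : ℝ, 0 < C ∧
      ∀ η : Metric.sphere (0 : TwoScale.Rd d) 1 → ℝ,
        TwoScale.KernelClass lam Lam η →
        (∀ k : ℕ, 1 ≤ k → (k : ℝ) < β → TwoScale.KernelContDiff k η) →
      ∀ f : TwoScale.Rd d → ℝ,
        TwoScale.MemHolder (β - 2 * s) f Ω →
        (∃ B : ℝ, ∀ x ∈ Ω, |f x| ≤ B) →
        TwoScale.WeightedHolderFinite (β - 2 * s) s f Ω →
      ∀ u : TwoScale.Rd d → ℝ,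
        TwoScale.MemSClass s β Ω M u →
        TwoScale.IsWeakSolution s η Ω f u →
      ∀ (h : ℝ) (K : Geometry.SimplicialComplex ℝ (TwoScale.Rd d)),
        0 < h →
        TwoScale.IsTriangulation Ω K →
        TwoScale.ShapeRegular κ K →
        TwoScale.IsGraded Ω μ c h K →
      ∀ uh : TwoScale.Rd d → ℝ,
        TwoScale.IsDiscreteSolution s η Ω K f uh →
        ∀ x ∈ Ω, |u x - uh x| ≤
          C * max (h ^ (μ * s)) (max (h ^ (min β 2 - s)) (h ^ (β / 2 - s))) := by
  open TwoScale in
  have hD : ConvexDomain Ω := hΩ.convexDomain hd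
  have : Nonempty (Fin d) := ⟨⟨0, hd⟩⟩
  have hnt : Nontrivial (Rd d) := inferInstance
  have hβ4' : β < 4 := lt_of_le_of_ne hβ4 (by exact_mod_cast hβN 4)
  -- no function is of class `S^β` with a negative constant
  rcases lt_or_ge M 0 with hM | hM
  · refine ⟨1, one_pos, fun η _ _ f _ _ _ u hu => ?_⟩
    exact absurd (hu.nonneg hD) (not_le.2 hM)
  set C₀ := Lam * (kernelRatio d s * M * (sphereArea d / (β - 2 * s))) with hC₀
  have hC₀0 : 0 ≤ C₀ := by
    have h1 := one_le_kernelRatio (d := d) hs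
    have h2 := sphereArea_nonneg d
    have h3 : 0 < β - 2 * s := by linarith
    have h4 : 0 < Lam := hlam.trans_le hLam
    positivity
  obtain ⟨C, hC, hest⟩ := exists_one_sided_const hs hβ hβ4' hμ hlam hLam hκ hc hM hC₀0 hD
  refine ⟨C + 1, by linarith, fun η hη _ f hf hfB _ u hu huw h K hh hK hS hG uh huh x hx => ?_⟩
  set rate := max (h ^ (μ * s)) (max (h ^ (min β 2 - s)) (h ^ (β / 2 - s))) with hrate
  have hr1 : h ^ (μ * s) ≤ rate := le_max_left _ _
  have hr2 : h ^ (min β 2 - s) ≤ rate := (le_max_left _ _).trans (le_max_right _ _)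
  have hr3 : h ^ (β / 2 - s) ≤ rate := (le_max_right _ _).trans (le_max_right _ _)
  have hrate0 : 0 ≤ rate := (Real.rpow_pos_of_pos hh _).le.trans hr1
  have hpt : ∀ z ∈ Ω, singOp s η u z = f z := fun z hz =>
    hu.singOp_eq hD hs hβ hβ4' hη hlam huw hf.1.continuousOn hz
  obtain ⟨B, hB⟩ := hfB
  have hZ : ZeroTraceSClass s β Ω M u := ⟨hu, huw.1.1, fun y hy =>
    hu.abs_le_bdist_rpow hD huw.1.1 hs hβ hβ4' hη hlam
      (fun z hz => by rw [hpt z hz]; exact hB z hz) hy⟩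
  obtain ⟨Bh, hBh⟩ := huh.1.exists_bound hD
  have hres : ∀ z ∈ K.vertices ∩ Ω, 0 < regScale Ω K z → regScale Ω K z ≤ bdist Ω z / 2 →
      |regOp s η (regScale Ω K z) (u - uh) z| ≤
        C₀ * ((bdist Ω z / 2) ^ (s - β) * regScale Ω K z ^ (β - 2 * s)) := by
    intro z hz hε hεz
    rw [regOp_sub hs hε hη hlam (hu.measurable hD huw.1.1) (hu.abs_le_univ hD huw.1.1)
      (huh.1.measurable hD) hBh, huh.2 z hz, ← hpt z hz.2]
    exact hu.abs_regOp_sub_singOp_le hD huw.1.1 hs hβ hβ4' hη hlam hz.2 hε hεz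
  have h1 := hest η hη u hZ h rate K hh hK hS hG hr1 hr2 hr3 uh huh.1
    (fun z hz hε hεz => (abs_le.1 (hres z hz hε hεz)).2) x hx
  have h2 := hest η hη (-u) hZ.neg h rate K hh hK hS hG hr1 hr2 hr3 (-uh) huh.1.neg
    (fun z hz hε hεz => by
      rw [show -u - -uh = -(u - uh) by ring, regOp_neg]
      linarith [(abs_le.1 (hres z hz hε hεz)).1]) x hx
  simp only [Pi.neg_apply] at h2
  rw [abs_le]
  constructor <;> nlinarith
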